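/- Let $s>\frac32$ and let $H^s_{df}(\mathbb R^3)$ be the space of divergence free vector fields $\mathbb R^3\to\mathbb R^3$ with finite norm $\|f\|_{H^s}=\left(\int(1+4\pi^2|\xi|^2)^s|\hat f(\xi)|^2\,d\xi\right)^{1/2}$, whose elements are identified with their continuous representatives. For $x=(r\cos\theta,r\sin\theta,z)$ put $e_\theta=(-\sin\theta,\cos\theta,0)$, and let $H^s_*$ be the set of all $\omega\in H^s_{df}$ of the form $\omega(x)=\omega_\theta(r,z)e_\theta$ (the vorticities of axisymmetric, swirl-free velocity fields). Let $\Omega=\operatorname{supp}\omega_\theta\subset\{(r,z):r\ge0\}$. The inviscid vortex stretching equation is $$\partial_t\omega=P_{df}\big((\omega\cdot\nabla)u\big),\qquad u=\nabla\times(-\Delta)^{-1}\omega,$$ where $P_{df}$ is the Helmholtz projection onto divergence free fields. A solution on $[0,T)$ with initial data $\omega^0$ is an $\omega\in C^1([0,T);H^s_{df})$ with $\omega(0)=\omega^0$ that satisfies the equation for all $0\le t<T$. **Theorem.** Let $\omega^0\in H^s_*(\mathbb R^3)$, $s>\frac32$, be such that 1. $\omega^0$ is not identically zero; 2. $\omega^0_\theta(r,z)$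 is odd in $z$; 3. the support $\Omega^0$ of $\omega^0_\theta$ is compact and does not meet the axis $r=0$ or the plane $z=0$; 4. $\omega^0_\theta(r,z)\le0$ for all $r,z\ge0$. Let $\Omega^0_+=\Omega^0\cap\{r,z\ge0\}$ and $$\kappa=\frac1{2\pi}\inf_{(r,z),(\bar r,\bar z)\in\Omega^0_+}\int_0^1\frac{(z+\bar z)\,\sigma(1-\sigma^2)^{-1/2}}{r\bar r}\left(\frac1{\left((z+\bar z)^2+r^2+\bar r^2-2r\bar r\sigma\right)^{3/2}}-\frac1{\left((z+\bar z)^2+r^2+\bar r^2+2r\bar r\sigma\right)^{3/2}}\right)d\sigma,$$ $$Q^0=-\int_0^\infty\!\int_0^\infty r^2\,\omega^0_\theta(r,z)\,dr\,dz .$$ Then $\kappa>0$, and there are a finite time $T_{max}>0$ and a unique maximal solution $\omega$ on $[0,T_{max})$ with initial data $\omega^0$ (every solution with these data on an interval $[0,T)$ has $T\le T_{max}$ and coincides with $\omega$ on $[0,T)$). For all $0\le t<T_{max}$, $\omega(\cdot,t)$ belongs to $H^s_*$ and has the properties 1–4, with $\operatorname{supp}\omega_\theta(\cdot,t)=\Omega^0$.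 The solution blows up in finite time: $\|\omega(\cdot,t)\|_{H^s}\to\infty$ as $t\to T_{max}^-$, and $$T_{max}\le\frac1{\kappa Q^0}.$$ -/

import Mathlib

open MeasureTheory Filter Topology Set
open scoped FourierTransform ENNReal

namespace VortexStretching

/-- Physical space `ℝ³` (Euclidean norm); coordinates are `x 0`, `x 1`, `x 2`. -/
abbrev E3 := EuclideanSpace ℝ (Fin 3)

/-- `ℂ³`, where Fourier transforms of vector fields take their values. -/
abbrev C3 := EuclideanSpace ℂ (Fin 3)

/-! ### Sobolev spaces of vector fields -/

/-- A real vector field, seen as a complex one. -/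
def complexify (f : E3 → E3) : E3 → C3 :=
  fun x => WithLp.toLp 2 (fun i => ((f x i : ℝ) : ℂ))

open Classical in
/-- The (Plancherel) Fourier transform `f̂` of a square integrable real vector field, with the
normalization `f̂ ξ = ∫ exp (-2πi x·ξ) f x dx`; by convention `0` if `f` is not in `L²`. -/
noncomputable def hat (f : E3 → E3) : E3 → C3 :=
  if h : MemLp (complexify f) 2 (volume : Measure E3) then
    ((𝓕 (h.toLp (complexify f)) : Lp C3 2 (volume : Measure E3)) : E3 → C3)
  else 0

open Classical in
/-- The norm `‖f‖_{H^s} = (∫ (1 + 4π²|ξ|²)^s |f̂ ξ|² dξ)^{1/2}`, for `s ≥ 0`, with values in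
`[0, ∞]`; it is `∞` if `f` is not in `L²`. -/
noncomputable def hsNorm (s : ℝ) (f : E3 → E3) : ℝ≥0∞ :=
  if MemLp (complexify f) 2 (volume : Measure E3) then
    (∫⁻ ξ : E3, ENNReal.ofReal ((1 + 4 * Real.pi ^ 2 * ‖ξ‖ ^ 2) ^ s) * ‖hat f ξ‖ₑ ^ 2)
      ^ (1 / 2 : ℝ)
  else ⊤

/-- `f ∈ H^s(ℝ³; ℝ³)`. For `s > 3/2` (the only case in use) every class in `H^s` has exactly one
continuous representative, and the elements of `H^s` are taken to be these functions. -/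
def MemHs (s : ℝ) (f : E3 → E3) : Prop :=
  Continuous f ∧ hsNorm s f < ⊤

/-- A real vector as a triple of complex numbers. -/
def toComplex (ξ : E3) : Fin 3 → ℂ := fun i => ((ξ i : ℝ) : ℂ)

/-- Divergence free fields, `H^s_df`: `ξ · f̂(ξ) = 0`. -/
def MemHsDf (s : ℝ) (f : E3 → E3) : Prop :=
  MemHs s f ∧ ∀ᵐ ξ : E3, ∑ i, toComplex ξ i * hat f ξ i = 0

/-- Gradient fields, `H^s_gr`: `ξ × f̂(ξ) = 0`. -/
def MemHsGr (s : ℝ) (f : E3 → E3) : Prop :=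
  MemHs s f ∧ ∀ᵐ ξ : E3, crossProduct (toComplex ξ) (hat f ξ).ofLp = 0

/-- `w = P_df v`: the vector field `v ∈ H^s` splits as the sum of `w ∈ H^s_df` and an
element of `H^s_gr`. -/
def IsHelmholtzProj (s : ℝ) (v w : E3 → E3) : Prop :=
  MemHs s v ∧ MemHsDf s w ∧ MemHsGr s (v - w)

/-! ### The equation -/

/-- The Fourier transform of `∇ × (-Δ)⁻¹ ω`, that is `(2πi ξ) × ω̂(ξ) / (4π²|ξ|²)`. -/
noncomputable def velocityHat (ω : E3 → E3) : E3 → C3 :=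
  fun ξ => WithLp.toLp 2
    ((((4 * Real.pi ^ 2 * ‖ξ‖ ^ 2 : ℝ) : ℂ))⁻¹ •
      crossProduct ((2 * (Real.pi : ℂ) * Complex.I) • toComplex ξ) (hat ω ξ).ofLp)

/-- The velocity `u = ∇ × (-Δ)⁻¹ ω`. For `ω ∈ H^s`, `s > 3/2`, its Fourier transform is
integrable, also after multiplication by `|ξ|`, so that `u` is given pointwise by the inverse
Fourier integral, is real valued, and is of class `C¹`. -/
noncomputable def velocity (ω : E3 → E3) : E3 → E3 :=
  fun x => WithLp.toLp 2 (fun i => (𝓕⁻ (velocityHat ω) x i).re)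

/-- The vortex stretching term `(ω · ∇) u = ∑ⱼ ωⱼ ∂ⱼ u`, with `u = ∇ × (-Δ)⁻¹ ω`. -/
noncomputable def stretching (ω : E3 → E3) : E3 → E3 :=
  fun x => fderiv ℝ (velocity ω) x (ω x)

/-- `ω ∈ C¹([0, T); H^s_df)` is a strong solution, with initial data `ω₀`, of
`∂ₜ ω = P_df ((ω · ∇) u)`, `u = ∇ × (-Δ)⁻¹ ω`. The time derivative `ω'` is taken in the norm of
`H^s` (one-sided at `t = 0`), and is continuous in that norm. -/
def IsSolution (s : ℝ) (ω₀ : E3 → E3) (T : ℝ) (ω : ℝ → E3 → E3) : Prop :=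
  0 < T ∧ ω 0 = ω₀ ∧ (∀ t ∈ Ico 0 T, MemHsDf s (ω t)) ∧
  ∃ ω' : ℝ → E3 → E3,
    (∀ t ∈ Ico 0 T, IsHelmholtzProj s (stretching (ω t)) (ω' t)) ∧
    (∀ t ∈ Ico 0 T, Tendsto (fun τ => hsNorm s ((τ - t)⁻¹ • (ω τ - ω t) - ω' t))
      (𝓝[Ico 0 T \ {t}] t) (𝓝 0)) ∧
    (∀ t ∈ Ico 0 T, Tendsto (fun τ => hsNorm s (ω' τ - ω' t)) (𝓝[Ico 0 T] t) (𝓝 0))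

/-- `ω` is the solution with initial data `ω₀`, and `T` is its maximal time of existence: every
solution with the same data lives on a subinterval of `[0, T)` and coincides with `ω` there. -/
def IsMaximalSolution (s : ℝ) (ω₀ : E3 → E3) (T : ℝ) (ω : ℝ → E3 → E3) : Prop :=
  IsSolution s ω₀ T ω ∧
  ∀ (T' : ℝ) (ω' : ℝ → E3 → E3), IsSolution s ω₀ T' ω' →
    T' ≤ T ∧ ∀ t ∈ Ico 0 T', ω' t = ω t

/-! ### Axisymmetric, swirl-free vorticity -/

/-- The distance `r` to the axis. -/
noncomputable def radius (x : E3) : ℝ := Real.sqrt (x 0 ^ 2 + x 1 ^ 2)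

/-- The unit vector `e_θ = (-sin θ, cos θ, 0)`, with the value `0` on the axis. -/
noncomputable def eTheta (x : E3) : E3 := !₂[-x 1 / radius x, x 0 / radius x, 0]

/-- The component `ω_θ(r, z)`, `r ≥ 0`, read off in the half plane `θ = 0`, where
`e_θ = (0, 1, 0)`. -/
def omegaTheta (ω : E3 → E3) (r z : ℝ) : ℝ := ω !₂[r, 0, z] 1

/-- The space `H^s_*`: fields in `H^s_df` of the form `ω(x) = ω_θ(r, z) e_θ`. (A continuous field
of this form vanishes on the axis.) -/
def MemHsStar (s : ℝ) (ω : E3 → E3) : Prop :=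
  MemHsDf s ω ∧ ∀ x, ω x = omegaTheta ω (radius x) (x 2) • eTheta x

/-- The support `Ω` of `ω_θ` in the half plane `Π = {(r, z) : r ≥ 0}`. -/
def vortSupport (ω : E3 → E3) : Set (ℝ × ℝ) :=
  closure {p : ℝ × ℝ | 0 ≤ p.1 ∧ omegaTheta ω p.1 p.2 ≠ 0}

/-- The part `Ω₊` of the support in `Π₊ = {(r, z) : r ≥ 0, z ≥ 0}`. -/
def upperSupport (ω : E3 → E3) : Set (ℝ × ℝ) :=
  vortSupport ω ∩ {p : ℝ × ℝ | 0 ≤ p.1 ∧ 0 ≤ p.2}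

/-- The properties of the vorticity: it is in `H^s_*`, is not identically zero, `ω_θ` is odd
in `z`, compactly supported away from the axis `r = 0` and the plane `z = 0`, and nonpositive for
`r, z ≥ 0`. -/
structure IsCollidingRings (s : ℝ) (ω : E3 → E3) : Prop where
  memHsStar : MemHsStar s ω
  ne_zero : ω ≠ 0
  odd : ∀ r z : ℝ, 0 ≤ r → omegaTheta ω r (-z) = -omegaTheta ω r z
  isCompact_support : IsCompact (vortSupport ω)
  support_away : ∀ p ∈ vortSupport ω, p.1 ≠ 0 ∧ p.2 ≠ 0
  nonpos : ∀ r z : ℝ, 0 ≤ r → 0 ≤ z → omegaTheta ω r z ≤ 0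

/-- The integrand of `κ`, as a function of `p = (r, z)`, `q = (r̄, z̄)` and `σ`. -/
noncomputable def kappaIntegrand (p q : ℝ × ℝ) (σ : ℝ) : ℝ :=
  (p.2 + q.2) * σ * (1 - σ ^ 2) ^ (-(1 / 2) : ℝ) / (p.1 * q.1) *
    (1 / ((p.2 + q.2) ^ 2 + p.1 ^ 2 + q.1 ^ 2 - 2 * p.1 * q.1 * σ) ^ (3 / 2 : ℝ) -
      1 / ((p.2 + q.2) ^ 2 + p.1 ^ 2 + q.1 ^ 2 + 2 * p.1 * q.1 * σ) ^ (3 / 2 : ℝ))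

/-- The constant `κ`, a function of the set `Ω₊`. -/
noncomputable def kappa (A : Set (ℝ × ℝ)) : ℝ :=
  1 / (2 * Real.pi) * ⨅ pq : ↥(A ×ˢ A), ∫ σ in (0 : ℝ)..1, kappaIntegrand pq.1.1 pq.1.2 σ

/-- `Q = -∫₀^∞ ∫₀^∞ r² ω_θ(r, z) dr dz`. -/
noncomputable def Q (ω : E3 → E3) : ℝ :=
  -∫ z in Ioi (0 : ℝ), ∫ r in Ioi (0 : ℝ), r ^ 2 * omegaTheta ω r z

end VortexStretching

/-!
The Sobolev space is handled on the Fourier side, as the `L²` space of the measure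
`sobolevMeasure s = (1 + 4π²|ξ|²)^s dξ`. Since `s > 3/2`, this space embeds in `L¹`, and therefore
it is closed under convolution. The velocity gradient is a Fourier multiplier of order zero in `ω`,
so the stretching term is a bounded quadratic map of `H^s`, and locally Lipschitz continuous
(`hsNorm_stretching_sub_le`). At each point it is bounded by a multiple of `‖ω‖_{H^s} |ω(x)|`
(`enorm_stretching_le`).

*Symmetry removes the projection.* The fields `ω_θ(r, z) e_θ` with `ω_θ` odd in `z` are exactly the
fields that transform as pseudovectors under all the isometries preserving the axis and the plane
`z = 0` (`IsAxial`). By the Biot–Savart law (`velocity_eq_integral`) the stretching term has the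
same symmetry (`IsAxial.stretching`), and such fields are divergence free (`IsAxial.memHsDf`).
On them the equation is the ordinary differential equation `ω' = (ω · ∇) u`, in the closed subspace
`ringSpace` of the fields with this symmetry and with the support of `ω_θ` in a given compact set.
The Picard–Lindelöf theorem provides a maximal solution, whose norm tends to infinity if its
lifespan is finite (`exists_maximal_flowLine`). Uniqueness in the larger class of all solutions in
`H^s_df` holds because the Helmholtz projection is a contraction
(`IsHelmholtzProj.norm_toSob_sub_le`), by Gronwall's inequality (`IsSolution.eq`). For a fixed
point `x` the pointwise bound gives `|∂ₜ ω| ≤ C |ω|`, so that zeros and signs of `ω_θ`, and with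
them its support, do not change (`IsFlowLine.omegaTheta_preserved`).

*Blow-up.* Up to a constant, `Q` is the integral of the angular component `r ω_θ` over the half
space `z > 0`. Rotational symmetry and the Biot–Savart law write its rate of change as a double
integral of a kernel that is antisymmetric in the two vortex elements. The interaction of the upper
half space with itself cancels, and what is left is the interaction with the mirror images
(`IsAxial.Q_stretching`). Integrated over circles, its kernel becomes the positive integral in the
definition of `κ`, and so `Q' ≥ κ Q²` (`IsAxial.kappa_mul_Q_sq_le`), with `κ > 0` because the
support is compact and away from the axis and the plane (`kappa_pos`). A positive solution of this
Riccati inequality exists at most until `1 / (κ Q⁰)` (`le_one_div_of_riccati`).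
-/

namespace VortexStretching

/-! ### The Fourier transform and the weighted `L²` space -/

theorem continuous_fourier {F : Type*} [NormedAddCommGroup F] [NormedSpace ℂ F]
    {g : E3 → F} (hg : Integrable g) : Continuous (𝓕 g) :=
  VectorFourier.fourierIntegral_continuous Real.continuous_fourierChar
    (by exact (innerSL ℝ).continuous₂) hg

theorem continuous_fourierInv {F : Type*} [NormedAddCommGroup F] [NormedSpace ℂ F]
    {g : E3 → F} (hg : Integrable g) : Continuous (𝓕⁻ g) :=
  VectorFourier.fourierIntegral_continuous Real.continuous_fourierChar
    (by exact (innerSL ℝ).continuous₂.neg) hg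

/-- Two locally integrable fields with the same pairings with Schwartz functions agree. -/
theorem ae_eq_of_integral_schwartz_smul_eq {u v : E3 → C3} (hu : LocallyIntegrable u)
    (hv : LocallyIntegrable v) (h : ∀ ψ : SchwartzMap E3 ℂ, ∫ x, ψ x • u x = ∫ x, ψ x • v x) :
    u =ᵐ[volume] v := by
  refine ae_eq_of_integral_contDiff_smul_eq hu hv fun φ hφ hφc => ?_
  have hc : HasCompactSupport (Complex.ofRealCLM ∘ φ) := hφc.comp_left rfl
  have hd : ContDiff ℝ ((⊤ : ℕ∞) : WithTop ℕ∞) (Complex.ofRealCLM ∘ φ) := by fun_prop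
  simpa using h (hc.toSchwartzMap hd)

/-- The inverse Fourier transforms of `L¹` and of `L²` agree. -/
theorem fourierInv_toLp_ae_eq {g : E3 → C3} (h1 : Integrable g) (h2 : MemLp g 2 volume) :
    ((𝓕⁻ (h2.toLp g) : Lp C3 2 (volume : Measure E3)) : E3 → C3) =ᵐ[volume] 𝓕⁻ g := by
  refine ae_eq_of_integral_schwartz_smul_eq ((Lp.memLp _).locallyIntegrable one_le_two)
    (continuous_fourierInv h1).locallyIntegrable fun ψ => ?_
  have key := congrArg (fun D : TemperedDistribution E3 C3 => D ψ)
    (Lp.fourierInv_toTemperedDistribution_eq (h2.toLp g))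
  simp only [TemperedDistribution.fourierInv_apply, Lp.toTemperedDistribution_apply] at key
  have hflip := VectorFourier.integral_fourierIntegral_smul_eq_flip (e := Real.fourierChar)
    (μ := (volume : Measure E3)) (ν := (volume : Measure E3)) (L := -innerₗ E3)
    (f := (ψ : E3 → ℂ)) (g := g) Real.continuous_fourierChar
    (by exact (innerSL ℝ).continuous₂.neg) ψ.integrable h1
  rw [show (-innerₗ E3).flip = -innerₗ E3 by ext x y; simp [real_inner_comm]] at hflip
  refine key.symm.trans (Eq.trans (integral_congr_ae ?_) hflip)
  filter_upwards [h2.coeFn_toLp] with x hx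
  rw [hx, SchwartzMap.fourierInv_coe]
  rfl

/-- The Fourier transforms of `L¹` and of `L²` agree. -/
theorem fourier_toLp_ae_eq {g : E3 → C3} (h1 : Integrable g) (h2 : MemLp g 2 volume) :
    ((𝓕 (h2.toLp g) : Lp C3 2 (volume : Measure E3)) : E3 → C3) =ᵐ[volume] 𝓕 g := by
  refine ae_eq_of_integral_schwartz_smul_eq ((Lp.memLp _).locallyIntegrable one_le_two)
    (continuous_fourier h1).locallyIntegrable fun ψ => ?_
  have key := congrArg (fun D : TemperedDistribution E3 C3 => D ψ)
    (Lp.fourier_toTemperedDistribution_eq (h2.toLp g))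
  simp only [TemperedDistribution.fourier_apply, Lp.toTemperedDistribution_apply] at key
  have hflip := VectorFourier.integral_fourierIntegral_smul_eq_flip (e := Real.fourierChar)
    (μ := (volume : Measure E3)) (ν := (volume : Measure E3)) (L := innerₗ E3)
    (f := (ψ : E3 → ℂ)) (g := g) Real.continuous_fourierChar
    (by exact (innerSL ℝ).continuous₂) ψ.integrable h1
  rw [flip_innerₗ] at hflip
  refine key.symm.trans (Eq.trans (integral_congr_ae ?_) hflip)
  filter_upwards [h2.coeFn_toLp] with x hx
  rw [hx, SchwartzMap.fourier_coe]
  rfl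

/-- The weight `(1 + 4π²|ξ|²)^s` of the norm of `H^s`. -/
noncomputable def sobolevWeight (s : ℝ) (ξ : E3) : ℝ := (1 + 4 * Real.pi ^ 2 * ‖ξ‖ ^ 2) ^ s

/-- The measure `(1 + 4π²|ξ|²)^s dξ`: the Fourier transform is an isometry from `H^s` into the
`L²` space of this measure. -/
noncomputable def sobolevMeasure (s : ℝ) : Measure E3 :=
  volume.withDensity fun ξ => ENNReal.ofReal (sobolevWeight s ξ)

theorem one_le_bracket (ξ : E3) : 1 ≤ 1 + 4 * Real.pi ^ 2 * ‖ξ‖ ^ 2 := by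
  have : 0 ≤ 4 * Real.pi ^ 2 * ‖ξ‖ ^ 2 := by positivity
  linarith

theorem sobolevWeight_pos (s : ℝ) (ξ : E3) : 0 < sobolevWeight s ξ :=
  Real.rpow_pos_of_pos (by linarith [one_le_bracket ξ]) _

theorem one_le_sobolevWeight {s : ℝ} (hs : 0 ≤ s) (ξ : E3) : 1 ≤ sobolevWeight s ξ :=
  Real.one_le_rpow (one_le_bracket ξ) hs

theorem sobolevWeight_neg (s : ℝ) (ξ : E3) : sobolevWeight s (-ξ) = sobolevWeight s ξ := by
  simp [sobolevWeight]

theorem measurable_sobolevWeight (s : ℝ) : Measurable (sobolevWeight s) := by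
  unfold sobolevWeight; fun_prop

theorem volume_le_sobolevMeasure {s : ℝ} (hs : 0 ≤ s) :
    (volume : Measure E3) ≤ sobolevMeasure s := by
  conv_lhs => rw [← withDensity_one (μ := (volume : Measure E3))]
  refine withDensity_mono (Eventually.of_forall fun ξ => ?_)
  simpa using one_le_sobolevWeight hs ξ

theorem sobolevMeasure_absolutelyContinuous (s : ℝ) : sobolevMeasure s ≪ volume :=
  withDensity_absolutelyContinuous _ _

theorem volume_absolutelyContinuous_sobolevMeasure {s : ℝ} (hs : 0 ≤ s) :
    (volume : Measure E3) ≪ sobolevMeasure s :=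
  Measure.absolutelyContinuous_of_le (volume_le_sobolevMeasure hs)

section
variable {F : Type*} [NormedAddCommGroup F]

theorem eLpNorm_sobolevMeasure (s : ℝ) (g : E3 → F) :
    eLpNorm g 2 (sobolevMeasure s) =
      (∫⁻ ξ, ENNReal.ofReal (sobolevWeight s ξ) * ‖g ξ‖ₑ ^ 2) ^ (1 / 2 : ℝ) := by
  rw [eLpNorm_eq_lintegral_rpow_enorm_toReal two_ne_zero ENNReal.ofNat_ne_top, sobolevMeasure,
    lintegral_withDensity_eq_lintegral_mul_non_measurable _
      (measurable_sobolevWeight s).ennreal_ofReal (by simp)]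
  simp

theorem MemLp.of_sobolevMeasure {s : ℝ} (hs : 0 ≤ s) {g : E3 → F}
    (hg : MemLp g 2 (sobolevMeasure s)) : MemLp g 2 volume :=
  hg.mono_measure (volume_le_sobolevMeasure hs)

/-- The constant in the embedding of `L²((1 + 4π²|ξ|²)^s dξ)` into `L¹`. -/
noncomputable def sobolevConst (s : ℝ) : ℝ≥0∞ :=
  (∫⁻ ξ : E3, ENNReal.ofReal (sobolevWeight (-s) ξ)) ^ (1 / 2 : ℝ)

theorem sobolevConst_lt_top {s : ℝ} (hs : 3 / 2 < s) : sobolevConst s < ⊤ := by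
  refine ENNReal.rpow_lt_top_of_nonneg (by norm_num) (ne_of_lt ?_)
  have h := integrable_rpow_neg_one_add_norm_sq (E := E3) (μ := volume) (r := 2 * s)
    (by simp; linarith)
  refine lt_of_le_of_lt (lintegral_mono fun ξ => ?_) h.lintegral_lt_top
  refine ENNReal.ofReal_le_ofReal ?_
  unfold sobolevWeight
  rw [show -(2 * s) / 2 = -s by ring]
  refine Real.rpow_le_rpow_of_nonpos (by positivity) ?_ (by linarith)
  have : (1 : ℝ) ≤ Real.pi ^ 2 := one_le_pow₀ (by linarith [Real.pi_gt_three])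
  nlinarith [sq_nonneg ‖ξ‖]

/-- The Cauchy–Schwarz inequality, with the weight `(1 + 4π²|ξ|²)^(-s)` integrable for `s > 3/2`. -/
theorem eLpNorm_one_le_sobolevConst_mul {s : ℝ} {g : E3 → F}
    (hg : AEStronglyMeasurable g volume) :
    eLpNorm g 1 volume ≤ sobolevConst s * eLpNorm g 2 (sobolevMeasure s) := by
  have hw : Measurable fun ξ : E3 => ENNReal.ofReal (sobolevWeight (-s / 2) ξ) :=
    (measurable_sobolevWeight _).ennreal_ofReal
  have hw' : Measurable fun ξ : E3 => ENNReal.ofReal (sobolevWeight (s / 2) ξ) :=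
    (measurable_sobolevWeight _).ennreal_ofReal
  have hsq : ∀ (t : ℝ) (ξ : E3), ENNReal.ofReal (sobolevWeight (t / 2) ξ) ^ (2 : ℝ)
      = ENNReal.ofReal (sobolevWeight t ξ) := by
    intro t ξ
    rw [ENNReal.ofReal_rpow_of_pos (sobolevWeight_pos _ _)]
    unfold sobolevWeight
    rw [← Real.rpow_mul (by linarith [one_le_bracket ξ])]
    norm_num
  have h := ENNReal.lintegral_mul_le_Lp_mul_Lq (volume : Measure E3)
    (Real.HolderConjugate.two_two) hw.aemeasurable (hw'.aemeasurable.mul hg.enorm)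
  rw [eLpNorm_one_eq_lintegral_enorm, eLpNorm_sobolevMeasure, sobolevConst]
  refine le_trans (le_of_eq ?_) (h.trans (le_of_eq ?_))
  · refine lintegral_congr fun ξ => ?_
    simp only [Pi.mul_apply]
    rw [← mul_assoc, ← ENNReal.ofReal_mul (sobolevWeight_pos _ _).le]
    unfold sobolevWeight
    rw [← Real.rpow_add (by linarith [one_le_bracket ξ])]
    simp [neg_div]
  · congr 2
    · exact lintegral_congr fun ξ => hsq _ _
    · refine lintegral_congr fun ξ => ?_
      simp only [Pi.mul_apply]
      rw [ENNReal.mul_rpow_of_nonneg _ _ (by norm_num), hsq]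
      norm_num

theorem MemLp.integrable_of_sobolevMeasure {s : ℝ} (hs : 3 / 2 < s) {g : E3 → F}
    (hg : MemLp g 2 (sobolevMeasure s)) : Integrable g := by
  have hm := (MemLp.of_sobolevMeasure (by linarith) hg).1
  rw [← memLp_one_iff_integrable]
  exact ⟨hm, (eLpNorm_one_le_sobolevConst_mul hm).trans_lt
    (ENNReal.mul_lt_top (sobolevConst_lt_top hs) hg.2)⟩

theorem eLpNorm_sobolevMeasure_comp_neg (s : ℝ) (g : E3 → F) :
    eLpNorm (fun ξ => g (-ξ)) 2 (sobolevMeasure s) = eLpNorm g 2 (sobolevMeasure s) := by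
  simp only [eLpNorm_sobolevMeasure]
  rw [← lintegral_neg_eq_self]
  simp [sobolevWeight_neg]

theorem MemLp.comp_neg_sobolevMeasure {s : ℝ} (hs : 0 ≤ s) {g : E3 → F}
    (hg : MemLp g 2 (sobolevMeasure s)) : MemLp (fun ξ => g (-ξ)) 2 (sobolevMeasure s) := by
  refine ⟨?_, by rw [eLpNorm_sobolevMeasure_comp_neg]; exact hg.2⟩
  exact ((MemLp.of_sobolevMeasure hs hg).1.comp_quasiMeasurePreserving
    (Measure.measurePreserving_neg volume).quasiMeasurePreserving).mono_ac
    (sobolevMeasure_absolutelyContinuous s)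

end

theorem enorm_fourierInv_le {F : Type*} [NormedAddCommGroup F] [NormedSpace ℂ F]
    (g : E3 → F) (x : E3) : ‖𝓕⁻ g x‖ₑ ≤ eLpNorm g 1 volume := by
  rw [Real.fourierInv_eq, eLpNorm_one_eq_lintegral_enorm]
  refine (enorm_integral_le_lintegral_enorm _).trans (le_of_eq ?_)
  refine lintegral_congr fun v => ?_
  rw [← ofReal_norm, ← ofReal_norm, Circle.norm_smul]

/-- Componentwise complex conjugation of `ℂ³`. -/
noncomputable def conjC3 : C3 ≃ₗᵢ[ℝ] C3 :=
  LinearIsometryEquiv.piLpCongrRight 2 (fun _ => Complex.conjLIE)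

@[simp] theorem conjC3_apply (v : C3) (i : Fin 3) : conjC3 v i = star (v i) := rfl

theorem conjC3_smul (c : ℂ) (v : C3) : conjC3 (c • v) = star c • conjC3 v := by
  ext i; simp

theorem conjC3_fourierInv (g : E3 → C3) (x : E3) :
    conjC3 (𝓕⁻ g x) = 𝓕⁻ (fun ξ => conjC3 (g (-ξ))) x := by
  rw [Real.fourierInv_eq', Real.fourierInv_eq', ← integral_neg_eq_self (fun v => _ • conjC3 _)]
  refine (conjC3.toContinuousLinearEquiv.integral_comp_comm _).symm.trans ?_
  congr 1
  ext1 v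
  refine (conjC3_smul _ _).trans ?_
  congr 1
  · simp [← Complex.exp_conj, Complex.conj_ofNat]
  · simp

/-- The real vector field with Fourier transform `g`; for a `g` without Hermitian symmetry, the
real part of the inverse Fourier transform. -/
noncomputable def realField (g : E3 → C3) : E3 → E3 :=
  fun x => WithLp.toLp 2 fun i => (𝓕⁻ g x i).re

/-- The Hermitian part of `g`, that is the Fourier transform of `realField g`. -/
noncomputable def hermitianPart (g : E3 → C3) : E3 → C3 :=
  fun ξ => (1 / 2 : ℂ) • (g ξ + conjC3 (g (-ξ)))

theorem memLp_hermitianPart {s : ℝ} (hs : 0 ≤ s) {g : E3 → C3}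
    (hg : MemLp g 2 (sobolevMeasure s)) : MemLp (hermitianPart g) 2 (sobolevMeasure s) := by
  have hc : MemLp (fun ξ => conjC3 (g (-ξ))) 2 (sobolevMeasure s) :=
    (MemLp.comp_neg_sobolevMeasure hs hg).continuousLinearMap_comp
      (conjC3.toContinuousLinearEquiv : C3 →L[ℝ] C3)
  exact (hg.add hc).const_smul (1 / 2 : ℂ)

theorem eLpNorm_hermitianPart_le {s : ℝ} (hs : 0 ≤ s) {g : E3 → C3}
    (hg : MemLp g 2 (sobolevMeasure s)) :
    eLpNorm (hermitianPart g) 2 (sobolevMeasure s) ≤ eLpNorm g 2 (sobolevMeasure s) := by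
  have hc : MemLp (fun ξ => conjC3 (g (-ξ))) 2 (sobolevMeasure s) :=
    (MemLp.comp_neg_sobolevMeasure hs hg).continuousLinearMap_comp
    (conjC3.toContinuousLinearEquiv : C3 →L[ℝ] C3)
  have he : eLpNorm (fun ξ => conjC3 (g (-ξ))) 2 (sobolevMeasure s)
      = eLpNorm g 2 (sobolevMeasure s) := by
    rw [← eLpNorm_sobolevMeasure_comp_neg s g]
    exact eLpNorm_congr_norm_ae (Eventually.of_forall fun ξ => by simp)
  have h := eLpNorm_add_le hg.1 hc.1 (one_le_two (α := ℝ≥0∞))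
  have h2 : eLpNorm (hermitianPart g) 2 (sobolevMeasure s) =
      ‖(1 / 2 : ℂ)‖ₑ * eLpNorm (g + fun ξ => conjC3 (g (-ξ))) 2 (sobolevMeasure s) :=
    eLpNorm_const_smul (1 / 2 : ℂ) (g + fun ξ => conjC3 (g (-ξ))) 2 (sobolevMeasure s)
  rw [h2]
  rw [he, ← two_mul] at h
  refine (mul_le_mul_right h _).trans (le_of_eq ?_)
  rw [← mul_assoc]
  have : ‖(1 / 2 : ℂ)‖ₑ * 2 = 1 := by
    rw [← ofReal_norm, ← ENNReal.ofReal_ofNat, ← ENNReal.ofReal_mul (by positivity)]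
    norm_num
  rw [this, one_mul]

theorem complexify_realField {g : E3 → C3} (hg : Integrable g) :
    complexify (realField g) = 𝓕⁻ (hermitianPart g) := by
  ext1 x
  have hc : Integrable (fun ξ => conjC3 (g (-ξ))) :=
    (conjC3.toContinuousLinearEquiv : C3 →L[ℝ] C3).integrable_comp hg.comp_neg
  have h : 𝓕⁻ (hermitianPart g) x = (1 / 2 : ℂ) • (𝓕⁻ g x + conjC3 (𝓕⁻ g x)) := by
    rw [conjC3_fourierInv]
    simp only [Real.fourierInv_eq, hermitianPart]
    rw [← integral_add ((Real.fourierIntegral_convergent_iff (-x)).2 hg |>.congr ?_)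
      ((Real.fourierIntegral_convergent_iff (-x)).2 hc |>.congr ?_), ← integral_smul]
    · congr 1; ext1 v
      rw [smul_comm, smul_add]
    all_goals exact Eventually.of_forall fun v => by simp
  rw [h]
  ext i
  simp only [complexify, realField, Complex.ext_iff, PiLp.smul_apply, PiLp.add_apply,
    conjC3_apply]
  simp
  ring

/-- A field given by an inverse Fourier integral of `h` has the Plancherel Fourier transform `h`. -/
theorem hat_of_complexify_eq {f : E3 → E3} {h : E3 → C3} (h1 : Integrable h)
    (h2 : MemLp h 2 volume) (hf : complexify f = 𝓕⁻ h) :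
    MemLp (complexify f) 2 (volume : Measure E3) ∧ hat f =ᵐ[volume] h := by
  have h3 := fourierInv_toLp_ae_eq h1 h2
  rw [← hf] at h3
  have hm : MemLp (complexify f) 2 (volume : Measure E3) := (memLp_congr_ae h3).1 (Lp.memLp _)
  refine ⟨hm, ?_⟩
  have h4 : hm.toLp (complexify f) = 𝓕⁻ (h2.toLp h) := by
    rw [Lp.ext_iff]
    exact hm.coeFn_toLp.trans h3.symm
  rw [hat, dif_pos hm, h4, FourierTransform.fourier_fourierInv_eq]
  exact h2.coeFn_toLp

theorem hat_ae_eq_fourier {f : E3 → E3} (h1 : Integrable (complexify f))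
    (h2 : MemLp (complexify f) 2 volume) : hat f =ᵐ[volume] 𝓕 (complexify f) := by
  rw [hat, dif_pos h2]
  exact fourier_toLp_ae_eq h1 h2

theorem hsNorm_eq {s : ℝ} {f : E3 → E3} (hf : MemLp (complexify f) 2 (volume : Measure E3)) :
    hsNorm s f = eLpNorm (hat f) 2 (sobolevMeasure s) := by
  rw [hsNorm, if_pos hf, eLpNorm_sobolevMeasure]
  rfl

theorem aestronglyMeasurable_hat (f : E3 → E3) : AEStronglyMeasurable (hat f) volume := by
  unfold hat
  split_ifs
  · exact Lp.aestronglyMeasurable _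
  · exact aestronglyMeasurable_const

theorem MemHs.memLp_complexify {s : ℝ} {f : E3 → E3} (hf : MemHs s f) :
    MemLp (complexify f) 2 (volume : Measure E3) := by
  by_contra h
  have := hf.2
  rw [hsNorm, if_neg h] at this
  exact lt_irrefl _ this

theorem MemHs.hsNorm_eq {s : ℝ} {f : E3 → E3} (hf : MemHs s f) :
    hsNorm s f = eLpNorm (hat f) 2 (sobolevMeasure s) :=
  VortexStretching.hsNorm_eq hf.memLp_complexify

theorem MemHs.memLp_hat {s : ℝ} {f : E3 → E3} (hf : MemHs s f) :
    MemLp (hat f) 2 (sobolevMeasure s) :=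
  ⟨(aestronglyMeasurable_hat f).mono_ac (sobolevMeasure_absolutelyContinuous s), by
    rw [← hf.hsNorm_eq]; exact hf.2⟩

theorem MemHs.integrable_hat {s : ℝ} (hs : 3 / 2 < s) {f : E3 → E3} (hf : MemHs s f) :
    Integrable (hat f) := MemLp.integrable_of_sobolevMeasure hs hf.memLp_hat

theorem continuous_complexify {f : E3 → E3} (hf : Continuous f) : Continuous (complexify f) := by
  unfold complexify
  fun_prop

/-- Fourier inversion in `H^s`, at every point. -/
theorem MemHs.complexify_eq {s : ℝ} (hs : 3 / 2 < s) {f : E3 → E3} (hf : MemHs s f) :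
    complexify f = 𝓕⁻ (hat f) := by
  have h2 : MemLp (hat f) 2 volume := MemLp.of_sobolevMeasure (by linarith) hf.memLp_hat
  have h3 := fourierInv_toLp_ae_eq (hf.integrable_hat hs) h2
  have hm := hf.memLp_complexify
  have h4 : h2.toLp (hat f) = 𝓕 (hm.toLp (complexify f)) := by
    rw [Lp.ext_iff]
    refine h2.coeFn_toLp.trans ?_
    rw [hat, dif_pos hm]
  rw [h4, FourierTransform.fourierInv_fourier_eq] at h3
  exact (Continuous.ae_eq_iff_eq volume (continuous_complexify hf.1)
    (continuous_fourierInv (hf.integrable_hat hs))).1 (hm.coeFn_toLp.symm.trans h3)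

theorem continuous_realField {g : E3 → C3} (hg : Integrable g) : Continuous (realField g) := by
  have := continuous_fourierInv hg
  unfold realField
  refine (PiLp.continuous_toLp 2 _).comp (continuous_pi fun i => ?_)
  exact Complex.continuous_re.comp ((EuclideanSpace.proj (𝕜 := ℂ) i).continuous.comp this)

theorem MemHs.realField_hat {s : ℝ} (hs : 3 / 2 < s) {f : E3 → E3} (hf : MemHs s f) :
    realField (hat f) = f := by
  ext x i
  simp [realField, ← hf.complexify_eq hs, complexify]

theorem memHs_realField {s : ℝ} (hs : 3 / 2 < s) {g : E3 → C3}
    (hg : MemLp g 2 (sobolevMeasure s)) :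
    MemHs s (realField g) ∧ hsNorm s (realField g) ≤ eLpNorm g 2 (sobolevMeasure s) ∧
      hat (realField g) =ᵐ[volume] hermitianPart g := by
  have hs0 : 0 ≤ s := by linarith
  have hi := MemLp.integrable_of_sobolevMeasure hs hg
  have hh := memLp_hermitianPart hs0 hg
  obtain ⟨h1, h2⟩ := hat_of_complexify_eq (MemLp.integrable_of_sobolevMeasure hs hh)
    (MemLp.of_sobolevMeasure hs0 hh) (complexify_realField hi)
  have h3 : hsNorm s (realField g) ≤ eLpNorm g 2 (sobolevMeasure s) := by
    rw [hsNorm_eq h1, eLpNorm_congr_ae ((sobolevMeasure_absolutelyContinuous s).ae_eq h2)]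
    exact eLpNorm_hermitianPart_le hs0 hg
  exact ⟨⟨continuous_realField hi, h3.trans_lt hg.2⟩, h3, h2⟩

/-- If the inverse Fourier transform of `g` is real, then `g` is the Fourier transform of a
field of `H^s`. -/
theorem hat_ae_eq_of_complexify_eq {s : ℝ} (hs : 3 / 2 < s) {g : E3 → C3} {f : E3 → E3}
    (hg : MemLp g 2 (sobolevMeasure s)) (hf : complexify f = 𝓕⁻ g) : hat f =ᵐ[volume] g :=
  (hat_of_complexify_eq (MemLp.integrable_of_sobolevMeasure hs hg)
    (MemLp.of_sobolevMeasure (by linarith) hg) hf).2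

theorem norm_complexify (f : E3 → E3) (x : E3) : ‖complexify f x‖ = ‖f x‖ := by
  simp [complexify, EuclideanSpace.norm_eq]

/-- The Sobolev embedding of `H^s` into the bounded functions. -/
theorem MemHs.enorm_apply_le {s : ℝ} (hs : 3 / 2 < s) {f : E3 → E3} (hf : MemHs s f) (x : E3) :
    ‖f x‖ₑ ≤ sobolevConst s * hsNorm s f := by
  rw [← ofReal_norm, ← norm_complexify, ofReal_norm, hf.complexify_eq hs, hf.hsNorm_eq]
  exact (enorm_fourierInv_le _ _).trans
    (eLpNorm_one_le_sobolevConst_mul (aestronglyMeasurable_hat f))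

/-! ### Fields of `H^s` as elements of a weighted `L²` space -/

theorem complexify_sub (f g : E3 → E3) : complexify (f - g) = complexify f - complexify g := by
  ext x i; simp [complexify]

theorem complexify_smul (c : ℝ) (f : E3 → E3) : complexify (c • f) = c • complexify f := by
  ext x i; simp [complexify]

theorem hat_sub {f g : E3 → E3} (hf : MemLp (complexify f) 2 (volume : Measure E3))
    (hg : MemLp (complexify g) 2 (volume : Measure E3)) :
    hat (f - g) =ᵐ[volume] hat f - hat g := by
  have h : MemLp (complexify (f - g)) 2 (volume : Measure E3) := by
    rw [complexify_sub]; exact hf.sub hg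
  have he : h.toLp _ = hf.toLp _ - hg.toLp _ := by
    rw [← MemLp.toLp_sub]
    exact MemLp.toLp_congr _ _ (Eventually.of_forall fun x => by rw [complexify_sub])
  rw [hat, hat, hat, dif_pos hf, dif_pos hg, dif_pos h, he,
    show 𝓕 (hf.toLp _ - hg.toLp _) = 𝓕 (hf.toLp _) - 𝓕 (hg.toLp _) from
      (Lp.fourierTransformₗᵢ E3 C3).map_sub _ _]
  exact Lp.coeFn_sub _ _

theorem hat_smul (c : ℝ) {f : E3 → E3} (hf : MemLp (complexify f) 2 (volume : Measure E3)) :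
    hat (c • f) =ᵐ[volume] (c : ℂ) • hat f := by
  have h : MemLp (complexify (c • f)) 2 (volume : Measure E3) := by
    rw [complexify_smul]; exact hf.const_smul c
  have he : h.toLp _ = (c : ℂ) • hf.toLp _ := by
    rw [← MemLp.toLp_const_smul]
    refine MemLp.toLp_congr _ _ (Eventually.of_forall fun x => ?_)
    rw [complexify_smul]; ext i; simp
  rw [hat, hat, dif_pos hf, dif_pos h, he, FourierTransform.fourier_smul]
  exact Lp.coeFn_smul _ _

theorem MemHs.sub {s : ℝ} {f g : E3 → E3} (hf : MemHs s f) (hg : MemHs s g) :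
    MemHs s (f - g) := by
  have h : MemLp (complexify (f - g)) 2 (volume : Measure E3) := by
    rw [complexify_sub]; exact hf.memLp_complexify.sub hg.memLp_complexify
  refine ⟨hf.1.sub hg.1, ?_⟩
  rw [VortexStretching.hsNorm_eq h, eLpNorm_congr_ae ((sobolevMeasure_absolutelyContinuous s).ae_eq
    (hat_sub hf.memLp_complexify hg.memLp_complexify))]
  exact (hf.memLp_hat.sub hg.memLp_hat).2

theorem MemHs.const_smul {s : ℝ} (c : ℝ) {f : E3 → E3} (hf : MemHs s f) : MemHs s (c • f) := by
  have h : MemLp (complexify (c • f)) 2 (volume : Measure E3) := by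
    rw [complexify_smul]; exact hf.memLp_complexify.const_smul c
  refine ⟨hf.1.const_smul c, ?_⟩
  rw [VortexStretching.hsNorm_eq h, eLpNorm_congr_ae ((sobolevMeasure_absolutelyContinuous s).ae_eq
    (hat_smul c hf.memLp_complexify))]
  exact (hf.memLp_hat.const_smul (c : ℂ)).2

open Classical in
/-- The Fourier transform of a field of `H^s` as an element of the weighted `L²` space; by
convention `0` for fields that are not in `H^s`. -/
noncomputable def toSob (s : ℝ) (f : E3 → E3) : Lp C3 2 (sobolevMeasure s) :=
  if h : MemHs s f then h.memLp_hat.toLp (hat f) else 0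

theorem toSob_coe_ae {s : ℝ} {f : E3 → E3} (hf : MemHs s f) :
    toSob s f =ᵐ[sobolevMeasure s] hat f := by
  rw [toSob, dif_pos hf]; exact hf.memLp_hat.coeFn_toLp

theorem toSob_coe_ae_volume {s : ℝ} (hs : 0 ≤ s) {f : E3 → E3} (hf : MemHs s f) :
    toSob s f =ᵐ[volume] hat f :=
  (volume_absolutelyContinuous_sobolevMeasure hs).ae_eq (toSob_coe_ae hf)

theorem enorm_toSob {s : ℝ} {f : E3 → E3} (hf : MemHs s f) : ‖toSob s f‖ₑ = hsNorm s f := by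
  rw [Lp.enorm_def, eLpNorm_congr_ae (toSob_coe_ae hf), hf.hsNorm_eq]

theorem toSob_sub {s : ℝ} {f g : E3 → E3} (hf : MemHs s f) (hg : MemHs s g) :
    toSob s (f - g) = toSob s f - toSob s g := by
  rw [Lp.ext_iff]
  refine (toSob_coe_ae (hf.sub hg)).trans (EventuallyEq.trans ?_ (Lp.coeFn_sub _ _).symm)
  exact ((sobolevMeasure_absolutelyContinuous s).ae_eq
    (hat_sub hf.memLp_complexify hg.memLp_complexify)).trans
    ((toSob_coe_ae hf).sub (toSob_coe_ae hg)).symm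

theorem toSob_smul {s : ℝ} (c : ℝ) {f : E3 → E3} (hf : MemHs s f) :
    toSob s (c • f) = c • toSob s f := by
  rw [Lp.ext_iff]
  refine (toSob_coe_ae (hf.const_smul c)).trans (EventuallyEq.trans ?_ (Lp.coeFn_smul _ _).symm)
  refine ((sobolevMeasure_absolutelyContinuous s).ae_eq (hat_smul c hf.memLp_complexify)).trans ?_
  filter_upwards [toSob_coe_ae hf] with ξ h
  simp [h]

theorem realField_toSob {s : ℝ} (hs : 3 / 2 < s) {f : E3 → E3} (hf : MemHs s f) :
    realField (toSob s f) = f := by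
  refine Eq.trans ?_ (hf.realField_hat hs)
  ext x i
  simp only [realField]
  rw [Real.fourierInv_congr_ae (toSob_coe_ae_volume (by linarith) hf)]

/-! ### Convolutions -/

/-- The square root of the weight is subadditive up to a constant, which splits the norm of a
product in `H^s` into two terms with the weight on one factor only. -/
theorem sobolevWeight_half_le {s : ℝ} (hs : 0 ≤ s) (ξ η : E3) :
    sobolevWeight (s / 2) ξ ≤
      2 ^ s * (sobolevWeight (s / 2) η + sobolevWeight (s / 2) (ξ - η)) := by
  have h1 : ‖ξ‖ ≤ ‖η‖ + ‖ξ - η‖ := by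
    calc ‖ξ‖ = ‖η + (ξ - η)‖ := by simp
      _ ≤ _ := norm_add_le _ _
  have h3 : 1 + 4 * Real.pi ^ 2 * ‖ξ‖ ^ 2 ≤
      4 * max (1 + 4 * Real.pi ^ 2 * ‖η‖ ^ 2) (1 + 4 * Real.pi ^ 2 * ‖ξ - η‖ ^ 2) := by
    have h2 : ‖ξ‖ ^ 2 ≤ 2 * ‖η‖ ^ 2 + 2 * ‖ξ - η‖ ^ 2 := by
      nlinarith [norm_nonneg ξ, sq_nonneg (‖η‖ - ‖ξ - η‖)]
    have h4 := mul_le_mul_of_nonneg_left h2 (show 0 ≤ 4 * Real.pi ^ 2 by positivity)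
    linarith [le_max_left (1 + 4 * Real.pi ^ 2 * ‖η‖ ^ 2) (1 + 4 * Real.pi ^ 2 * ‖ξ - η‖ ^ 2),
      le_max_right (1 + 4 * Real.pi ^ 2 * ‖η‖ ^ 2) (1 + 4 * Real.pi ^ 2 * ‖ξ - η‖ ^ 2)]
  have h5 : (4 : ℝ) ^ (s / 2) = 2 ^ s := by
    rw [show (4 : ℝ) = 2 ^ (2 : ℝ) by norm_num, ← Real.rpow_mul (by norm_num)]
    congr 1; ring
  have hη := (sobolevWeight_pos (s / 2) η).le
  have hξ := (sobolevWeight_pos (s / 2) (ξ - η)).le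
  calc sobolevWeight (s / 2) ξ
      ≤ (4 * max (1 + 4 * Real.pi ^ 2 * ‖η‖ ^ 2) (1 + 4 * Real.pi ^ 2 * ‖ξ - η‖ ^ 2)) ^ (s / 2) :=
        Real.rpow_le_rpow (by positivity) h3 (by linarith)
    _ = 2 ^ s *
        (max (1 + 4 * Real.pi ^ 2 * ‖η‖ ^ 2) (1 + 4 * Real.pi ^ 2 * ‖ξ - η‖ ^ 2)) ^ (s / 2) := by
        rw [Real.mul_rpow (by norm_num) (by positivity), h5]
    _ ≤ _ := by
        gcongr
        rcases max_cases (1 + 4 * Real.pi ^ 2 * ‖η‖ ^ 2) (1 + 4 * Real.pi ^ 2 * ‖ξ - η‖ ^ 2)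
          with h | h <;> rw [h.1] <;> unfold sobolevWeight at * <;> linarith

/-- Young's inequality `L¹ * L² ⊆ L²`. -/
theorem lintegral_conv_sq_le {a b : E3 → ℝ≥0∞} (ha : AEMeasurable a) (hb : AEMeasurable b) :
    (∫⁻ ξ, (∫⁻ η, a η * b (ξ - η)) ^ (2 : ℝ)) ^ (1 / 2 : ℝ) ≤
      (∫⁻ η, a η) * (∫⁻ η, b η ^ (2 : ℝ)) ^ (1 / 2 : ℝ) := by
  have hb' : ∀ ξ : E3, AEMeasurable fun η => b (ξ - η) := fun ξ =>
    hb.comp_quasiMeasurePreserving (quasiMeasurePreserving_sub_left volume ξ)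
  have hsqrt : AEMeasurable fun η => a η ^ (1 / 2 : ℝ) := ha.pow_const _
  have hmul : ∀ x : ℝ≥0∞, x ^ (1 / 2 : ℝ) * x ^ (1 / 2 : ℝ) = x := fun x => by
    rw [← ENNReal.rpow_add_of_nonneg _ _ (by norm_num) (by norm_num)]; norm_num
  have hpow : ∀ x : ℝ≥0∞, (x ^ (1 / 2 : ℝ)) ^ (2 : ℝ) = x := fun x => by
    rw [← ENNReal.rpow_mul]; norm_num
  -- Cauchy–Schwarz for the product of `√a` and `√a b`
  have h1 : ∀ ξ : E3, (∫⁻ η, a η * b (ξ - η)) ^ (2 : ℝ) ≤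
      (∫⁻ η, a η) * ∫⁻ η, a η * b (ξ - η) ^ (2 : ℝ) := by
    intro ξ
    have h := ENNReal.lintegral_mul_le_Lp_mul_Lq (volume : Measure E3)
      Real.HolderConjugate.two_two hsqrt (hsqrt.mul (hb' ξ))
    calc (∫⁻ η, a η * b (ξ - η)) ^ (2 : ℝ)
        = (∫⁻ η, ((fun η => a η ^ (1 / 2 : ℝ)) *
            ((fun η => a η ^ (1 / 2 : ℝ)) * fun η => b (ξ - η))) η) ^ (2 : ℝ) := by
          congr 1
          refine lintegral_congr fun η => ?_
          simp only [Pi.mul_apply]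
          rw [← mul_assoc, hmul]
      _ ≤ _ := ENNReal.rpow_le_rpow h (by norm_num)
      _ = _ := by
          rw [ENNReal.mul_rpow_of_nonneg _ _ (by norm_num), hpow, hpow]
          congr 1
          · exact lintegral_congr fun η => hpow _
          · refine lintegral_congr fun η => ?_
            simp only [Pi.mul_apply]
            rw [ENNReal.mul_rpow_of_nonneg _ _ (by norm_num), hpow]
  have h2 : ∫⁻ ξ, ∫⁻ η, a η * b (ξ - η) ^ (2 : ℝ) = (∫⁻ η, a η) * ∫⁻ η, b η ^ (2 : ℝ) := by
    rw [lintegral_lintegral_swap]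
    · rw [← lintegral_mul_const'' _ ha]
      refine lintegral_congr fun η => ?_
      have hm : AEMeasurable fun ξ => b (ξ - η) ^ (2 : ℝ) :=
        (hb.comp_quasiMeasurePreserving
          (measurePreserving_sub_right volume η).quasiMeasurePreserving).pow_const _
      rw [lintegral_const_mul'' _ hm, lintegral_sub_right_eq_self (fun ξ => b ξ ^ (2 : ℝ))]
    · exact ha.comp_snd.mul ((hb.comp_quasiMeasurePreserving
        (quasiMeasurePreserving_sub_of_right_invariant volume volume)).pow_const _)
  calc _ ≤ (∫⁻ ξ, (∫⁻ η, a η) * ∫⁻ η, a η * b (ξ - η) ^ (2 : ℝ)) ^ (1 / 2 : ℝ) := by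
        gcongr with ξ; exact h1 ξ
    _ ≤ ((∫⁻ η, a η) * ((∫⁻ η, a η) * ∫⁻ η, b η ^ (2 : ℝ))) ^ (1 / 2 : ℝ) := by
        gcongr
        rw [lintegral_const_mul'', h2]
        exact (ha.comp_snd.mul ((hb.comp_quasiMeasurePreserving
          (quasiMeasurePreserving_sub_of_right_invariant volume volume)).pow_const
            (2 : ℝ))).lintegral_prod_right'
    _ = _ := by
        rw [← mul_assoc, ENNReal.mul_rpow_of_nonneg _ _ (by norm_num),
          ENNReal.mul_rpow_of_nonneg _ _ (by norm_num), hmul]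

theorem eLpNorm_sobolevMeasure' {F : Type*} [NormedAddCommGroup F] (s : ℝ) (g : E3 → F) :
    eLpNorm g 2 (sobolevMeasure s) =
      (∫⁻ ξ, (ENNReal.ofReal (sobolevWeight (s / 2) ξ) * ‖g ξ‖ₑ) ^ (2 : ℝ)) ^ (1 / 2 : ℝ) := by
  rw [eLpNorm_sobolevMeasure]
  congr 1
  refine lintegral_congr fun ξ => ?_
  rw [ENNReal.mul_rpow_of_nonneg _ _ (by norm_num),
    ENNReal.ofReal_rpow_of_pos (sobolevWeight_pos _ _)]
  unfold sobolevWeight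
  rw [← Real.rpow_mul (by linarith [one_le_bracket ξ])]
  norm_num

open scoped Convolution in
/-- `H^s` is an algebra: the weighted `L²` space is closed under convolution. -/
theorem eLpNorm_convolution_le {F₁ F₂ F₃ : Type*}
    [NormedAddCommGroup F₁] [NormedSpace ℂ F₁] [NormedAddCommGroup F₂] [NormedSpace ℂ F₂]
    [NormedAddCommGroup F₃] [NormedSpace ℂ F₃] {s : ℝ} (hs : 3 / 2 < s)
    (L : F₁ →L[ℂ] F₂ →L[ℂ] F₃) (hL : ∀ x y, ‖L x y‖ ≤ ‖x‖ * ‖y‖) {a : E3 → F₁} {b : E3 → F₂}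
    (ha : MemLp a 2 (sobolevMeasure s)) (hb : MemLp b 2 (sobolevMeasure s)) :
    eLpNorm (a ⋆[L] b) 2 (sobolevMeasure s) ≤
      ENNReal.ofReal (2 ^ s) * (2 * sobolevConst s) *
        (eLpNorm a 2 (sobolevMeasure s) * eLpNorm b 2 (sobolevMeasure s)) := by
  have ham := (MemLp.of_sobolevMeasure (by linarith) ha).1
  have hbm := (MemLp.of_sobolevMeasure (by linarith) hb).1
  set v : E3 → ℝ≥0∞ := fun ξ => ENNReal.ofReal (sobolevWeight (s / 2) ξ) with hv
  have hvm : Measurable v := (measurable_sobolevWeight _).ennreal_ofReal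
  set A : E3 → ℝ≥0∞ := fun ξ => v ξ * ‖a ξ‖ₑ
  set B : E3 → ℝ≥0∞ := fun ξ => v ξ * ‖b ξ‖ₑ
  have hA : AEMeasurable A := hvm.aemeasurable.mul ham.enorm
  have hB : AEMeasurable B := hvm.aemeasurable.mul hbm.enorm
  -- the weight is moved to one of the factors, the other one is estimated in `L¹`
  have hpt : ∀ ξ, v ξ * ‖(a ⋆[L] b) ξ‖ₑ ≤ ENNReal.ofReal (2 ^ s) *
      ((∫⁻ η, ‖b η‖ₑ * A (ξ - η)) + ∫⁻ η, ‖a η‖ₑ * B (ξ - η)) := by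
    intro ξ
    have hAm : AEMeasurable fun η => ‖b (ξ - η)‖ₑ * A η :=
      (hbm.enorm.comp_quasiMeasurePreserving (quasiMeasurePreserving_sub_left volume ξ)).mul hA
    calc v ξ * ‖(a ⋆[L] b) ξ‖ₑ
        ≤ v ξ * ∫⁻ η, ‖a η‖ₑ * ‖b (ξ - η)‖ₑ := by
          gcongr
          refine (enorm_integral_le_lintegral_enorm _).trans (lintegral_mono fun η => ?_)
          rw [← ofReal_norm, ← ofReal_norm, ← ofReal_norm, ← ENNReal.ofReal_mul (norm_nonneg _)]
          exact ENNReal.ofReal_le_ofReal (hL _ _)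
      _ = ∫⁻ η, v ξ * (‖a η‖ₑ * ‖b (ξ - η)‖ₑ) := by
          rw [lintegral_const_mul']; exact ENNReal.ofReal_ne_top
      _ ≤ ∫⁻ η, ENNReal.ofReal (2 ^ s) * (‖b (ξ - η)‖ₑ * A η + ‖a η‖ₑ * B (ξ - η)) := by
          refine lintegral_mono fun η => ?_
          have : v ξ ≤ ENNReal.ofReal (2 ^ s) * (v η + v (ξ - η)) := by
            rw [hv]; dsimp only
            rw [← ENNReal.ofReal_add (sobolevWeight_pos _ _).le (sobolevWeight_pos _ _).le,
              ← ENNReal.ofReal_mul (by positivity)]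
            exact ENNReal.ofReal_le_ofReal (sobolevWeight_half_le (by linarith) ξ η)
          calc v ξ * (‖a η‖ₑ * ‖b (ξ - η)‖ₑ)
              ≤ ENNReal.ofReal (2 ^ s) * (v η + v (ξ - η)) * (‖a η‖ₑ * ‖b (ξ - η)‖ₑ) := by gcongr
            _ = _ := by simp only [A, B]; ring
      _ = ENNReal.ofReal (2 ^ s) *
          ((∫⁻ η, ‖b (ξ - η)‖ₑ * A η) + ∫⁻ η, ‖a η‖ₑ * B (ξ - η)) := by
          rw [lintegral_const_mul' _ _ ENNReal.ofReal_ne_top, lintegral_add_left' hAm]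
      _ = _ := by
          congr 2
          rw [← lintegral_sub_left_eq_self _ ξ]
          simp
  have hcm : ∀ {c d : E3 → ℝ≥0∞}, AEMeasurable c → AEMeasurable d →
      AEMeasurable fun ξ => ∫⁻ η, c η * d (ξ - η) := fun hc hd =>
    (hc.comp_snd.mul (hd.comp_quasiMeasurePreserving
      (quasiMeasurePreserving_sub_of_right_invariant volume volume))).lintegral_prod_right'
  have h1a : ∫⁻ η, ‖a η‖ₑ ≤ sobolevConst s * eLpNorm a 2 (sobolevMeasure s) := by
    rw [← eLpNorm_one_eq_lintegral_enorm]; exact eLpNorm_one_le_sobolevConst_mul ham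
  have h1b : ∫⁻ η, ‖b η‖ₑ ≤ sobolevConst s * eLpNorm b 2 (sobolevMeasure s) := by
    rw [← eLpNorm_one_eq_lintegral_enorm]; exact eLpNorm_one_le_sobolevConst_mul hbm
  rw [eLpNorm_sobolevMeasure']
  calc (∫⁻ ξ, (v ξ * ‖(a ⋆[L] b) ξ‖ₑ) ^ (2 : ℝ)) ^ (1 / 2 : ℝ)
      ≤ (∫⁻ ξ, (ENNReal.ofReal (2 ^ s) *
      ((∫⁻ η, ‖b η‖ₑ * A (ξ - η)) + ∫⁻ η, ‖a η‖ₑ * B (ξ - η))) ^ (2 : ℝ)) ^ (1 / 2 : ℝ) := by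
        refine ENNReal.rpow_le_rpow (lintegral_mono fun ξ => ?_) (by norm_num)
        exact ENNReal.rpow_le_rpow (hpt ξ) (by norm_num)
    _ = ENNReal.ofReal (2 ^ s) * (∫⁻ ξ, ((fun ξ => ∫⁻ η, ‖b η‖ₑ * A (ξ - η)) +
          fun ξ => ∫⁻ η, ‖a η‖ₑ * B (ξ - η)) ξ ^ (2 : ℝ)) ^ (1 / 2 : ℝ) := by
        simp only [Pi.add_apply]
        simp_rw [ENNReal.mul_rpow_of_nonneg _ _ (show (0 : ℝ) ≤ 2 by norm_num)]
        rw [lintegral_const_mul' _ _ (ENNReal.rpow_ne_top_of_nonneg (by norm_num)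
          ENNReal.ofReal_ne_top), ENNReal.mul_rpow_of_nonneg _ _ (by norm_num), ← ENNReal.rpow_mul]
        norm_num
    _ ≤ ENNReal.ofReal (2 ^ s) * ((∫⁻ η, ‖b η‖ₑ) * eLpNorm a 2 (sobolevMeasure s) +
          (∫⁻ η, ‖a η‖ₑ) * eLpNorm b 2 (sobolevMeasure s)) := by
        gcongr
        refine (ENNReal.lintegral_Lp_add_le (hcm hbm.enorm hA) (hcm ham.enorm hB)
          one_le_two).trans (add_le_add ?_ ?_)
        · rw [eLpNorm_sobolevMeasure']; exact lintegral_conv_sq_le hbm.enorm hA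
        · rw [eLpNorm_sobolevMeasure']; exact lintegral_conv_sq_le ham.enorm hB
    _ ≤ ENNReal.ofReal (2 ^ s) * ((sobolevConst s * eLpNorm b 2 (sobolevMeasure s)) *
          eLpNorm a 2 (sobolevMeasure s) + (sobolevConst s * eLpNorm a 2 (sobolevMeasure s)) *
          eLpNorm b 2 (sobolevMeasure s)) := by gcongr
    _ = _ := by ring

/-! ### The velocity and the stretching term -/

/-- The inclusion of `ℝ³` in `ℂ³`. -/
noncomputable def toC3 : E3 →L[ℝ] C3 :=
  LinearMap.toContinuousLinearMap
    { toFun := fun v => WithLp.toLp 2 fun i => ((v i : ℝ) : ℂ)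
      map_add' := fun v w => by ext i; simp
      map_smul' := fun c v => by ext i; simp }

@[simp] theorem toC3_apply (v : E3) (i : Fin 3) : toC3 v i = ((v i : ℝ) : ℂ) := rfl

/-- The real part of a vector of `ℂ³`. -/
noncomputable def reC3 : C3 →L[ℝ] E3 :=
  LinearMap.toContinuousLinearMap
    { toFun := fun v => WithLp.toLp 2 fun i => (v i).re
      map_add' := fun v w => by ext i; simp
      map_smul' := fun c v => by ext i; simp }

@[simp] theorem reC3_apply (v : C3) (i : Fin 3) : reC3 v i = (v i).re := rfl

theorem norm_toC3 (v : E3) : ‖toC3 v‖ = ‖v‖ := by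
  simp [EuclideanSpace.norm_eq]

theorem norm_reC3_le (v : C3) : ‖reC3 v‖ ≤ ‖v‖ := by
  simp only [EuclideanSpace.norm_eq]
  refine Real.sqrt_le_sqrt (Finset.sum_le_sum fun i _ => ?_)
  rw [reC3_apply, Real.norm_eq_abs]
  exact pow_le_pow_left₀ (abs_nonneg _) (Complex.abs_re_le_norm _) 2

/-- The cross product of `ℂ³` as a continuous bilinear map of Euclidean spaces. -/
noncomputable def crossC : C3 →L[ℂ] C3 →L[ℂ] C3 :=
  LinearMap.toContinuousLinearMap
    ((LinearMap.toContinuousLinearMap : (C3 →ₗ[ℂ] C3) ≃ₗ[ℂ] (C3 →L[ℂ] C3)).toLinearMap ∘ₗ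
      LinearMap.mk₂ ℂ (fun a b : C3 => WithLp.toLp 2 (crossProduct a.ofLp b.ofLp))
        (fun a b c => by simp) (fun a b c => by simp) (fun a b c => by simp)
        (fun a b c => by simp))

theorem crossC_apply (a b : C3) :
    crossC a b = WithLp.toLp 2 (crossProduct a.ofLp b.ofLp) := rfl

/-- The Fourier transform of `∇ × (-Δ)⁻¹` applied to the field with Fourier transform `h`. -/
noncomputable def velHat (h : E3 → C3) (ξ : E3) : C3 :=
  ((((4 * Real.pi ^ 2 * ‖ξ‖ ^ 2 : ℝ) : ℂ))⁻¹ * (2 * (Real.pi : ℂ) * Complex.I)) •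
    crossC (toC3 ξ) (h ξ)

theorem velocityHat_eq (ω : E3 → E3) : velocityHat ω = velHat (hat ω) := by
  ext1 ξ
  rw [velHat, crossC_apply, mul_smul, velocityHat]
  simp only [map_smul, LinearMap.smul_apply, WithLp.toLp_smul]
  rfl

theorem velocity_eq (ω : E3 → E3) : velocity ω = fun x => reC3 (𝓕⁻ (velHat (hat ω)) x) := by
  rw [← velocityHat_eq]
  rfl

/-- The velocity is of order `-1` in the vorticity. -/
theorem norm_velHat_le (h : E3 → C3) (ξ : E3) : ‖ξ‖ * ‖velHat h ξ‖ ≤ ‖crossC‖ * ‖h ξ‖ := by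
  have hp : (1 : ℝ) ≤ 2 * Real.pi := by linarith [Real.pi_gt_three]
  rcases eq_or_ne ξ 0 with rfl | hξ
  · simp; positivity
  have h0 : 0 < ‖ξ‖ := norm_pos_iff.2 hξ
  have h1 : ‖velHat h ξ‖ = (2 * Real.pi * ‖ξ‖ ^ 2)⁻¹ * ‖crossC (toC3 ξ) (h ξ)‖ := by
    rw [velHat, norm_smul]
    congr 1
    have h3 : ‖(2 * (Real.pi : ℂ) * Complex.I)‖ = 2 * Real.pi := by
      simp [abs_of_pos Real.pi_pos]
    rw [norm_mul, norm_inv, Complex.norm_real, h3, Real.norm_of_nonneg (by positivity)]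
    field_simp
    norm_num
  have h2 : ‖crossC (toC3 ξ) (h ξ)‖ ≤ ‖crossC‖ * ‖ξ‖ * ‖h ξ‖ := by
    have := crossC.le_opNorm₂ (toC3 ξ) (h ξ)
    rwa [norm_toC3] at this
  calc ‖ξ‖ * ‖velHat h ξ‖
      ≤ ‖ξ‖ * ((2 * Real.pi * ‖ξ‖ ^ 2)⁻¹ * (‖crossC‖ * ‖ξ‖ * ‖h ξ‖)) := by rw [h1]; gcongr
    _ = (2 * Real.pi)⁻¹ * (‖crossC‖ * ‖h ξ‖) := by field_simp
    _ ≤ 1 * (‖crossC‖ * ‖h ξ‖) := by gcongr; exact inv_le_one_of_one_le₀ hp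
    _ = _ := one_mul _

theorem aestronglyMeasurable_velHat {h : E3 → C3} (hm : AEStronglyMeasurable h volume) :
    AEStronglyMeasurable (velHat h) volume := by
  have hc : Measurable fun ξ : E3 => (((4 * Real.pi ^ 2 * ‖ξ‖ ^ 2 : ℝ) : ℂ))⁻¹ *
      (2 * (Real.pi : ℂ) * Complex.I) := by fun_prop
  exact hc.aestronglyMeasurable.smul (crossC.aestronglyMeasurable_comp₂
    toC3.continuous.aestronglyMeasurable hm)

/-- The function `|ξ|⁻²` is integrable near the origin of `ℝ³`. -/
theorem integrableOn_norm_inv_sq (r : ℝ) :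
    IntegrableOn (fun ξ : E3 => (‖ξ‖ ^ 2)⁻¹) (Metric.ball 0 r) := by
  refine integrableOn_ball_of_norm_le_rpow (C := 1) (α := 2) (by simp) (by norm_num) ?_ ?_
  · refine Eventually.of_forall fun ξ => ?_
    rw [Real.norm_of_nonneg (by positivity), one_mul, Real.rpow_neg (norm_nonneg _)]
    norm_num
  · exact Measurable.aestronglyMeasurable (by fun_prop)

theorem integrable_norm_inv_mul {F : Type*} [NormedAddCommGroup F] {h : E3 → F}
    (h1 : Integrable h) (h2 : MemLp h 2 volume) :
    Integrable fun ξ => ‖ξ‖⁻¹ * ‖h ξ‖ := by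
  have hb := (integrable_indicator_iff Metric.isOpen_ball.measurableSet).2
    (integrableOn_norm_inv_sq 1)
  have hsq : Integrable fun ξ => ‖h ξ‖ ^ 2 := by
    simpa using h2.integrable_norm_pow two_ne_zero
  refine ((hb.add hsq).add h1.norm).mono' ?_ (Eventually.of_forall fun ξ => ?_)
  · exact (Measurable.aestronglyMeasurable (by fun_prop)).mul h1.1.norm
  · simp only [Pi.add_apply, indicator]
    rw [Real.norm_of_nonneg (by positivity)]
    split_ifs with hξ
    · have : (‖ξ‖ ^ 2)⁻¹ = ‖ξ‖⁻¹ ^ 2 := by rw [inv_pow]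
      rw [this]
      nlinarith [sq_nonneg (‖ξ‖⁻¹ - ‖h ξ‖), norm_nonneg (h ξ), sq_nonneg ‖ξ‖⁻¹, sq_nonneg ‖h ξ‖]
    · have hle : ‖ξ‖⁻¹ ≤ 1 := by
        rw [Metric.mem_ball, dist_zero_right, not_lt] at hξ
        exact inv_le_one_of_one_le₀ hξ
      nlinarith [norm_nonneg (h ξ), sq_nonneg ‖h ξ‖]

/-- The velocity has an integrable Fourier transform: the singularity `|ξ|⁻¹` at the origin is
square integrable near it in dimension three. -/
theorem integrable_velHat {h : E3 → C3} (h1 : Integrable h) (h2 : MemLp h 2 volume) :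
    Integrable (velHat h) := by
  refine ((integrable_norm_inv_mul h1 h2).const_mul ‖crossC‖).mono'
    (aestronglyMeasurable_velHat h1.1) (Eventually.of_forall fun ξ => ?_)
  rcases eq_or_ne ξ 0 with rfl | hξ
  · simp [velHat]
  have h0 : 0 < ‖ξ‖ := norm_pos_iff.2 hξ
  have := norm_velHat_le h ξ
  rw [← mul_assoc, mul_comm _ ‖ξ‖⁻¹, mul_assoc, ← div_eq_inv_mul, le_div_iff₀ h0, mul_comm]
  exact this

/-- The Fourier transform of the gradient of the velocity, a linear map acting on `ℂ³`. -/
noncomputable def gradHat (h : E3 → C3) (ξ : E3) : C3 →L[ℂ] C3 :=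
  ((2 * (Real.pi : ℂ) * Complex.I) • innerSL ℂ (toC3 ξ)).smulRight (velHat h ξ)

theorem norm_gradHat_le (h : E3 → C3) (ξ : E3) :
    ‖gradHat h ξ‖ ≤ 2 * Real.pi * ‖crossC‖ * ‖h ξ‖ := by
  rw [gradHat, ContinuousLinearMap.norm_smulRight_apply, norm_smul, innerSL_apply_norm, norm_toC3]
  have h1 : ‖(2 * (Real.pi : ℂ) * Complex.I)‖ = 2 * Real.pi := by
    simp [abs_of_pos Real.pi_pos]
  rw [h1, mul_assoc, mul_assoc (2 * Real.pi)]
  exact mul_le_mul_of_nonneg_left (norm_velHat_le h ξ) (by positivity)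

theorem aestronglyMeasurable_gradHat {h : E3 → C3} (hm : AEStronglyMeasurable h volume) :
    AEStronglyMeasurable (gradHat h) volume := by
  have hc0 : Continuous fun ξ : E3 => innerSL ℂ (toC3 ξ) :=
    (innerSL ℂ (E := C3)).continuous.comp toC3.continuous
  have hc : Continuous fun ξ : E3 => (2 * (Real.pi : ℂ) * Complex.I) • innerSL ℂ (toC3 ξ) := by
    fun_prop
  exact (ContinuousLinearMap.smulRightL ℂ C3 C3).aestronglyMeasurable_comp₂
    hc.aestronglyMeasurable (aestronglyMeasurable_velHat hm)

theorem integrable_gradHat {h : E3 → C3} (h1 : Integrable h) : Integrable (gradHat h) :=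
  (h1.norm.const_mul (2 * Real.pi * ‖crossC‖)).mono' (aestronglyMeasurable_gradHat h1.1)
    (Eventually.of_forall fun ξ => norm_gradHat_le h ξ)

theorem memLp_gradHat {s : ℝ} (hs : 0 ≤ s) {h : E3 → C3} (hh : MemLp h 2 (sobolevMeasure s)) :
    MemLp (gradHat h) 2 (sobolevMeasure s) :=
  (hh.norm.const_mul (2 * Real.pi * ‖crossC‖)).mono'
    ((aestronglyMeasurable_gradHat (MemLp.of_sobolevMeasure hs hh).1).mono_ac
      (sobolevMeasure_absolutelyContinuous s))
    (Eventually.of_forall fun ξ => norm_gradHat_le h ξ)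

theorem eLpNorm_gradHat_le (p : ℝ≥0∞) (μ : Measure E3) (h : E3 → C3) :
    eLpNorm (gradHat h) p μ ≤ ENNReal.ofReal (2 * Real.pi * ‖crossC‖) * eLpNorm h p μ :=
  eLpNorm_le_mul_eLpNorm_of_ae_le_mul (Eventually.of_forall fun ξ => norm_gradHat_le h ξ) p

theorem fourierInv_apply_clm {F G : Type*} [NormedAddCommGroup F] [NormedSpace ℂ F]
    [NormedAddCommGroup G] [NormedSpace ℂ G] [CompleteSpace G]
    {A : E3 → F →L[ℂ] G} (hA : Integrable A) (x : E3) (v : F) :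
    𝓕⁻ A x v = 𝓕⁻ (fun ξ => A ξ v) x := by
  rw [Real.fourierInv_eq', Real.fourierInv_eq']
  rw [ContinuousLinearMap.integral_apply]
  · rfl
  · have := (Real.fourierIntegral_convergent_iff (-x)).2 hA
    refine this.congr (Eventually.of_forall fun ξ => ?_)
    simp [Circle.smul_def, Real.fourierChar_apply]

theorem hasFDerivAt_fourierInv_velHat {h : E3 → C3} (h1 : Integrable h) (h2 : MemLp h 2 volume)
    (x : E3) :
    HasFDerivAt (𝓕⁻ (velHat h)) (((𝓕⁻ (gradHat h) x).restrictScalars ℝ).comp toC3) x := by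
  have hv' : Integrable fun ξ => ‖ξ‖ * ‖velHat h ξ‖ :=
    (h1.norm.const_mul ‖crossC‖).mono'
      (continuous_norm.aestronglyMeasurable.mul (aestronglyMeasurable_velHat h1.1).norm)
      (Eventually.of_forall fun ξ => by
        rw [Real.norm_of_nonneg (by positivity)]; exact norm_velHat_le h ξ)
  have h3 := VectorFourier.hasFDerivAt_fourierIntegral (-innerSL ℝ (E := E3))
    (integrable_velHat h1 h2) hv' x
  have hi : Integrable (VectorFourier.fourierSMulRight (-innerSL ℝ (E := E3)) (velHat h)) := by
    refine (hv'.const_mul (2 * Real.pi)).mono'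
      (aestronglyMeasurable_velHat h1.1).fourierSMulRight (Eventually.of_forall fun ξ => ?_)
    rw [VectorFourier.norm_fourierSMulRight, ← mul_assoc, neg_apply, norm_neg,
      innerSL_apply_norm]
  have h4 : ((𝓕⁻ (gradHat h) x).restrictScalars ℝ).comp toC3 =
      VectorFourier.fourierIntegral Real.fourierChar volume (-innerSL ℝ (E := E3)).toLinearMap₁₂
        (VectorFourier.fourierSMulRight (-innerSL ℝ (E := E3)) (velHat h)) x := by
    ext1 v
    rw [ContinuousLinearMap.comp_apply, ContinuousLinearMap.coe_restrictScalars',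
      fourierInv_apply_clm (integrable_gradHat h1)]
    rw [VectorFourier.fourierIntegral, ContinuousLinearMap.integral_apply]
    · rw [Real.fourierInv_eq]
      refine integral_congr_ae (Eventually.of_forall fun ξ => ?_)
      have hin : inner ℂ (toC3 ξ) (toC3 v) = ((inner ℝ ξ v : ℝ) : ℂ) := by
        simp [PiLp.inner_apply]
      change Real.fourierChar (inner ℝ ξ x) • gradHat h ξ (toC3 v) =
        Real.fourierChar (-(-inner ℝ ξ x)) •
          VectorFourier.fourierSMulRight (-innerSL ℝ (E := E3)) (velHat h) ξ v
      simp [gradHat, hin, mul_smul]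
      rfl
    · have := (VectorFourier.fourierIntegral_convergent_iff (L := -innerₗ E3)
        Real.continuous_fourierChar (by exact (innerSL ℝ).continuous₂.neg) x).2 hi
      exact this
  rw [h4]
  exact h3

/-- The velocity is differentiable, and its gradient is the inverse Fourier integral of
`gradHat`. -/
theorem hasFDerivAt_velocity {s : ℝ} (hs : 3 / 2 < s) {f : E3 → E3} (hf : MemHs s f) (x : E3) :
    HasFDerivAt (velocity f)
      (reC3.comp (((𝓕⁻ (gradHat (hat f)) x).restrictScalars ℝ).comp toC3)) x := by
  rw [velocity_eq]
  exact reC3.hasFDerivAt.comp x (hasFDerivAt_fourierInv_velHat (hf.integrable_hat hs)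
    (MemLp.of_sobolevMeasure (by linarith) hf.memLp_hat) x)

open scoped Convolution in
/-- The Fourier transform of the stretching term `(ω · ∇) u`, for `b = ω̂` and a velocity `u`
induced by the vorticity with Fourier transform `a`. -/
noncomputable def stretchHat (a b : E3 → C3) : E3 → C3 :=
  gradHat a ⋆[ContinuousLinearMap.id ℂ (C3 →L[ℂ] C3)] b

theorem memLp_stretchHat {s : ℝ} (hs : 3 / 2 < s) {a b : E3 → C3}
    (ha : MemLp a 2 (sobolevMeasure s)) (hb : MemLp b 2 (sobolevMeasure s)) :
    MemLp (stretchHat a b) 2 (sobolevMeasure s) ∧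
    eLpNorm (stretchHat a b) 2 (sobolevMeasure s) ≤
      ENNReal.ofReal (2 ^ s) * (2 * sobolevConst s) * ENNReal.ofReal (2 * Real.pi * ‖crossC‖) *
        (eLpNorm a 2 (sobolevMeasure s) * eLpNorm b 2 (sobolevMeasure s)) := by
  have hs0 : 0 ≤ s := by linarith
  have hg := memLp_gradHat hs0 ha
  have h1 := eLpNorm_convolution_le hs (ContinuousLinearMap.id ℂ (C3 →L[ℂ] C3))
    (fun x y => x.le_opNorm y) hg hb
  refine ⟨⟨?_, h1.trans_lt ?_⟩, h1.trans ?_⟩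
  · exact ((MemLp.integrable_of_sobolevMeasure hs hg).integrable_convolution _
      (MemLp.integrable_of_sobolevMeasure hs hb)).1.mono_ac (sobolevMeasure_absolutelyContinuous s)
  · exact ENNReal.mul_lt_top (ENNReal.mul_lt_top ENNReal.ofReal_lt_top
      (ENNReal.mul_lt_top ENNReal.ofNat_lt_top (sobolevConst_lt_top hs)))
      (ENNReal.mul_lt_top hg.2 hb.2)
  · rw [mul_assoc _ (ENNReal.ofReal (2 * Real.pi * ‖crossC‖)), ← mul_assoc (ENNReal.ofReal
      (2 * Real.pi * ‖crossC‖))]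
    gcongr
    exact eLpNorm_gradHat_le _ _ _

theorem fourierInv_stretchHat {a b : E3 → C3} (ha : Integrable a) (hb : Integrable b) (x : E3) :
    𝓕⁻ (stretchHat a b) x = 𝓕⁻ (gradHat a) x (𝓕⁻ b x) := by
  simp only [Real.fourierInv_eq_fourier_neg]
  exact Real.fourier_bilin_convolution_eq _ (integrable_gradHat ha) hb (-x)

theorem complexify_apply (f : E3 → E3) (x : E3) : complexify f x = toC3 (f x) := rfl

theorem stretching_apply {s : ℝ} (hs : 3 / 2 < s) {f : E3 → E3} (hf : MemHs s f) (x : E3) :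
    stretching f x = reC3 (𝓕⁻ (gradHat (hat f)) x (𝓕⁻ (hat f) x)) := by
  rw [stretching, (hasFDerivAt_velocity hs hf x).fderiv, ← hf.complexify_eq hs]
  rfl

theorem realField_apply (g : E3 → C3) (x : E3) : realField g x = reC3 (𝓕⁻ g x) := rfl

theorem stretching_eq_realField {s : ℝ} (hs : 3 / 2 < s) {f : E3 → E3} (hf : MemHs s f) :
    stretching f = realField (stretchHat (hat f) (hat f)) := by
  ext1 x
  rw [stretching_apply hs hf, realField_apply,
    fourierInv_stretchHat (hf.integrable_hat hs) (hf.integrable_hat hs)]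

theorem MemHs.stretching {s : ℝ} (hs : 3 / 2 < s) {f : E3 → E3} (hf : MemHs s f) :
    MemHs s (stretching f) := by
  rw [stretching_eq_realField hs hf]
  exact (memHs_realField hs (memLp_stretchHat hs hf.memLp_hat hf.memLp_hat).1).1

/-- The constant of the bilinear estimates for the stretching term. -/
noncomputable def stretchConst (s : ℝ) : ℝ≥0∞ :=
  ENNReal.ofReal (2 ^ s) * (2 * sobolevConst s) * ENNReal.ofReal (2 * Real.pi * ‖crossC‖)

theorem stretchConst_lt_top {s : ℝ} (hs : 3 / 2 < s) : stretchConst s < ⊤ :=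
  ENNReal.mul_lt_top (ENNReal.mul_lt_top ENNReal.ofReal_lt_top
    (ENNReal.mul_lt_top ENNReal.ofNat_lt_top (sobolevConst_lt_top hs))) ENNReal.ofReal_lt_top

theorem fourierInv_sub {F : Type*} [NormedAddCommGroup F] [NormedSpace ℂ F] {a b : E3 → F}
    (ha : Integrable a) (hb : Integrable b) (x : E3) :
    𝓕⁻ (a - b) x = 𝓕⁻ a x - 𝓕⁻ b x := by
  simp only [Real.fourierInv_eq, Pi.sub_apply, smul_sub]
  have h : ∀ {c : E3 → F}, Integrable c →
      Integrable fun v => Real.fourierChar (inner ℝ v x) • c v := fun hc => by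
    simpa using (Real.fourierIntegral_convergent_iff (-x)).2 hc
  exact integral_sub (h ha) (h hb)

theorem gradHat_sub (a b : E3 → C3) : gradHat (a - b) = gradHat a - gradHat b := by
  ext1 ξ
  simp only [gradHat, velHat, Pi.sub_apply, map_sub, smul_sub]
  ext v : 1
  simp [smul_sub]

/-- The stretching term is locally Lipschitz continuous in `H^s`. -/
theorem hsNorm_stretching_sub_le {s : ℝ} (hs : 3 / 2 < s) {f g : E3 → E3} (hf : MemHs s f)
    (hg : MemHs s g) : hsNorm s (stretching f - stretching g) ≤
      stretchConst s * ((hsNorm s f + hsNorm s g) * hsNorm s (f - g)) := by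
  set a := hat f
  set b := hat g
  have ha := hf.memLp_hat
  have hb := hg.memLp_hat
  have hab : MemLp (a - b) 2 (sobolevMeasure s) := ha.sub hb
  have hd : eLpNorm (a - b) 2 (sobolevMeasure s) = hsNorm s (f - g) := by
    rw [(hf.sub hg).hsNorm_eq]
    exact eLpNorm_congr_ae ((sobolevMeasure_absolutelyContinuous s).ae_eq
      (hat_sub hf.memLp_complexify hg.memLp_complexify)).symm
  have hi := hf.integrable_hat hs
  have hj := hg.integrable_hat hs
  obtain ⟨h1, h1'⟩ := memLp_stretchHat hs hab ha
  obtain ⟨h2, h2'⟩ := memLp_stretchHat hs hb hab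
  -- bilinearity: `B(f, f) - B(g, g) = B(f - g, f) + B(g, f - g)`
  have key : stretching f - stretching g =
      realField (stretchHat (a - b) a + stretchHat b (a - b)) := by
    ext1 x
    rw [Pi.sub_apply, stretching_apply hs hf, stretching_apply hs hg, realField_apply, ← map_sub]
    congr 1
    have h3 : 𝓕⁻ (stretchHat (a - b) a + stretchHat b (a - b)) x =
        𝓕⁻ (stretchHat (a - b) a) x + 𝓕⁻ (stretchHat b (a - b)) x := by
      have := fourierInv_sub (MemLp.integrable_of_sobolevMeasure hs (h1.add h2))
        (MemLp.integrable_of_sobolevMeasure hs h2) x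
      rw [add_sub_cancel_right] at this
      rw [this, sub_add_cancel]
    rw [h3, fourierInv_stretchHat (hi.sub hj) hi, fourierInv_stretchHat hj (hi.sub hj),
      gradHat_sub, fourierInv_sub (integrable_gradHat hi) (integrable_gradHat hj),
      fourierInv_sub hi hj]
    simp
  rw [key]
  refine (memHs_realField hs (h1.add h2)).2.1.trans ?_
  refine (eLpNorm_add_le h1.1 h2.1 one_le_two).trans ((add_le_add h1' h2').trans (le_of_eq ?_))
  rw [hd, hf.hsNorm_eq, hg.hsNorm_eq, stretchConst]
  ring

/-- The constant in the bound of the velocity gradient by the norm of the vorticity. -/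
noncomputable def gradConst (s : ℝ) : ℝ≥0∞ :=
  ENNReal.ofReal (2 * Real.pi * ‖crossC‖) * sobolevConst s

theorem gradConst_lt_top {s : ℝ} (hs : 3 / 2 < s) : gradConst s < ⊤ :=
  ENNReal.mul_lt_top ENNReal.ofReal_lt_top (sobolevConst_lt_top hs)

/-- The stretching term at a point is bounded by the vorticity at this point, as the velocity
gradient is bounded. -/
theorem enorm_stretching_le {s : ℝ} (hs : 3 / 2 < s) {f : E3 → E3} (hf : MemHs s f) (x : E3) :
    ‖stretching f x‖ₑ ≤ gradConst s * hsNorm s f * ‖f x‖ₑ := by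
  have h1 : ‖stretching f x‖ ≤ ‖𝓕⁻ (gradHat (hat f)) x‖ * ‖f x‖ := by
    rw [stretching_apply hs hf, ← hf.complexify_eq hs]
    refine (norm_reC3_le _).trans ((ContinuousLinearMap.le_opNorm _ _).trans ?_)
    rw [norm_complexify]
  calc ‖stretching f x‖ₑ ≤ ‖𝓕⁻ (gradHat (hat f)) x‖ₑ * ‖f x‖ₑ := by
        rw [← ofReal_norm, ← ofReal_norm, ← ofReal_norm, ← ENNReal.ofReal_mul (norm_nonneg _)]
        exact ENNReal.ofReal_le_ofReal h1
    _ ≤ _ := by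
        gcongr
        refine (enorm_fourierInv_le _ _).trans ((eLpNorm_gradHat_le _ _ _).trans ?_)
        rw [gradConst, mul_assoc (ENNReal.ofReal _), hf.hsNorm_eq]
        refine mul_le_mul_right ?_ _
        exact eLpNorm_one_le_sobolevConst_mul (aestronglyMeasurable_hat f)

/-! ### The Biot–Savart law -/

/-- A multiplier `m` that is a superposition of nonnegative kernels `k · l`, `l > 0`, acts by
superposition. -/
theorem integral_smul_eq_integral_integral {k : E3 → ℝ → ℝ} {m : E3 → ℝ} {g : E3 → C3}
    (hk : Measurable (Function.uncurry k)) (hk0 : ∀ ξ, ∀ l ∈ Ioi (0 : ℝ), 0 ≤ k ξ l)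
    (hm : ∀ᵐ ξ, IntegrableOn (k ξ) (Ioi 0) ∧ ∫ l in Ioi 0, k ξ l = m ξ)
    (hg : AEStronglyMeasurable g) (hi : Integrable fun ξ => m ξ * ‖g ξ‖) :
    ∫ ξ, m ξ • g ξ = ∫ l in Ioi 0, ∫ ξ, k ξ l • g ξ := by
  have h1 : Integrable (Function.uncurry fun ξ l => k ξ l • g ξ)
      ((volume : Measure E3).prod (volume.restrict (Ioi 0))) := by
    have hm' : AEStronglyMeasurable (Function.uncurry fun ξ l => k ξ l • g ξ)
        ((volume : Measure E3).prod (volume.restrict (Ioi 0))) :=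
      hk.aestronglyMeasurable.smul hg.comp_fst
    rw [integrable_prod_iff hm']
    refine ⟨?_, ?_⟩
    · filter_upwards [hm] with ξ h
      exact h.1.smul_const (g ξ)
    · refine hi.congr ?_
      filter_upwards [hm] with ξ h
      simp only [Function.uncurry, norm_smul]
      rw [integral_mul_const, ← h.2]
      congr 1
      refine setIntegral_congr_fun measurableSet_Ioi fun l hl => ?_
      exact (Real.norm_of_nonneg (hk0 ξ l hl)).symm
  rw [← integral_integral_swap h1]
  refine integral_congr_ae ?_
  filter_upwards [hm] with ξ h
  rw [integral_smul_const, h.2]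

/-- `∫₀^∞ c λ⁻² exp (-c / λ) dλ = 1`, with the integrand the derivative of `exp (-c / λ)`. -/
theorem integral_inv_sq_mul_exp_neg_div {c : ℝ} (hc : 0 < c) :
    IntegrableOn (fun l : ℝ => c / l ^ 2 * Real.exp (-c / l)) (Ioi 0) ∧
      ∫ l in Ioi 0, c / l ^ 2 * Real.exp (-c / l) = 1 := by
  set F : ℝ → ℝ := fun l => expNegInvGlue (l / c)
  have hF : ∀ l ∈ Ioi (0 : ℝ), F l = Real.exp (-c / l) := by
    intro l hl
    have : 0 < l / c := div_pos hl hc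
    simp [F, expNegInvGlue, not_le.2 this, neg_div]
  have hcont : ContinuousWithinAt F (Ici 0) 0 := by
    have : Continuous F := (expNegInvGlue.contDiff (n := 0)).continuous.comp (by fun_prop)
    exact this.continuousWithinAt
  have hd : ∀ l ∈ Ioi (0 : ℝ), HasDerivAt F (c / l ^ 2 * Real.exp (-c / l)) l := by
    intro l hl
    have hl' : l ≠ 0 := ne_of_gt hl
    have h1 : HasDerivAt (fun l : ℝ => Real.exp (-c / l)) (c / l ^ 2 * Real.exp (-c / l)) l := by
      have h2 : HasDerivAt (fun l : ℝ => -c / l) (c / l ^ 2) l := by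
        have := (hasDerivAt_inv hl').const_mul (-c)
        refine (this.congr_deriv ?_).congr_of_eventuallyEq ?_
        · field_simp
        · exact Eventually.of_forall fun x => by simp [div_eq_mul_inv]
      convert! h2.exp using 1
      ring
    refine h1.congr_of_eventuallyEq ?_
    filter_upwards [Ioi_mem_nhds hl] with x hx using hF x hx
  have hnn : ∀ l ∈ Ioi (0 : ℝ), 0 ≤ c / l ^ 2 * Real.exp (-c / l) := fun l _ => by positivity
  have hlim : Tendsto F atTop (𝓝 1) := by
    have h1 : Tendsto (fun l : ℝ => Real.exp (-c / l)) atTop (𝓝 1) := by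
      have : Tendsto (fun l : ℝ => -c / l) atTop (𝓝 0) := tendsto_const_nhds.div_atTop tendsto_id
      have h := (Real.continuous_exp.tendsto 0).comp this
      rwa [Real.exp_zero] at h
    refine h1.congr' ?_
    filter_upwards [Ioi_mem_atTop 0] with x hx using (hF x hx).symm
  have h0 : F 0 = 0 := by simp [F]
  refine ⟨integrableOn_Ioi_deriv_of_nonneg hcont hd hnn hlim, ?_⟩
  rw [integral_Ioi_of_hasDerivAt_of_nonneg hcont hd hnn hlim, h0, sub_zero]

/-- The kernel `R⁻³` as a superposition of the Gaussians `exp (-π l R²)`. -/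
theorem integral_sqrt_mul_exp_neg {R : ℝ} (hR : 0 < R) :
    IntegrableOn (fun l : ℝ => l ^ (1 / 2 : ℝ) * Real.exp (-(Real.pi * R ^ 2 * l))) (Ioi 0) ∧
      ∫ l in Ioi 0, l ^ (1 / 2 : ℝ) * Real.exp (-(Real.pi * R ^ 2 * l)) =
        (2 * Real.pi * R ^ 3)⁻¹ := by
  have hp := Real.pi_pos
  have hr : 0 < Real.pi * R ^ 2 := by positivity
  have h := Real.integral_rpow_mul_exp_neg_mul_Ioi (a := 3 / 2) (by norm_num) hr
  rw [show (3 / 2 : ℝ) - 1 = 1 / 2 by norm_num] at h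
  have hval : (1 / (Real.pi * R ^ 2)) ^ (3 / 2 : ℝ) * Real.Gamma (3 / 2) =
      (2 * Real.pi * R ^ 3)⁻¹ := by
    have hG : Real.Gamma (3 / 2) = 1 / 2 * Real.sqrt Real.pi := by
      rw [show (3 / 2 : ℝ) = 1 / 2 + 1 by norm_num, Real.Gamma_add_one (by norm_num),
        Real.Gamma_one_half_eq]
    have h1 : (Real.pi * R ^ 2) ^ (3 / 2 : ℝ) = Real.pi * Real.sqrt Real.pi * R ^ 3 := by
      rw [show (3 / 2 : ℝ) = 1 + 1 / 2 by norm_num, Real.rpow_add hr, Real.rpow_one,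
        ← Real.sqrt_eq_rpow, Real.sqrt_mul hp.le, Real.sqrt_sq hR.le]
      ring
    have hs : 0 < Real.sqrt Real.pi := Real.sqrt_pos.2 hp
    rw [hG, Real.div_rpow zero_le_one hr.le, Real.one_rpow, h1]
    field_simp
  refine ⟨?_, h.trans hval⟩
  by_contra hni
  -- the value of the integral is positive, and not the default value for nonintegrable functions
  have hzero : ∫ l in Ioi 0, l ^ (1 / 2 : ℝ) * Real.exp (-(Real.pi * R ^ 2 * l)) = 0 :=
    integral_undef hni
  have hpos : 0 < (2 * Real.pi * R ^ 3)⁻¹ := by positivity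
  rw [← hval, ← h, hzero] at hpos
  exact lt_irrefl _ hpos

/-- The function `x ↦ ⟨x, w⟩ exp (-π λ |x|²)`. -/
noncomputable def gaussMoment (l : ℝ) (w x : E3) : ℂ :=
  ((inner ℝ x w : ℝ) : ℂ) * Complex.exp (-((Real.pi * l : ℝ) : ℂ) * ‖x‖ ^ 2)

theorem norm_gauss (l : ℝ) (x : E3) :
    ‖Complex.exp (-((Real.pi * l : ℝ) : ℂ) * ‖x‖ ^ 2)‖ = Real.exp (-(Real.pi * l * ‖x‖ ^ 2)) := by
  rw [Complex.norm_exp]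
  congr 1
  rw [← Complex.ofReal_pow, ← Complex.ofReal_neg, ← Complex.ofReal_mul, Complex.ofReal_re]
  ring

theorem integrable_gauss {l : ℝ} (hl : 0 < l) :
    Integrable fun x : E3 => Complex.exp (-((Real.pi * l : ℝ) : ℂ) * ‖x‖ ^ 2) := by
  have := GaussianFourier.integrable_cexp_neg_mul_sq_norm_add (V := E3)
    (b := ((Real.pi * l : ℝ) : ℂ)) (by rw [Complex.ofReal_re]; positivity) 0 0
  simpa using this

theorem integrable_norm_mul_gauss {l : ℝ} (hl : 0 < l) :
    Integrable fun x : E3 => ‖x‖ * ‖Complex.exp (-((Real.pi * l : ℝ) : ℂ) * ‖x‖ ^ 2)‖ := by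
  have hp := Real.pi_pos
  have hl2 : 0 < l / 2 := by positivity
  refine ((integrable_gauss hl2).norm.const_mul (1 + 2 / (Real.pi * l))).mono'
    (Continuous.aestronglyMeasurable (by fun_prop)) (Eventually.of_forall fun x => ?_)
  rw [norm_gauss, norm_gauss, Real.norm_of_nonneg (by positivity)]
  set a := Real.pi * (l / 2) * ‖x‖ ^ 2 with ha
  have ha0 : 0 ≤ a := by positivity
  have h1 : Real.exp (-(Real.pi * l * ‖x‖ ^ 2)) = Real.exp (-a) * Real.exp (-a) := by
    rw [← Real.exp_add]; congr 1; rw [ha]; ring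
  rw [h1, ← mul_assoc]
  refine mul_le_mul_of_nonneg_right ?_ (Real.exp_pos _).le
  have h2 : a * Real.exp (-a) ≤ 1 := by
    rw [Real.exp_neg, ← div_eq_mul_inv, div_le_one (Real.exp_pos _)]
    linarith [Real.add_one_le_exp a]
  have h3 : Real.exp (-a) ≤ 1 := Real.exp_le_one_iff.2 (by linarith)
  have h4 : ‖x‖ ≤ 1 + 2 / (Real.pi * l) * a := by
    have : 2 / (Real.pi * l) * a = ‖x‖ ^ 2 := by rw [ha]; field_simp
    rw [this]; nlinarith [sq_nonneg (‖x‖ - 1), norm_nonneg x]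
  calc ‖x‖ * Real.exp (-a) ≤ (1 + 2 / (Real.pi * l) * a) * Real.exp (-a) := by gcongr
    _ = Real.exp (-a) + 2 / (Real.pi * l) * (a * Real.exp (-a)) := by ring
    _ ≤ 1 + 2 / (Real.pi * l) * 1 := by gcongr
    _ = _ := by ring

theorem integrable_gaussMoment {l : ℝ} (hl : 0 < l) (w : E3) : Integrable (gaussMoment l w) := by
  refine ((integrable_norm_mul_gauss hl).const_mul ‖w‖).mono'
    (Continuous.aestronglyMeasurable (by unfold gaussMoment; fun_prop))
    (Eventually.of_forall fun x => ?_)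
  rw [gaussMoment, norm_mul, Complex.norm_real, ← mul_assoc]
  gcongr
  rw [mul_comm]
  exact norm_inner_le_norm x w

/-- The function `gaussMoment` is a multiple of a derivative of a Gaussian, so that its transform is
again of the same form. -/
theorem fourier_gaussMoment {l : ℝ} (hl : 0 < l) (w ξ : E3) :
    𝓕 (gaussMoment l w) ξ = -Complex.I * ((l ^ (-(5 / 2) : ℝ) : ℝ) : ℂ) *
      ((inner ℝ ξ w : ℝ) : ℂ) * ((Real.exp (-(Real.pi * ‖ξ‖ ^ 2) / l) : ℝ) : ℂ) := by
  have hp := Real.pi_pos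
  set G : E3 → ℂ := fun x => Complex.exp (-((Real.pi * l : ℝ) : ℂ) * ‖x‖ ^ 2) with hG
  have hFG : 𝓕 G = fun ξ => ((l ^ (-(3 / 2) : ℝ) * Real.exp (-(Real.pi / l) * ‖ξ‖ ^ 2) : ℝ) : ℂ) := by
    ext1 ξ
    rw [hG, fourier_gaussian_innerProductSpace (by rw [Complex.ofReal_re]; positivity)]
    rw [Complex.ofReal_mul (l ^ (-(3 / 2) : ℝ)), Complex.ofReal_exp]
    congr 1
    · have h1 : (Real.pi : ℂ) / ((Real.pi * l : ℝ) : ℂ) = ((l⁻¹ : ℝ) : ℂ) := by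
        rw [← Complex.ofReal_div]; congr 1; field_simp
      rw [h1, show ((Module.finrank ℝ E3 : ℂ) / 2) = ((3 / 2 : ℝ) : ℂ) by simp,
        ← Complex.ofReal_cpow (by positivity), Real.inv_rpow hl.le, Real.rpow_neg hl.le]
    · congr 1
      push_cast
      have : (l : ℂ) ≠ 0 := by exact_mod_cast hl.ne'
      have : (Real.pi : ℂ) ≠ 0 := by exact_mod_cast hp.ne'
      field_simp
  have h1 := (Real.hasFDerivAt_fourier (integrable_gauss hl) (integrable_norm_mul_gauss hl) ξ)
  have h2 : HasFDerivAt (fun ξ : E3 =>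
      ((l ^ (-(3 / 2) : ℝ) * Real.exp (-(Real.pi / l) * ‖ξ‖ ^ 2) : ℝ) : ℂ))
      (Complex.ofRealCLM.comp (l ^ (-(3 / 2) : ℝ) • (Real.exp (-(Real.pi / l) * ‖ξ‖ ^ 2) •
        (-(Real.pi / l)) • (2 • innerSL ℝ ξ)))) ξ := by
    refine Complex.ofRealCLM.hasFDerivAt.comp ξ (HasFDerivAt.const_mul ?_ _)
    refine HasFDerivAt.exp (HasFDerivAt.const_mul ?_ _)
    exact (hasStrictFDerivAt_norm_sq ξ).hasFDerivAt
  have h3 := (hFG ▸ h1).unique h2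
  have h4 := congrArg (fun A : E3 →L[ℝ] ℂ => A w) h3
  have h5 : (𝓕 (VectorFourier.fourierSMulRight (innerSL ℝ) G) ξ) w =
      -(2 * Real.pi * Complex.I) * 𝓕 (gaussMoment l w) ξ := by
    rw [Real.fourier_eq, Real.fourier_eq, ContinuousLinearMap.integral_apply]
    · rw [← smul_eq_mul, ← integral_smul]
      refine integral_congr_ae (Eventually.of_forall fun x => ?_)
      change Real.fourierChar _ • (VectorFourier.fourierSMulRight (innerSL ℝ) G x w) = _
      rw [VectorFourier.fourierSMulRight_apply, smul_comm]
      congr 2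
    · rw [Real.fourierIntegral_convergent_iff]
      refine ((integrable_norm_mul_gauss hl).const_mul (2 * Real.pi)).mono'
        (integrable_gauss hl).1.fourierSMulRight (Eventually.of_forall fun x => ?_)
      rw [VectorFourier.norm_fourierSMulRight, innerSL_apply_norm, mul_assoc]
  have h6 : -(2 * Real.pi * Complex.I) * 𝓕 (gaussMoment l w) ξ =
      ((l ^ (-(3 / 2) : ℝ) * (Real.exp (-(Real.pi / l) * ‖ξ‖ ^ 2) *
        (-(Real.pi / l) * (2 * inner ℝ ξ w))) : ℝ) : ℂ) := by
    rw [← h5]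
    refine h4.trans ?_
    simp
  have h7 : l ^ (-(3 / 2) : ℝ) = l * l ^ (-(5 / 2) : ℝ) := by
    rw [show (-(3 / 2) : ℝ) = 1 + -(5 / 2) by norm_num, Real.rpow_add hl, Real.rpow_one]
  have h8 : -(Real.pi * ‖ξ‖ ^ 2) / l = -(Real.pi / l) * ‖ξ‖ ^ 2 := by ring
  have hne : -(2 * (Real.pi : ℂ) * Complex.I) ≠ 0 := by
    simp [Complex.I_ne_zero, hp.ne']
  refine mul_left_cancel₀ hne (h6.trans ?_)
  rw [h7, h8]
  have hlc : (l : ℂ) ≠ 0 := by exact_mod_cast hl.ne'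
  push_cast
  field_simp
  rw [Complex.I_sq]
  ring

open scoped Convolution in
theorem fourierInv_fourier_gaussMoment_smul {l : ℝ} (hl : 0 < l) (w x : E3) {f : E3 → C3}
    (hc : Continuous f) (hf : Integrable f) (hb : BddAbove (range fun x => ‖f x‖))
    (hF : Integrable (𝓕 f)) :
    𝓕⁻ (fun ξ => 𝓕 (gaussMoment l w) ξ • 𝓕 f ξ) x =
      ∫ y, gaussMoment l w (x - y) • f y := by
  have hΦ := integrable_gaussMoment hl w
  set C := gaussMoment l w ⋆[ContinuousLinearMap.lsmul ℂ ℂ] f with hC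
  have h1 : 𝓕 C = fun ξ => 𝓕 (gaussMoment l w) ξ • 𝓕 f ξ := by
    ext1 ξ
    exact Real.fourier_smul_convolution_eq hΦ hf ξ
  have h2 : Integrable (𝓕 C) := by
    rw [h1]
    refine hF.bdd_smul (∫ v, ‖gaussMoment l w v‖)
      (continuous_fourier hΦ).aestronglyMeasurable (Eventually.of_forall fun ξ => ?_)
    exact VectorFourier.norm_fourierIntegral_le_integral_norm _ _ _ _ _
  have h3 : Continuous C := hb.continuous_convolution_right_of_integrable _ hΦ hc
  rw [← h1, h3.fourierInv_fourier_eq (hΦ.integrable_convolution _ hf) h2, hC, convolution_eq_swap]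
  rfl

/-- The multiplier `ξ / |ξ|²` is the convolution with a multiple of `x / |x|³`: both are
superpositions of the Gaussian moments `gaussMoment l`, with corresponding weights in `l`. -/
theorem fourierInv_inner_div_smul_fourier {f : E3 → C3} (hc : Continuous f) (hf : Integrable f)
    (hb : BddAbove (range fun x => ‖f x‖)) (hF : Integrable (𝓕 f))
    (hF' : Integrable fun ξ => ‖ξ‖⁻¹ * ‖𝓕 f ξ‖) (x w : E3)
    (hK : Integrable fun y => (‖x - y‖ ^ 2)⁻¹ * ‖f y‖) :
    𝓕⁻ (fun ξ => (inner ℝ ξ w / ‖ξ‖ ^ 2) • 𝓕 f ξ) x =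
      (Complex.I / 2) • ∫ y, (inner ℝ (x - y) w / ‖x - y‖ ^ 3) • f y := by
  have hp := Real.pi_pos
  have hne : ∀ z : E3, ∀ᵐ ξ : E3, ξ ≠ z := fun z => Measure.ae_ne volume z
  have hmF : AEStronglyMeasurable (fun ξ => inner ℝ ξ w • 𝓕 f ξ) volume :=
    AEStronglyMeasurable.fun_smul
      (Continuous.aestronglyMeasurable (f := fun ξ : E3 => inner ℝ ξ w) (by fun_prop)) hF.1
  have hmF' : AEStronglyMeasurable
      (fun ξ => Real.fourierChar (inner ℝ ξ x) • inner ℝ ξ w • 𝓕 f ξ) volume :=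
    AEStronglyMeasurable.fun_smul (Continuous.aestronglyMeasurable
      (f := fun ξ : E3 => Real.fourierChar (inner ℝ ξ x))
      (Real.continuous_fourierChar.comp (by fun_prop))) hmF
  have hmf : AEStronglyMeasurable (fun y => inner ℝ (x - y) w • f y) volume :=
    AEStronglyMeasurable.fun_smul
      (Continuous.aestronglyMeasurable (f := fun y : E3 => inner ℝ (x - y) w) (by fun_prop)) hf.1
  have hdF : Integrable fun ξ => (‖ξ‖ ^ 2)⁻¹ *
      ‖Real.fourierChar (inner ℝ ξ x) • inner ℝ ξ w • 𝓕 f ξ‖ := by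
    refine (hF'.const_mul ‖w‖).mono' ?_ (Eventually.of_forall fun ξ => ?_)
    · exact (Measurable.aestronglyMeasurable (f := fun ξ : E3 => (‖ξ‖ ^ 2)⁻¹)
        (by fun_prop)).mul hmF'.norm
    · rw [Real.norm_of_nonneg (by positivity), Circle.norm_smul, norm_smul]
      rcases eq_or_ne ξ 0 with rfl | hξ
      · simp
      have h0 : 0 < ‖ξ‖ := norm_pos_iff.2 hξ
      calc (‖ξ‖ ^ 2)⁻¹ * (‖inner ℝ ξ w‖ * ‖𝓕 f ξ‖)
          ≤ (‖ξ‖ ^ 2)⁻¹ * ((‖ξ‖ * ‖w‖) * ‖𝓕 f ξ‖) := by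
            gcongr; exact norm_inner_le_norm ξ w
        _ = _ := by field_simp
  have hdf : Integrable fun y => (2 * Real.pi * ‖x - y‖ ^ 3)⁻¹ * ‖inner ℝ (x - y) w • f y‖ := by
    refine (hK.const_mul ((2 * Real.pi)⁻¹ * ‖w‖)).mono' ?_ (Eventually.of_forall fun y => ?_)
    · exact (Measurable.aestronglyMeasurable (f := fun y : E3 => (2 * Real.pi * ‖x - y‖ ^ 3)⁻¹)
        (by fun_prop)).mul hmf.norm
    · rw [Real.norm_of_nonneg (by positivity), norm_smul]
      rcases eq_or_ne (x - y) 0 with h | h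
      · simp [h]
      have h0 : 0 < ‖x - y‖ := norm_pos_iff.2 h
      calc (2 * Real.pi * ‖x - y‖ ^ 3)⁻¹ * (‖inner ℝ (x - y) w‖ * ‖f y‖)
          ≤ (2 * Real.pi * ‖x - y‖ ^ 3)⁻¹ * ((‖x - y‖ * ‖w‖) * ‖f y‖) := by
            gcongr; exact norm_inner_le_norm _ w
        _ = _ := by field_simp
  -- On the Fourier side, `|ξ|⁻²` is a superposition of Gaussians.
  have h1 := integral_smul_eq_integral_integral
    (k := fun ξ l => Real.pi / l ^ 2 * Real.exp (-(Real.pi * ‖ξ‖ ^ 2) / l))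
    (m := fun ξ => (‖ξ‖ ^ 2)⁻¹)
    (g := fun ξ => Real.fourierChar (inner ℝ ξ x) • inner ℝ ξ w • 𝓕 f ξ)
    (by fun_prop) (fun ξ l _ => by positivity)
    (by
      filter_upwards [hne 0] with ξ hξ
      have h0 : 0 < ‖ξ‖ := norm_pos_iff.2 hξ
      obtain ⟨ha, hb⟩ := integral_inv_sq_mul_exp_neg_div (c := Real.pi * ‖ξ‖ ^ 2) (by positivity)
      have he : ∀ l : ℝ, Real.pi / l ^ 2 * Real.exp (-(Real.pi * ‖ξ‖ ^ 2) / l) = (‖ξ‖ ^ 2)⁻¹ *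
          (Real.pi * ‖ξ‖ ^ 2 / l ^ 2 * Real.exp (-(Real.pi * ‖ξ‖ ^ 2) / l)) := fun l => by
        field_simp
      refine ⟨(Integrable.const_mul ha (‖ξ‖ ^ 2)⁻¹).congr
        (Eventually.of_forall fun l => (he l).symm), ?_⟩
      simp_rw [he]
      rw [integral_const_mul, hb, mul_one])
    hmF' hdF
  -- On the physical side, `|x - y|⁻³` is one, too.
  have h2 := integral_smul_eq_integral_integral
    (k := fun y l => l ^ (1 / 2 : ℝ) * Real.exp (-(Real.pi * ‖x - y‖ ^ 2 * l)))
    (m := fun y => (2 * Real.pi * ‖x - y‖ ^ 3)⁻¹)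
    (g := fun y => inner ℝ (x - y) w • f y)
    (by fun_prop) (fun y l hl => mul_nonneg (Real.rpow_nonneg (le_of_lt hl) _) (Real.exp_pos _).le)
    (by
      filter_upwards [hne x] with y hy
      exact integral_sqrt_mul_exp_neg (norm_pos_iff.2 (sub_ne_zero.2 hy.symm)))
    hmf hdf
  have h3 : ∀ l ∈ Ioi (0 : ℝ),
      (∫ ξ, (Real.pi / l ^ 2 * Real.exp (-(Real.pi * ‖ξ‖ ^ 2) / l)) •
        Real.fourierChar (inner ℝ ξ x) • inner ℝ ξ w • 𝓕 f ξ) =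
      ((Real.pi : ℂ) * Complex.I) • ∫ y, (l ^ (1 / 2 : ℝ) *
        Real.exp (-(Real.pi * ‖x - y‖ ^ 2 * l))) • inner ℝ (x - y) w • f y := by
    intro l hl
    have hl : 0 < l := hl
    have h4 := fourierInv_fourier_gaussMoment_smul hl w x hc hf hb hF
    have hpow : l ^ (-(5 / 2) : ℝ) * l ^ (1 / 2 : ℝ) = (l ^ 2)⁻¹ := by
      rw [← Real.rpow_add hl, ← Real.rpow_natCast, ← Real.rpow_neg hl.le]
      norm_num
    have h5 : (∫ ξ, (Real.pi / l ^ 2 * Real.exp (-(Real.pi * ‖ξ‖ ^ 2) / l)) •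
        Real.fourierChar (inner ℝ ξ x) • inner ℝ ξ w • 𝓕 f ξ) =
        ((Real.pi : ℂ) * Complex.I * ((l ^ (1 / 2 : ℝ) : ℝ) : ℂ)) •
          𝓕⁻ (fun ξ => 𝓕 (gaussMoment l w) ξ • 𝓕 f ξ) x := by
      rw [Real.fourierInv_eq, ← integral_smul]
      refine integral_congr_ae (Eventually.of_forall fun ξ => ?_)
      dsimp only
      rw [fourier_gaussMoment hl, smul_comm _ (Real.fourierChar _), smul_comm _
        (Real.fourierChar _)]
      congr 1
      rw [← Complex.coe_smul, ← Complex.coe_smul, smul_smul, smul_smul]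
      congr 1
      have : Real.pi / l ^ 2 = Real.pi * (l ^ (-(5 / 2) : ℝ) * l ^ (1 / 2 : ℝ)) := by
        rw [hpow]; rfl
      rw [this]
      push_cast
      linear_combination ((Real.pi : ℂ) * ((l ^ (-(5 / 2) : ℝ) : ℝ) : ℂ) *
        ((l ^ (1 / 2 : ℝ) : ℝ) : ℂ) * Complex.exp (-(Real.pi * ‖ξ‖ ^ 2) / l) *
        ((inner ℝ ξ w : ℝ) : ℂ)) * Complex.I_sq
    rw [h5, h4, ← integral_smul, ← integral_smul]
    refine integral_congr_ae (Eventually.of_forall fun y => ?_)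
    dsimp only
    rw [← Complex.coe_smul (_ * _), ← Complex.coe_smul, smul_smul, smul_smul, smul_smul]
    congr 1
    rw [gaussMoment]
    push_cast
    have : -((Real.pi : ℂ) * (l : ℂ)) * (‖x - y‖ : ℂ) ^ 2 =
        -((Real.pi : ℂ) * (‖x - y‖ : ℂ) ^ 2 * (l : ℂ)) := by ring
    rw [this]
    ring
  calc 𝓕⁻ (fun ξ => (inner ℝ ξ w / ‖ξ‖ ^ 2) • 𝓕 f ξ) x
      = ∫ ξ, (‖ξ‖ ^ 2)⁻¹ • Real.fourierChar (inner ℝ ξ x) • inner ℝ ξ w • 𝓕 f ξ := by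
        rw [Real.fourierInv_eq]
        refine integral_congr_ae (Eventually.of_forall fun ξ => ?_)
        dsimp only
        rw [smul_comm _ (Real.fourierChar _), smul_smul, div_eq_inv_mul]
    _ = ∫ l in Ioi 0, ((Real.pi : ℂ) * Complex.I) • ∫ y, (l ^ (1 / 2 : ℝ) *
        Real.exp (-(Real.pi * ‖x - y‖ ^ 2 * l))) • inner ℝ (x - y) w • f y := by
        rw [h1]
        exact setIntegral_congr_fun measurableSet_Ioi h3
    _ = ((Real.pi : ℂ) * Complex.I) •
        ∫ y, (2 * Real.pi * ‖x - y‖ ^ 3)⁻¹ • inner ℝ (x - y) w • f y := by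
        rw [integral_smul, h2]
    _ = _ := by
        rw [← integral_smul, ← integral_smul]
        refine integral_congr_ae (Eventually.of_forall fun y => ?_)
        dsimp only
        rw [← Complex.coe_smul, ← Complex.coe_smul, ← Complex.coe_smul, smul_smul, smul_smul,
          smul_smul]
        congr 1
        push_cast
        have : (Real.pi : ℂ) ≠ 0 := by exact_mod_cast hp.ne'
        rw [mul_inv, mul_inv, div_eq_mul_inv]
        field_simp

/-- The cross product of `ℝ³` as a continuous bilinear map. -/
noncomputable def crossR : E3 →L[ℝ] E3 →L[ℝ] E3 :=
  LinearMap.toContinuousLinearMap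
    ((LinearMap.toContinuousLinearMap : (E3 →ₗ[ℝ] E3) ≃ₗ[ℝ] (E3 →L[ℝ] E3)).toLinearMap ∘ₗ
      LinearMap.mk₂ ℝ (fun a b : E3 => WithLp.toLp 2 (crossProduct a.ofLp b.ofLp))
        (fun a b c => by simp) (fun a b c => by simp) (fun a b c => by simp)
        (fun a b c => by simp))

theorem crossR_apply (a b : E3) :
    crossR a b = WithLp.toLp 2 (crossProduct a.ofLp b.ofLp) := rfl

theorem crossR_anticomm (a b : E3) : crossR a b = -crossR b a := by
  rw [crossR_apply, crossR_apply, ← WithLp.toLp_neg, cross_anticomm]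

theorem crossC_toC3 (a b : E3) : crossC (toC3 a) (toC3 b) = toC3 (crossR a b) := by
  rw [crossC_apply, crossR_apply]
  ext i
  fin_cases i <;> simp [cross_apply]

theorem toC3_eq_sum (v : E3) :
    toC3 v = ∑ j, v j • toC3 (EuclideanSpace.single j (1 : ℝ)) := by
  ext i
  simp [Finset.sum_apply, apply_ite]

theorem integrable_inv_sq_sub_mul {F : Type*} [NormedAddCommGroup F] {f : E3 → F}
    (hc : Continuous f) (hcs : HasCompactSupport f) (x : E3) :
    Integrable fun y => (‖x - y‖ ^ 2)⁻¹ * ‖f y‖ := by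
  obtain ⟨R, hR⟩ := hcs.isCompact.isBounded.subset_ball (0 : E3)
  obtain ⟨M, hM⟩ := hc.bounded_above_of_compact_support hcs
  set φ : E3 → ℝ := (Metric.ball 0 (‖x‖ + R)).indicator fun z => (‖z‖ ^ 2)⁻¹
  have hφ : Integrable φ := (integrable_indicator_iff Metric.isOpen_ball.measurableSet).2
    (integrableOn_norm_inv_sq _)
  refine ((hφ.comp_sub_left x).mul_const M).mono' ?_ (Eventually.of_forall fun y => ?_)
  · exact (Measurable.aestronglyMeasurable (f := fun y : E3 => (‖x - y‖ ^ 2)⁻¹)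
      (by fun_prop)).mul hc.norm.aestronglyMeasurable
  · rw [Real.norm_of_nonneg (by positivity)]
    by_cases hy : f y = 0
    · rw [hy, norm_zero, mul_zero]
      exact mul_nonneg (indicator_nonneg (fun z _ => by positivity) _)
        ((norm_nonneg _).trans (hM 0))
    · have hyR : ‖y‖ < R := by
        simpa using hR (subset_tsupport f hy)
      have hmem : x - y ∈ Metric.ball (0 : E3) (‖x‖ + R) := by
        rw [Metric.mem_ball, dist_zero_right]
        linarith [norm_sub_le x y]
      simp only [φ, indicator_of_mem hmem]
      gcongr
      exact hM y

theorem integrable_biotSavart {f : E3 → E3} (hc : Continuous f) (hcs : HasCompactSupport f)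
    (x : E3) : Integrable fun y => (‖x - y‖ ^ 3)⁻¹ • crossR (x - y) (f y) := by
  have hK' := integrable_inv_sq_sub_mul hc hcs x
  refine (hK'.const_mul ‖crossR‖).mono' (AEStronglyMeasurable.fun_smul
    (Measurable.aestronglyMeasurable (f := fun y : E3 => (‖x - y‖ ^ 3)⁻¹) (by fun_prop))
    (crossR.aestronglyMeasurable_comp₂ (Continuous.aestronglyMeasurable (by fun_prop))
      hc.aestronglyMeasurable)) (Eventually.of_forall fun y => ?_)
  rw [norm_smul, Real.norm_of_nonneg (by positivity)]
  rcases eq_or_ne (x - y) 0 with h | h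
  · simp [h]
  have h0 : 0 < ‖x - y‖ := norm_pos_iff.2 h
  calc (‖x - y‖ ^ 3)⁻¹ * ‖crossR (x - y) (f y)‖
      ≤ (‖x - y‖ ^ 3)⁻¹ * (‖crossR‖ * ‖x - y‖ * ‖f y‖) := by
        gcongr; exact crossR.le_opNorm₂ _ _
    _ = _ := by field_simp

/-- The Biot–Savart law. -/
theorem velocity_eq_integral {s : ℝ} (hs : 3 / 2 < s) {f : E3 → E3} (hf : MemHs s f)
    (hcs : HasCompactSupport f) (x : E3) :
    velocity f x = (4 * Real.pi)⁻¹ • ∫ y, (‖x - y‖ ^ 3)⁻¹ • crossR (f y) (x - y) := by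
  set F := complexify f with hFdef
  have hFc : Continuous F := continuous_complexify hf.1
  have hFs : HasCompactSupport F := by
    refine hcs.comp_left (g := toC3) (map_zero _)
  have hFi : Integrable F := hFc.integrable_of_hasCompactSupport hFs
  have hhat : hat f =ᵐ[volume] 𝓕 F := hat_ae_eq_fourier hFi hf.memLp_complexify
  have hI : Integrable (𝓕 F) := (hf.integrable_hat hs).congr hhat
  have hI' : Integrable fun ξ => ‖ξ‖⁻¹ * ‖𝓕 F ξ‖ :=
    (integrable_norm_inv_mul (hf.integrable_hat hs)
      (MemLp.of_sobolevMeasure (by linarith) hf.memLp_hat)).congr (by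
        filter_upwards [hhat] with ξ h; rw [h])
  obtain ⟨M, hM⟩ := hFc.bounded_above_of_compact_support hFs
  have hB : BddAbove (range fun x => ‖F x‖) := ⟨M, by rintro _ ⟨y, rfl⟩; exact hM y⟩
  have hK := integrable_inv_sq_sub_mul hFc hFs x
  let e : Fin 3 → E3 := fun j => EuclideanSpace.single j (1 : ℝ)
  have hin : ∀ (v : E3) j, inner ℝ v (e j) = v j := fun v j => by
    simp [e, EuclideanSpace.inner_single_right]
  have hbs := fun j => fourierInv_inner_div_smul_fourier hFc hFi hB hI hI' x (e j) hK
  have hint : ∀ j, Integrable fun ξ : E3 => (inner ℝ ξ (e j) / ‖ξ‖ ^ 2) • 𝓕 F ξ := by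
    intro j
    refine hI'.mono' (AEStronglyMeasurable.fun_smul (Measurable.aestronglyMeasurable
      (f := fun ξ : E3 => inner ℝ ξ (e j) / ‖ξ‖ ^ 2) (by fun_prop)) hI.1)
      (Eventually.of_forall fun ξ => ?_)
    rw [norm_smul, norm_div, Real.norm_of_nonneg (show 0 ≤ ‖ξ‖ ^ 2 by positivity)]
    gcongr
    rcases eq_or_ne ξ 0 with rfl | hξ
    · simp
    have h0 : 0 < ‖ξ‖ := norm_pos_iff.2 hξ
    rw [div_le_iff₀ (by positivity)]
    have : ‖e j‖ = 1 := by simp [e]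
    calc ‖inner ℝ ξ (e j)‖ ≤ ‖ξ‖ * ‖e j‖ := norm_inner_le_norm _ _
      _ = _ := by rw [this]; field_simp
  have hintf : ∀ j, Integrable fun y : E3 => (inner ℝ (x - y) (e j) / ‖x - y‖ ^ 3) • F y := by
    intro j
    refine hK.mono' (AEStronglyMeasurable.fun_smul (Measurable.aestronglyMeasurable
      (f := fun y : E3 => inner ℝ (x - y) (e j) / ‖x - y‖ ^ 3) (by fun_prop)) hFi.1)
      (Eventually.of_forall fun y => ?_)
    rw [norm_smul, norm_div, Real.norm_of_nonneg (show 0 ≤ ‖x - y‖ ^ 3 by positivity)]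
    gcongr
    rcases eq_or_ne (x - y) 0 with h | h
    · simp [h]
    have h0 : 0 < ‖x - y‖ := norm_pos_iff.2 h
    rw [div_le_iff₀ (by positivity)]
    have : ‖e j‖ = 1 := by simp [e]
    calc ‖inner ℝ (x - y) (e j)‖ ≤ ‖x - y‖ * ‖e j‖ := norm_inner_le_norm _ _
      _ = _ := by rw [this]; field_simp
  have hchar : ∀ {c : E3 → C3}, Integrable c →
      Integrable fun v => Real.fourierChar (inner ℝ v x) • c v := fun hc => by
    simpa using (Real.fourierIntegral_convergent_iff (-x)).2 hc
  have h1 : 𝓕⁻ (velHat (hat f)) x = ∑ j, (Complex.I / (2 * Real.pi)) •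
      crossC (toC3 (e j)) (𝓕⁻ (fun ξ => (inner ℝ ξ (e j) / ‖ξ‖ ^ 2) • 𝓕 F ξ) x) := by
    have h2 : velHat (hat f) =ᵐ[volume] velHat (𝓕 F) := by
      filter_upwards [hhat] with ξ h
      simp only [velHat, h]
    rw [Real.fourierInv_congr_ae h2, Real.fourierInv_eq]
    simp only [Real.fourierInv_eq]
    have h3 : ∀ j, (Complex.I / (2 * Real.pi)) • crossC (toC3 (e j)) (∫ ξ, Real.fourierChar
        (inner ℝ ξ x) • (inner ℝ ξ (e j) / ‖ξ‖ ^ 2) • 𝓕 F ξ) = ∫ ξ, (Complex.I / (2 * Real.pi)) •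
        crossC (toC3 (e j)) (Real.fourierChar
        (inner ℝ ξ x) • (inner ℝ ξ (e j) / ‖ξ‖ ^ 2) • 𝓕 F ξ) := fun j => by
      rw [← ContinuousLinearMap.integral_comp_comm _ (hchar (hint j)), ← integral_smul]
    simp only [h3]
    have hI3 : ∀ j, Integrable fun ξ => (Complex.I / (2 * Real.pi)) •
        crossC (toC3 (e j)) (Real.fourierChar
        (inner ℝ ξ x) • (inner ℝ ξ (e j) / ‖ξ‖ ^ 2) • 𝓕 F ξ) := fun j =>
      ((crossC (toC3 (e j))).integrable_comp (hchar (hint j))).smul (Complex.I / (2 * Real.pi))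
    rw [← integral_finsetSum _ fun j _ => hI3 j]
    refine integral_congr_ae (Eventually.of_forall fun ξ => ?_)
    dsimp only
    rw [velHat, toC3_eq_sum ξ]
    simp only [map_sum, sum_apply, Finset.smul_sum, hin]
    refine Finset.sum_congr rfl fun j _ => ?_
    rw [Circle.smul_def, Circle.smul_def, ← Complex.coe_smul, ← Complex.coe_smul,
      map_smul crossC]
    simp only [map_smul (crossC (toC3 (e j))), smul_smul, smul_apply]
    congr 1
    have hp : (Real.pi : ℂ) ≠ 0 := by exact_mod_cast Real.pi_ne_zero
    push_cast
    rcases eq_or_ne ξ 0 with rfl | hξ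
    · simp
    have h0 : (‖ξ‖ : ℂ) ≠ 0 := by exact_mod_cast (norm_pos_iff.2 hξ).ne'
    field_simp
    ring
  have h4 : 𝓕⁻ (velHat (hat f)) x =
      -((4 * Real.pi)⁻¹ : ℝ) • ∫ y, (‖x - y‖ ^ 3)⁻¹ • toC3 (crossR (x - y) (f y)) := by
    rw [h1]
    simp only [hbs]
    have h3 : ∀ j, (Complex.I / (2 * Real.pi)) • crossC (toC3 (e j)) ((Complex.I / 2) •
        ∫ y, (inner ℝ (x - y) (e j) / ‖x - y‖ ^ 3) • F y) =
        ∫ y, (-((4 * Real.pi)⁻¹ : ℝ)) • crossC (toC3 (e j))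
          ((inner ℝ (x - y) (e j) / ‖x - y‖ ^ 3) • F y) := fun j => by
      rw [integral_smul, ContinuousLinearMap.integral_comp_comm _ (hintf j), map_smul, smul_smul,
        ← Complex.coe_smul]
      congr 1
      have hp : (Real.pi : ℂ) ≠ 0 := by exact_mod_cast Real.pi_ne_zero
      push_cast
      field_simp
      rw [Complex.I_sq]
      norm_num
    simp only [h3]
    rw [← integral_finsetSum _ fun j _ => ?_, ← integral_smul]
    · refine integral_congr_ae (Eventually.of_forall fun y => ?_)
      dsimp only
      rw [← crossC_toC3, toC3_eq_sum (x - y), ← Finset.smul_sum]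
      congr 1
      simp only [map_sum, sum_apply, Finset.smul_sum, hin]
      refine Finset.sum_congr rfl fun j _ => ?_
      rw [← Complex.coe_smul, ← Complex.coe_smul, ← Complex.coe_smul, map_smul, map_smul]
      simp only [smul_apply, smul_smul]
      congr 1
      push_cast
      rw [div_eq_inv_mul]
    · exact ((crossC (toC3 (e j))).integrable_comp (hintf j)).smul (-((4 * Real.pi)⁻¹ : ℝ))
  have hfi := integrable_biotSavart hf.1 hcs x
  rw [velocity_eq]
  dsimp only
  rw [h4]
  have h5 : ∀ y, (‖x - y‖ ^ 3)⁻¹ • toC3 (crossR (x - y) (f y)) =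
      toC3 ((‖x - y‖ ^ 3)⁻¹ • crossR (x - y) (f y)) := fun y => (map_smul _ _ _).symm
  simp only [h5]
  rw [ContinuousLinearMap.integral_comp_comm _ hfi, map_smul]
  have h6 : ∀ v : E3, reC3 (toC3 v) = v := fun v => by ext i; simp
  rw [h6, neg_smul, ← smul_neg, ← integral_neg]
  congr 2
  ext1 y
  rw [← smul_neg, ← crossR_anticomm]

/-! ### Symmetries: axisymmetric swirl-free vorticities that are odd in `z` -/

/-- The isometries of `ℝ³` that preserve the axis and the plane `z = 0`:
the orthogonal map `(a, b)` (with `a² + b² = 1`) of the horizontal plane, composed with a reflection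
if `ε = -1`, together with the reflection `z ↦ -z` if `δ = -1`. -/
noncomputable def axialMap {a b ε δ : ℝ} (h : a ^ 2 + b ^ 2 = 1) (hε : ε ^ 2 = 1)
    (hδ : δ ^ 2 = 1) : E3 ≃ₗᵢ[ℝ] E3 where
  toFun x := !₂[a * x 0 - ε * b * x 1, b * x 0 + ε * a * x 1, δ * x 2]
  invFun x := !₂[a * x 0 + b * x 1, ε * (-b * x 0 + a * x 1), δ * x 2]
  map_add' x y := by ext i; fin_cases i <;> simp <;> ring
  map_smul' c x := by ext i; fin_cases i <;> simp <;> ring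
  left_inv x := by
    ext i
    fin_cases i <;> simp
    · linear_combination x 0 * h
    · linear_combination x 1 * ε ^ 2 * h + x 1 * hε
    · linear_combination x 2 * hδ
  right_inv x := by
    ext i
    fin_cases i <;> simp
    · linear_combination x 0 * h + (b ^ 2 * x 0 - b * a * x 1) * hε
    · linear_combination x 1 * h + (a ^ 2 * x 1 - a * b * x 0) * hε
    · linear_combination x 2 * hδ
  norm_map' x := by
    simp only [EuclideanSpace.norm_eq, Fin.sum_univ_three, LinearEquiv.coe_mk, LinearMap.coe_mk,
      AddHom.coe_mk, Real.norm_eq_abs, sq_abs]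
    congr 1
    simp
    linear_combination (x 0 ^ 2 + ε ^ 2 * x 1 ^ 2) * h + x 1 ^ 2 * hε + x 2 ^ 2 * hδ

section

variable {a b ε δ : ℝ} (h : a ^ 2 + b ^ 2 = 1) (hε : ε ^ 2 = 1) (hδ : δ ^ 2 = 1)

theorem axialMap_apply (x : E3) : axialMap h hε hδ x =
    !₂[a * x 0 - ε * b * x 1, b * x 0 + ε * a * x 1, δ * x 2] := rfl

theorem radius_axialMap (x : E3) : radius (axialMap h hε hδ x) = radius x := by
  simp only [radius, axialMap_apply]
  congr 1
  simp
  linear_combination (x 0 ^ 2 + ε ^ 2 * x 1 ^ 2) * h + x 1 ^ 2 * hε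

theorem eTheta_axialMap (x : E3) :
    eTheta (axialMap h hε hδ x) = ε • axialMap h hε hδ (eTheta x) := by
  have hr := radius_axialMap h hε hδ x
  ext i
  rw [eTheta, hr]
  fin_cases i <;> simp [axialMap_apply, eTheta]
  · linear_combination (b * x 0 / radius x) * hε
  · linear_combination (-a * x 0 / radius x) * hε

theorem crossR_axialMap (u v : E3) : crossR (axialMap h hε hδ u) (axialMap h hε hδ v) =
    (ε * δ) • axialMap h hε hδ (crossR u v) := by
  ext i
  fin_cases i <;> simp [axialMap_apply, crossR_apply, cross_apply]
  · linear_combination b * δ * (u 2 * v 0 - u 0 * v 2) * hε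
  · linear_combination a * δ * (u 0 * v 2 - u 2 * v 0) * hε
  · linear_combination ε * (u 0 * v 1 - u 1 * v 0) * (h - hδ)

end

/-- The symmetry of the vorticity of an axisymmetric, swirl-free flow that is also odd in `z`:
equivariance, up to the determinant (vorticity is a pseudovector), under all the
isometries that preserve the axis and the plane `z = 0`. -/
def IsAxial (f : E3 → E3) : Prop :=
  ∀ ⦃a b ε δ : ℝ⦄ (h : a ^ 2 + b ^ 2 = 1) (hε : ε ^ 2 = 1) (hδ : δ ^ 2 = 1) (x : E3),
    f (axialMap h hε hδ x) = (ε * δ) • axialMap h hε hδ (f x)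

theorem radius_nonneg (x : E3) : 0 ≤ radius x := Real.sqrt_nonneg _

theorem radius_sq (x : E3) : radius x ^ 2 = x 0 ^ 2 + x 1 ^ 2 := Real.sq_sqrt (by positivity)

theorem norm_sq_eq (x : E3) : ‖x‖ ^ 2 = radius x ^ 2 + x 2 ^ 2 := by
  rw [radius_sq, EuclideanSpace.norm_sq_eq, Fin.sum_univ_three]
  simp

/-- Swirl fields `ω_θ e_θ` with `ω_θ` odd in `z` have the symmetry `IsAxial`. -/
theorem isAxial_of_eq {f : E3 → E3}
    (hf : ∀ x, f x = omegaTheta f (radius x) (x 2) • eTheta x)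
    (hodd : ∀ r z : ℝ, 0 ≤ r → omegaTheta f r (-z) = -omegaTheta f r z) : IsAxial f := by
  intro a b ε δ h hε hδ x
  have hz : omegaTheta f (radius x) (δ * x 2) = δ * omegaTheta f (radius x) (x 2) := by
    rcases eq_or_eq_neg_of_sq_eq_sq δ 1 (by rw [hδ, one_pow]) with rfl | rfl
    · simp
    · simpa using hodd _ (x 2) (radius_nonneg x)
  rw [hf (axialMap h hε hδ x), hf x, radius_axialMap, eTheta_axialMap, map_smul, smul_smul,
    smul_smul]
  have : (axialMap h hε hδ x) 2 = δ * x 2 := by simp [axialMap_apply]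
  rw [this, hz]
  congr 1
  ring

theorem radius_meridian {r : ℝ} (hr : 0 ≤ r) (z : ℝ) : radius !₂[r, 0, z] = r := by
  simp [radius, Real.sqrt_sq hr]

/-- A field with the symmetry `IsAxial` is a swirl field: the reflection in the plane `x 1 = 0`
leaves only the component along `e_θ` on this plane, and the rotations determine the field elsewhere. -/
theorem IsAxial.eq_omegaTheta {f : E3 → E3} (hf : IsAxial f) (x : E3) :
    f x = omegaTheta f (radius x) (x 2) • eTheta x := by
  -- the reflection `x 1 ↦ -x 1` fixes the plane `x 1 = 0`, and a pseudovector on this plane is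
  -- normal to it
  have key : ∀ p : E3, p 1 = 0 → f p 0 = 0 ∧ f p 2 = 0 := by
    intro p hp
    have h := hf (a := 1) (b := 0) (ε := -1) (δ := 1) (by norm_num) (by norm_num) (by norm_num) p
    rw [show axialMap (a := 1) (b := 0) (ε := -1) (δ := 1) (by norm_num) (by norm_num)
      (by norm_num) p = p by ext i; fin_cases i <;> simp [axialMap_apply, hp]] at h
    have h0 := congrArg (fun v : E3 => v 0) h
    have h2 := congrArg (fun v : E3 => v 2) h
    simp [axialMap_apply] at h0 h2
    constructor <;> linarith
  rcases eq_or_ne (radius x) 0 with hr | hr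
  · have h01 : x 0 ^ 2 + x 1 ^ 2 = 0 := by rw [← radius_sq, hr]; norm_num
    have hx0 : x 0 = 0 := by nlinarith [sq_nonneg (x 0), sq_nonneg (x 1)]
    have hx1 : x 1 = 0 := by nlinarith [sq_nonneg (x 0), sq_nonneg (x 1)]
    -- rotation by `π`, which fixes the points of the axis
    have h := hf (a := -1) (b := 0) (ε := 1) (δ := 1) (by norm_num) (by norm_num) (by norm_num) x
    rw [show axialMap (a := -1) (b := 0) (ε := 1) (δ := 1) (by norm_num) (by norm_num)
      (by norm_num) x = x by ext i; fin_cases i <;> simp [axialMap_apply, hx0, hx1]] at h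
    have h1 := congrArg (fun v : E3 => v 1) h
    simp [axialMap_apply] at h1
    obtain ⟨k0, k2⟩ := key x hx1
    ext i
    fin_cases i <;> simp [eTheta, hr, k0, k2]
    linarith
  · have hab : (x 0 / radius x) ^ 2 + (x 1 / radius x) ^ 2 = 1 := by
      rw [div_pow, div_pow, ← add_div, ← radius_sq, div_self (pow_ne_zero 2 hr)]
    set p : E3 := !₂[radius x, 0, x 2] with hp
    obtain ⟨k0, k2⟩ := key p (by simp [hp])
    have h := hf hab (ε := 1) (δ := 1) (by norm_num) (by norm_num) p
    rw [show axialMap hab (ε := 1) (δ := 1) (by norm_num) (by norm_num) p = x by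
      ext i; fin_cases i <;> simp [axialMap_apply, hp] <;> field_simp] at h
    rw [h]
    ext i
    fin_cases i <;> simp [axialMap_apply, eTheta, k0, k2, omegaTheta, ← hp] <;> ring

theorem IsAxial.omegaTheta_neg {f : E3 → E3} (hf : IsAxial f) (r z : ℝ) :
    omegaTheta f r (-z) = -omegaTheta f r z := by
  have h := hf (a := 1) (b := 0) (ε := 1) (δ := -1) (by norm_num) (by norm_num) (by norm_num)
    !₂[r, 0, z]
  rw [show axialMap (a := 1) (b := 0) (ε := 1) (δ := -1) (by norm_num) (by norm_num)
      (by norm_num) !₂[r, 0, z] = !₂[r, 0, -z] by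
        ext i; fin_cases i <;> simp [axialMap_apply]] at h
  have h1 := congrArg (fun v : E3 => v 1) h
  simpa [axialMap_apply, omegaTheta] using h1

theorem norm_eTheta_le (x : E3) : ‖eTheta x‖ ≤ 1 := by
  rw [EuclideanSpace.norm_eq, Fin.sum_univ_three]
  refine Real.sqrt_le_one.2 ?_
  simp only [eTheta, Real.norm_eq_abs, sq_abs]
  simp only [Matrix.cons_val_zero, Matrix.cons_val_one, Matrix.cons_val]
  rcases eq_or_ne (radius x) 0 with hr | hr
  · simp [hr]
  · rw [div_pow, div_pow, neg_sq, add_comm (x 1 ^ 2 / _), ← add_div, ← radius_sq,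
      div_self (pow_ne_zero 2 hr)]
    norm_num

theorem IsAxial.norm_meridian {f : E3 → E3} (hf : IsAxial f) {r : ℝ} (hr : 0 ≤ r) (z : ℝ) :
    ‖f !₂[r, 0, z]‖ = |omegaTheta f r z| := by
  apply le_antisymm
  · rw [hf.eq_omegaTheta, radius_meridian hr, norm_smul, Real.norm_eq_abs]
    simpa using mul_le_of_le_one_right (abs_nonneg _) (norm_eTheta_le _)
  · exact (Real.norm_eq_abs _) ▸ PiLp.norm_apply_le (f !₂[r, 0, z]) 1

/-- A swirl field is compactly supported if its profile `ω_θ` vanishes off a compact set. -/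
theorem hasCompactSupport_of_omegaTheta {f : E3 → E3}
    (hf : ∀ x, f x = omegaTheta f (radius x) (x 2) • eTheta x) {K : Set (ℝ × ℝ)} (hK : IsCompact K)
    (hfK : ∀ r z : ℝ, 0 ≤ r → (r, z) ∉ K → omegaTheta f r z = 0) : HasCompactSupport f := by
  obtain ⟨R, hR⟩ := hK.isBounded.exists_norm_le
  refine HasCompactSupport.intro (isCompact_closedBall (0 : E3) (2 * R)) fun x hx => ?_
  rw [hf x, hfK _ _ (radius_nonneg x), zero_smul]
  intro hmem
  have h := hR _ hmem
  rw [Prod.norm_def, max_le_iff, Real.norm_eq_abs, Real.norm_eq_abs] at h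
  apply hx
  rw [mem_closedBall_zero_iff]
  have hR0 : 0 ≤ R := (abs_nonneg _).trans h.1
  have h1 := sq_le_sq' (by linarith [abs_nonneg (radius x)]) h.1
  have h2 := sq_le_sq' (by linarith [abs_nonneg (x 2)]) h.2
  rw [sq_abs] at h1 h2
  have := norm_sq_eq x
  exact abs_le_of_sq_le_sq' (by nlinarith) (by linarith) |>.2

/-- The velocity is a true vector field: the sign `ε δ` of the pseudovector `f` cancels the one of
the cross product in the Biot–Savart law. -/
theorem IsAxial.velocity_axialMap {s : ℝ} (hs : 3 / 2 < s) {f : E3 → E3} (hf : MemHs s f)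
    (hcs : HasCompactSupport f) (hax : IsAxial f) {a b ε δ : ℝ} (h : a ^ 2 + b ^ 2 = 1)
    (hε : ε ^ 2 = 1) (hδ : δ ^ 2 = 1) (x : E3) :
    velocity f (axialMap h hε hδ x) = axialMap h hε hδ (velocity f x) := by
  set L := axialMap h hε hδ with hL
  rw [velocity_eq_integral hs hf hcs, velocity_eq_integral hs hf hcs, map_smul,
    ← L.measurePreserving.integral_comp' (f := L.toMeasurableEquiv)]
  congr 1
  refine Eq.trans ?_ (L.toContinuousLinearEquiv.integral_comp_comm _)
  refine integral_congr_ae (Eventually.of_forall fun y => ?_)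
  dsimp only
  have hy : L.toMeasurableEquiv y = L y := rfl
  rw [hy, ← map_sub, LinearIsometryEquiv.norm_map, hax, map_smul, smul_apply, crossR_axialMap,
    smul_smul (ε * δ), show (ε * δ) * (ε * δ) = 1 by linear_combination δ ^ 2 * hε + hδ, one_smul,
    map_smul]
  rfl

theorem IsAxial.stretching {s : ℝ} (hs : 3 / 2 < s) {f : E3 → E3} (hf : MemHs s f)
    (hcs : HasCompactSupport f) (hax : IsAxial f) : IsAxial (stretching f) := by
  intro a b ε δ h hε hδ x
  set L := axialMap h hε hδ with hL
  have hd : ∀ x, DifferentiableAt ℝ (velocity f) x := fun x =>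
    (hasFDerivAt_velocity hs hf x).differentiableAt
  have hcomp : velocity f ∘ L = L ∘ velocity f :=
    funext fun x => hax.velocity_axialMap hs hf hcs h hε hδ x
  have h1 : fderiv ℝ (velocity f ∘ L) x =
      (fderiv ℝ (velocity f) (L x)).comp (L : E3 →L[ℝ] E3) := by
    rw [fderiv_comp _ (hd _) L.differentiableAt, L.fderiv]
  have h2 : fderiv ℝ (L ∘ velocity f) x = (L : E3 →L[ℝ] E3).comp (fderiv ℝ (velocity f) x) := by
    rw [fderiv_comp _ L.differentiableAt (hd _), L.fderiv]
  rw [hcomp, h2] at h1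
  have h3 := congrArg (fun A : E3 →L[ℝ] E3 => A (f x)) h1
  simp only [ContinuousLinearMap.comp_apply] at h3
  simp only [VortexStretching.stretching]
  rw [hax, map_smul]
  congr 1
  exact h3.symm

/-- Axisymmetric swirl-free vorticity fields are divergence free: the reflection in the plane
spanned by the axis and `ξ` fixes `ξ`, and maps `f` to `-f`. -/
theorem IsAxial.memHsDf {s : ℝ} {f : E3 → E3} (hf : MemHs s f)
    (hcs : HasCompactSupport f) (hax : IsAxial f) : MemHsDf s f := by
  refine ⟨hf, ?_⟩
  have hFc : Continuous (complexify f) := continuous_complexify hf.1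
  have hFs : HasCompactSupport (complexify f) := hcs.comp_left (g := toC3) (map_zero _)
  have hFi : Integrable (complexify f) := hFc.integrable_of_hasCompactSupport hFs
  filter_upwards [hat_ae_eq_fourier hFi hf.memLp_complexify] with ξ hξ
  rw [hξ]
  have hi : Integrable fun x : E3 => Real.fourierChar (-inner ℝ x ξ) • complexify f x :=
    (Real.fourierIntegral_convergent_iff ξ).2 hFi
  have hsum : ∑ i, toComplex ξ i * 𝓕 (complexify f) ξ i =
      ∫ x : E3, Real.fourierChar (-inner ℝ x ξ) • ((inner ℝ ξ (f x) : ℝ) : ℂ) := by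
    have hlin : ∀ v : C3, (∑ i, toComplex ξ i • EuclideanSpace.proj (𝕜 := ℂ) i : C3 →L[ℂ] ℂ) v =
        ∑ i, toComplex ξ i * v i := fun v => by simp [sum_apply]
    rw [← hlin, Real.fourier_eq, ← ContinuousLinearMap.integral_comp_comm _ hi]
    refine integral_congr_ae (Eventually.of_forall fun x => ?_)
    dsimp only
    rw [Circle.smul_def, map_smul, hlin, Circle.smul_def]
    congr 1
    simp [complexify, toComplex, PiLp.inner_apply, mul_comm]
  rw [hsum]
  -- `(a, b) = (cos 2θ, sin 2θ)`, with `θ` the polar angle of `ξ`; on the axis any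
  -- reflection will do
  obtain ⟨a, b, hab, hfix⟩ : ∃ a b : ℝ, ∃ h : a ^ 2 + b ^ 2 = 1,
      axialMap h (ε := -1) (δ := 1) (by norm_num) (by norm_num) ξ = ξ := by
    rcases eq_or_ne (radius ξ) 0 with hr | hr
    · have h01 : ξ 0 ^ 2 + ξ 1 ^ 2 = 0 := by rw [← radius_sq, hr]; norm_num
      have hx0 : ξ 0 = 0 := by nlinarith [sq_nonneg (ξ 0), sq_nonneg (ξ 1)]
      have hx1 : ξ 1 = 0 := by nlinarith [sq_nonneg (ξ 0), sq_nonneg (ξ 1)]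
      refine ⟨1, 0, by norm_num, ?_⟩
      ext i; fin_cases i <;> simp [axialMap_apply, hx0, hx1]
    · have h2 := radius_sq ξ
      refine ⟨(ξ 0 ^ 2 - ξ 1 ^ 2) / radius ξ ^ 2, 2 * ξ 0 * ξ 1 / radius ξ ^ 2, ?_, ?_⟩
      · rw [div_pow, div_pow, ← add_div, div_eq_one_iff_eq (by positivity), h2]
        ring
      · ext i
        fin_cases i <;> simp [axialMap_apply] <;> field_simp <;> rw [h2] <;> ring
  set L := axialMap hab (ε := -1) (δ := 1) (by norm_num) (by norm_num) with hL
  have hneg : ∫ x : E3, Real.fourierChar (-inner ℝ x ξ) • ((inner ℝ ξ (f x) : ℝ) : ℂ) =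
      -∫ x : E3, Real.fourierChar (-inner ℝ x ξ) • ((inner ℝ ξ (f x) : ℝ) : ℂ) := by
    conv_lhs => rw [← L.measurePreserving.integral_comp' (f := L.toMeasurableEquiv)]
    rw [← integral_neg]
    refine integral_congr_ae (Eventually.of_forall fun x => ?_)
    dsimp only
    have hy : L.toMeasurableEquiv x = L x := rfl
    have h1 : inner ℝ (L x) ξ = inner ℝ x ξ := by
      conv_lhs => rw [← hfix]
      exact L.inner_map_map x ξ
    have h2 : inner ℝ ξ (f (L x)) = -inner ℝ ξ (f x) := by
      rw [hax, inner_smul_right]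
      conv_lhs => rw [← hfix]
      rw [← hL, L.inner_map_map]
      ring
    rw [hy, h1, h2, Complex.ofReal_neg, smul_neg]
  exact self_eq_neg.1 hneg

/-! ### Maximal solutions of autonomous equations with a locally Lipschitz right-hand side -/

section ODE

variable {E : Type*} [NormedAddCommGroup E] [NormedSpace ℝ E] {N : E → E}

/-- `γ` solves `γ' = N γ` on `[0, T)`, with `γ 0 = x₀` (one-sided derivative at `0`). -/
def IsFlowLine (N : E → E) (x₀ : E) (T : ℝ) (γ : ℝ → E) : Prop :=
  γ 0 = x₀ ∧ ∀ t ∈ Ico 0 T, HasDerivWithinAt γ (N (γ t)) (Ici 0) t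

theorem IsFlowLine.mono {x₀ : E} {T T' : ℝ} {γ : ℝ → E} (hγ : IsFlowLine N x₀ T γ) (h : T' ≤ T) :
    IsFlowLine N x₀ T' γ :=
  ⟨hγ.1, fun t ht => hγ.2 t ⟨ht.1, ht.2.trans_le h⟩⟩

theorem IsFlowLine.congr {x₀ : E} {T : ℝ} {γ δ : ℝ → E} (hγ : IsFlowLine N x₀ T γ) (hT : 0 < T)
    (h : EqOn δ γ (Ico 0 T)) : IsFlowLine N x₀ T δ := by
  refine ⟨(h ⟨le_rfl, hT⟩).trans hγ.1, fun t ht => ?_⟩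
  have hev : δ =ᶠ[𝓝[Ici 0] t] γ := by
    filter_upwards [self_mem_nhdsWithin, mem_nhdsWithin_of_mem_nhds (Iio_mem_nhds ht.2)] with u h1 h2
    exact h ⟨h1, h2⟩
  rw [h ht]
  exact (hγ.2 t ht).congr_of_eventuallyEq hev (h ht)

theorem IsFlowLine.continuousOn {x₀ : E} {T : ℝ} {γ : ℝ → E} (hγ : IsFlowLine N x₀ T γ) :
    ContinuousOn γ (Ico 0 T) := fun t ht =>
  (hγ.2 t ht).continuousWithinAt.mono fun _ h => h.1

theorem IsFlowLine.eqOn (hN : ∀ R, ∃ K, LipschitzOnWith K N (Metric.closedBall 0 R)) {x₀ : E}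
    {T : ℝ} {γ δ : ℝ → E} (hγ : IsFlowLine N x₀ T γ) (hδ : IsFlowLine N x₀ T δ) :
    EqOn γ δ (Ico 0 T) := by
  intro t ht
  have hsub : Icc 0 t ⊆ Ico 0 T := fun u hu => ⟨hu.1, hu.2.trans_lt ht.2⟩
  obtain ⟨R₁, hR₁⟩ := isCompact_Icc.exists_bound_of_continuousOn (hγ.continuousOn.mono hsub)
  obtain ⟨R₂, hR₂⟩ := isCompact_Icc.exists_bound_of_continuousOn (hδ.continuousOn.mono hsub)
  obtain ⟨K, hK⟩ := hN (max R₁ R₂)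
  refine ODE_solution_unique_of_mem_Icc_right (v := fun _ => N)
    (s := fun _ => Metric.closedBall 0 (max R₁ R₂)) (fun _ _ => hK)
    (hγ.continuousOn.mono hsub) (fun u hu => ?_) (fun u hu => ?_)
    (hδ.continuousOn.mono hsub) (fun u hu => ?_) (fun u hu => ?_) (hγ.1.trans hδ.1.symm)
    (right_mem_Icc.2 ht.1)
  · exact (hγ.2 u (hsub (Ico_subset_Icc_self hu))).mono (Ici_subset_Ici.2 hu.1)
  · exact mem_closedBall_zero_iff.2 ((hR₁ u (Ico_subset_Icc_self hu)).trans (le_max_left _ _))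
  · exact (hδ.2 u (hsub (Ico_subset_Icc_self hu))).mono (Ici_subset_Ici.2 hu.1)
  · exact mem_closedBall_zero_iff.2 ((hR₂ u (Ico_subset_Icc_self hu)).trans (le_max_right _ _))

/-- The time of existence is bounded from below on bounded sets of initial data. -/
theorem exists_local_flowLine [CompleteSpace E]
    (hN : ∀ R, ∃ K, LipschitzOnWith K N (Metric.closedBall 0 R)) {R : ℝ} (hR : 0 ≤ R) :
    ∃ τ > 0, ∀ x₀ : E, ‖x₀‖ ≤ R → ∀ t₀ : ℝ, ∃ α : ℝ → E, α t₀ = x₀ ∧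
      ∀ t ∈ Icc t₀ (t₀ + τ), HasDerivWithinAt α (N (α t)) (Icc t₀ (t₀ + τ)) t := by
  obtain ⟨K, hK⟩ := hN (R + 1)
  set L : NNReal := ⟨‖N 0‖ + K * (R + 1), by positivity⟩ with hL
  -- `L` bounds the speed in the unit ball about `x₀`, so that the ball is not left before
  -- time `1 / L`
  refine ⟨1 / (L + 1), by positivity, fun x₀ hx₀ t₀ => ?_⟩
  have hsub : Metric.closedBall x₀ ((1 : NNReal) : ℝ) ⊆ Metric.closedBall 0 (R + 1) := by
    refine Metric.closedBall_subset_closedBall' ?_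
    rw [dist_zero_right]
    push_cast
    linarith
  have hle : t₀ ≤ t₀ + 1 / ((L : ℝ) + 1) := by
    have : 0 ≤ 1 / ((L : ℝ) + 1) := by positivity
    linarith
  have hP : IsPicardLindelof (fun _ => N) (⟨t₀, left_mem_Icc.2 hle⟩ : Icc t₀ (t₀ + 1 / ((L : ℝ) + 1)))
      x₀ 1 0 L K := by
    refine IsPicardLindelof.of_time_independent (fun x hx => ?_) (hK.mono hsub) ?_
    · have h0 : (0 : E) ∈ Metric.closedBall (0 : E) (R + 1) := by
        simp; linarith
      have h1 := hK.dist_le_mul x (hsub hx) 0 h0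
      have h2 : dist x 0 ≤ R + 1 := hsub hx
      have h3 : ‖N x‖ ≤ ‖N x - N 0‖ + ‖N 0‖ := by
        simpa using norm_add_le (N x - N 0) (N 0)
      rw [← dist_eq_norm] at h3
      change ‖N x‖ ≤ ‖N 0‖ + K * (R + 1)
      nlinarith [K.coe_nonneg]
    · simp only [add_sub_cancel_left, sub_self, NNReal.coe_one, NNReal.coe_zero, sub_zero]
      rw [max_eq_left (by positivity), mul_one_div, div_le_one (by positivity)]
      linarith
  obtain ⟨α, h1, h2⟩ := hP.exists_eq_forall_mem_Icc_hasDerivWithinAt₀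
  exact ⟨α, h1, h2⟩

/-- Continuation of a solution beyond `t₀`. -/
theorem IsFlowLine.extend {x₀ : E} {T t₀ τ : ℝ} {γ α : ℝ → E} (hγ : IsFlowLine N x₀ T γ)
    (ht₀ : t₀ ∈ Ico 0 T) (h0 : α t₀ = γ t₀)
    (hα : ∀ t ∈ Icc t₀ (t₀ + τ), HasDerivWithinAt α (N (α t)) (Icc t₀ (t₀ + τ)) t) :
    IsFlowLine N x₀ (t₀ + τ) (fun t => if t ≤ t₀ then γ t else α t) := by
  set β : ℝ → E := fun t => if t ≤ t₀ then γ t else α t with hβ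
  have hβγ : EqOn β γ (Iic t₀) := fun t ht => if_pos ht
  have hβα : EqOn β α (Ici t₀) := fun t ht => by
    rcases (show t₀ ≤ t from ht).eq_or_lt with rfl | h
    · rw [h0]; exact if_pos le_rfl
    · exact if_neg (not_le.2 h)
  refine ⟨(hβγ ht₀.1).trans hγ.1, fun t ht => ?_⟩
  have hright : t₀ ≤ t → HasDerivWithinAt β (N (β t)) (Ici t₀) t := fun h => by
    have h1 := hα t ⟨h, ht.2.le⟩
    have h2 : HasDerivWithinAt α (N (α t)) (Ici t₀) t :=
      h1.mono_of_mem_nhdsWithin (by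
        filter_upwards [self_mem_nhdsWithin, mem_nhdsWithin_of_mem_nhds (Iic_mem_nhds ht.2)]
          with u h1 h2
        exact ⟨h1, h2⟩)
    rw [hβα h]
    exact h2.congr hβα (hβα h)
  have hleft : t ≤ t₀ → HasDerivWithinAt β (N (β t)) (Icc 0 t₀) t := fun h => by
    rw [hβγ h]
    exact ((hγ.2 t ⟨ht.1, h.trans_lt ht₀.2⟩).mono Icc_subset_Ici_self).congr
      (fun u hu => hβγ hu.2) (hβγ h)
  rcases lt_trichotomy t t₀ with h | h | h
  · refine (hleft h.le).mono_of_mem_nhdsWithin ?_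
    filter_upwards [self_mem_nhdsWithin, mem_nhdsWithin_of_mem_nhds (Iic_mem_nhds h)] with u h1 h2
    exact ⟨h1, h2⟩
  · have h1 := (hleft h.le).union (hright h.ge)
    exact h1.mono fun u hu => by
      rcases le_total u t₀ with h | h
      · exact Or.inl ⟨hu, h⟩
      · exact Or.inr h
  · refine (hright h.le).mono_of_mem_nhdsWithin ?_
    exact mem_nhdsWithin_of_mem_nhds (mem_of_superset (Ioi_mem_nhds h) Ioi_subset_Ici_self)

/-- If the lifespans of all solutions are bounded, then there is a
solution on a maximal interval, and its norm tends to infinity at the end of the interval. -/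
theorem exists_maximal_flowLine [CompleteSpace E]
    (hN : ∀ R, ∃ K, LipschitzOnWith K N (Metric.closedBall 0 R)) (x₀ : E) {M : ℝ}
    (hM : ∀ T γ, IsFlowLine N x₀ T γ → T ≤ M) :
    ∃ T γ, 0 < T ∧ IsFlowLine N x₀ T γ ∧ Tendsto (fun t => ‖γ t‖) (𝓝[<] T) atTop := by
  set S : Set ℝ := {T | 0 < T ∧ ∃ γ, IsFlowLine N x₀ T γ} with hS
  have hbdd : BddAbove S := ⟨M, fun T ⟨_, γ, hγ⟩ => hM T γ hγ⟩
  obtain ⟨τ₀, hτ₀, hloc₀⟩ := exists_local_flowLine hN (norm_nonneg x₀)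
  have hne : S.Nonempty := by
    obtain ⟨α, h0, hα⟩ := hloc₀ x₀ le_rfl 0
    refine ⟨τ₀, hτ₀, α, h0, fun t ht => ?_⟩
    rw [zero_add] at hα
    refine (hα t ⟨ht.1, ht.2.le⟩).mono_of_mem_nhdsWithin ?_
    filter_upwards [self_mem_nhdsWithin, mem_nhdsWithin_of_mem_nhds (Iic_mem_nhds ht.2)]
      with u h1 h2
    exact ⟨h1, h2⟩
  set T := sSup S with hT
  have hlt : ∀ t, t < T → ∃ T' ∈ S, t < T' := fun t ht => exists_lt_of_lt_csSup hne ht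
  have hpos : 0 < T := by
    obtain ⟨T₁, h1⟩ := hne
    exact h1.1.trans_le (le_csSup hbdd h1)
  have hex : ∀ t : ℝ, ∃ T' γ, t < T → (t < T' ∧ IsFlowLine N x₀ T' γ) := fun t => by
    by_cases ht : t < T
    · obtain ⟨T', ⟨_, γ, hγ⟩, h⟩ := hlt t ht
      exact ⟨T', γ, fun _ => ⟨h, hγ⟩⟩
    · exact ⟨0, 0, fun h => absurd h ht⟩
  choose T' γ' hγ' using hex
  -- solutions agree on common intervals, so that the local choices patch together
  have hagree : ∀ T'' γ, IsFlowLine N x₀ T'' γ → T'' ≤ T → EqOn (fun t => γ' t t) γ (Ico 0 T'') := by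
    intro T'' γ hγ hle t ht
    obtain ⟨h1, h2⟩ := hγ' t (ht.2.trans_le hle)
    exact (h2.mono (min_le_left _ T'')).eqOn hN (hγ.mono (min_le_right (T' t) _))
      ⟨ht.1, lt_min h1 ht.2⟩
  have hflow : IsFlowLine N x₀ T (fun t => γ' t t) := by
    have hloc : ∀ T'' ∈ S, IsFlowLine N x₀ T'' (fun t => γ' t t) := fun T'' h => by
      obtain ⟨γ, hγ⟩ := h.2
      exact hγ.congr h.1 (hagree T'' γ hγ (le_csSup hbdd h))
    obtain ⟨T₁, h1⟩ := hne
    refine ⟨(hloc T₁ h1).1, fun t ht => ?_⟩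
    obtain ⟨T₂, h2, h3⟩ := hlt t ht.2
    exact (hloc T₂ h2).2 t ⟨ht.1, h3⟩
  refine ⟨T, fun t => γ' t t, hpos, hflow, ?_⟩
  rw [tendsto_atTop]
  intro R
  -- if the norm were below `R` at a time within `τ` of `T`, then the solution could be
  -- continued past `T`
  obtain ⟨τ, hτ, hloc⟩ := exists_local_flowLine hN (le_max_right R 0)
  have hmem : Ioo (max 0 (T - τ)) T ∈ 𝓝[<] T :=
    Ioo_mem_nhdsLT (max_lt hpos (by linarith))
  filter_upwards [hmem] with t ht
  by_contra! hcon
  have ht0 : 0 < t := (le_max_left _ _).trans_lt ht.1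
  have htτ : T - τ < t := (le_max_right _ _).trans_lt ht.1
  obtain ⟨α, h0, hα⟩ := hloc _ (hcon.le.trans (le_max_left R 0)) t
  have hnew := hflow.extend (t₀ := t) ⟨ht0.le, ht.2⟩ h0 hα
  have := le_csSup hbdd (show t + τ ∈ S from ⟨by linarith, _, hnew⟩)
  linarith

end ODE

/-! ### The constant `κ` -/

/-- The difference of the two powers in `kappaIntegrand`, with `σ = cos φ`, times `cos φ`. -/
noncomputable def ringKernel (p q : ℝ × ℝ) (φ : ℝ) : ℝ :=
  Real.cos φ * (1 / ((p.2 + q.2) ^ 2 + p.1 ^ 2 + q.1 ^ 2 - 2 * p.1 * q.1 * Real.cos φ) ^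
    (3 / 2 : ℝ) - 1 / ((p.2 + q.2) ^ 2 + p.1 ^ 2 + q.1 ^ 2 + 2 * p.1 * q.1 * Real.cos φ) ^
    (3 / 2 : ℝ))

theorem image_cos_Ioo : Real.cos '' Ioo 0 (Real.pi / 2) = Ioo 0 1 := by
  ext x
  constructor
  · rintro ⟨φ, hφ, rfl⟩
    refine ⟨Real.cos_pos_of_mem_Ioo ⟨by linarith [hφ.1, Real.pi_pos], hφ.2⟩, ?_⟩
    rw [← Real.cos_zero]
    exact Real.cos_lt_cos_of_nonneg_of_le_pi le_rfl (by linarith [hφ.2, Real.pi_pos]) hφ.1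
  · intro hx
    exact ⟨Real.arccos x, ⟨Real.arccos_pos.2 hx.2, Real.arccos_lt_pi_div_two.2 hx.1⟩,
      Real.cos_arccos (by linarith [hx.1]) hx.2.le⟩

/-- The substitution `σ = cos φ` in the integral that defines `κ`. -/
theorem integral_kappaIntegrand (p q : ℝ × ℝ) : ∫ σ in (0 : ℝ)..1, kappaIntegrand p q σ =
    (p.2 + q.2) / (p.1 * q.1) * ∫ φ in (0 : ℝ)..(Real.pi / 2), ringKernel p q φ := by
  have hinj : InjOn Real.cos (Ioo 0 (Real.pi / 2)) := Real.injOn_cos.mono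
    (Ioo_subset_Icc_self.trans (Icc_subset_Icc_right (by linarith [Real.pi_pos])))
  rw [intervalIntegral.integral_of_le zero_le_one, integral_Ioc_eq_integral_Ioo, ← image_cos_Ioo,
    integral_image_eq_integral_abs_deriv_smul measurableSet_Ioo
      (fun x _ => (Real.hasDerivAt_cos x).hasDerivWithinAt)
      hinj,
    intervalIntegral.integral_of_le (by positivity), integral_Ioc_eq_integral_Ioo,
    ← integral_const_mul]
  refine setIntegral_congr_fun measurableSet_Ioo fun φ hφ => ?_
  have hsin : 0 < Real.sin φ := Real.sin_pos_of_pos_of_lt_pi hφ.1 (by linarith [hφ.2, Real.pi_pos])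
  have h1 : (1 - Real.cos φ ^ 2) ^ (-(1 / 2) : ℝ) = (Real.sin φ)⁻¹ := by
    rw [← Real.sin_sq, Real.rpow_neg (by positivity), ← Real.sqrt_eq_rpow, Real.sqrt_sq hsin.le]
  simp only [kappaIntegrand, ringKernel, h1, abs_neg, abs_of_pos hsin, smul_eq_mul]
  field_simp

/-- For `c = cos φ` this is the squared distance of a point on the circle `p` from a point on the
mirror image of the circle `q`. -/
theorem denom_pos {p q : ℝ × ℝ} (h : 0 < p.2 + q.2) {c : ℝ} (hc : c ∈ Icc (-1 : ℝ) 1) :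
    0 < (p.2 + q.2) ^ 2 + p.1 ^ 2 + q.1 ^ 2 - 2 * p.1 * q.1 * c := by
  have h1 := pow_pos h 2
  nlinarith [sq_nonneg (p.1 - c * q.1), sq_nonneg q.1, sq_nonneg (q.1 * c), hc.1, hc.2,
    mul_nonneg (sq_nonneg q.1) (mul_nonneg (sub_nonneg.2 hc.2) (by linarith [hc.1] : 0 ≤ 1 + c))]

theorem denom_pos' {p q : ℝ × ℝ} (h : 0 < p.2 + q.2) {c : ℝ} (hc : c ∈ Icc (-1 : ℝ) 1) :
    0 < (p.2 + q.2) ^ 2 + p.1 ^ 2 + q.1 ^ 2 + 2 * p.1 * q.1 * c := by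
  have := denom_pos h (c := -c) ⟨by linarith [hc.2], by linarith [hc.1]⟩
  linarith

/-- The half circles `|φ| < π/2` and `|φ| > π/2` contribute the two terms of `ringKernel`. -/
theorem integral_cos_div_eq {p q : ℝ × ℝ} (h : 0 < p.2 + q.2) :
    ∫ φ in (-Real.pi)..Real.pi, Real.cos φ * (1 / ((p.2 + q.2) ^ 2 + p.1 ^ 2 + q.1 ^ 2 -
      2 * p.1 * q.1 * Real.cos φ) ^ (3 / 2 : ℝ)) =
    2 * ∫ φ in (0 : ℝ)..(Real.pi / 2), ringKernel p q φ := by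
  set g : ℝ → ℝ := fun φ => Real.cos φ * (1 / ((p.2 + q.2) ^ 2 + p.1 ^ 2 + q.1 ^ 2 -
      2 * p.1 * q.1 * Real.cos φ) ^ (3 / 2 : ℝ)) with hg
  have hc : ∀ φ, Real.cos φ ∈ Icc (-1 : ℝ) 1 := Real.cos_mem_Icc
  have hgc : Continuous g := by
    refine Real.continuous_cos.mul (continuous_const.div ?_ fun φ => ?_)
    · exact Continuous.rpow_const (by fun_prop) fun φ => Or.inl (denom_pos h (hc φ)).ne'
    · exact (Real.rpow_pos_of_pos (denom_pos h (hc φ)) _).ne'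
  have hi : ∀ a b, IntervalIntegrable g volume a b := fun a b => hgc.intervalIntegrable a b
  have hneg : ∫ φ in (-Real.pi)..0, g φ = ∫ φ in (0 : ℝ)..Real.pi, g φ := by
    have := intervalIntegral.integral_comp_neg (a := 0) (b := Real.pi) g
    rw [neg_zero] at this
    rw [← this]
    simp [hg]
  have hrefl : ∫ φ in (Real.pi / 2)..Real.pi, g φ =
      ∫ φ in (0 : ℝ)..(Real.pi / 2), g (Real.pi - φ) := by
    rw [intervalIntegral.integral_comp_sub_left g Real.pi]
    congr 1 <;> ring
  have hi' : IntervalIntegrable (fun φ => g (Real.pi - φ)) volume 0 (Real.pi / 2) :=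
    (hgc.comp (continuous_sub_left Real.pi)).intervalIntegrable _ _
  rw [← intervalIntegral.integral_add_adjacent_intervals (hi _ 0) (hi 0 _), hneg,
    ← intervalIntegral.integral_add_adjacent_intervals (hi 0 (Real.pi / 2)) (hi _ Real.pi), hrefl,
    ← intervalIntegral.integral_add (hi _ _)
      hi', ← two_mul]
  congr 1
  refine intervalIntegral.integral_congr fun φ _ => ?_
  simp only [hg, ringKernel, Real.cos_pi_sub]
  rw [mul_neg, sub_neg_eq_add]
  ring

theorem ringKernel_pos {p q : ℝ × ℝ} (hp : 0 < p.1) (hq : 0 < q.1) (h : 0 < p.2 + q.2) {φ : ℝ}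
    (hφ : 0 < Real.cos φ) : 0 < ringKernel p q φ := by
  have hc := Real.cos_mem_Icc φ
  refine mul_pos hφ (sub_pos.2 ?_)
  refine one_div_lt_one_div_of_lt (Real.rpow_pos_of_pos (denom_pos h hc) _) ?_
  refine Real.rpow_lt_rpow (denom_pos h hc).le ?_ (by norm_num)
  have : 0 < 2 * p.1 * q.1 * Real.cos φ := by positivity
  linarith

section kappa

variable {A : Set (ℝ × ℝ)} (hA : ∀ p ∈ A, 0 < p.1 ∧ 0 < p.2)
include hA

theorem integral_kappaIntegrand_pos {p q : ℝ × ℝ} (hp : p ∈ A) (hq : q ∈ A) :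
    0 < ∫ σ in (0 : ℝ)..1, kappaIntegrand p q σ := by
  obtain ⟨hp1, hp2⟩ := hA p hp
  obtain ⟨hq1, hq2⟩ := hA q hq
  have h : 0 < p.2 + q.2 := add_pos hp2 hq2
  rw [integral_kappaIntegrand]
  refine mul_pos (by positivity) ?_
  refine intervalIntegral.intervalIntegral_pos_of_pos_on ?_ (fun φ hφ => ?_) (by positivity)
  · refine Continuous.intervalIntegrable ?_ _ _
    have hc : ∀ φ, Real.cos φ ∈ Icc (-1 : ℝ) 1 := Real.cos_mem_Icc
    refine Real.continuous_cos.mul ((continuous_const.div ?_ fun φ => ?_).sub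
      (continuous_const.div ?_ fun φ => ?_))
    · exact Continuous.rpow_const (by fun_prop) fun φ => Or.inl (denom_pos h (hc φ)).ne'
    · exact (Real.rpow_pos_of_pos (denom_pos h (hc φ)) _).ne'
    · exact Continuous.rpow_const (by fun_prop) fun φ => Or.inl (denom_pos' h (hc φ)).ne'
    · exact (Real.rpow_pos_of_pos (denom_pos' h (hc φ)) _).ne'
  · exact ringKernel_pos hp1 hq1 h
      (Real.cos_pos_of_mem_Ioo ⟨by linarith [hφ.1, Real.pi_pos], hφ.2⟩)

theorem kappa_le {p q : ℝ × ℝ} (hp : p ∈ A) (hq : q ∈ A) :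
    2 * Real.pi * kappa A ≤ ∫ σ in (0 : ℝ)..1, kappaIntegrand p q σ := by
  rw [kappa, ← mul_assoc, mul_one_div_cancel (by positivity), one_mul]
  refine ciInf_le (f := fun pq : ↥(A ×ˢ A) => ∫ σ in (0 : ℝ)..1, kappaIntegrand pq.1.1 pq.1.2 σ)
    ⟨0, ?_⟩ ⟨(p, q), hp, hq⟩
  rintro _ ⟨⟨⟨p, q⟩, hp, hq⟩, rfl⟩
  exact (integral_kappaIntegrand_pos hA hp hq).le

/-- The integral is a continuous positive function on a compact set. -/
theorem kappa_pos (hAc : IsCompact A) (hne : A.Nonempty) : 0 < kappa A := by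
  have hcont : Continuous fun pq : ↥(A ×ˢ A) => ∫ σ in (0 : ℝ)..1,
      kappaIntegrand pq.1.1 pq.1.2 σ := by
    simp only [integral_kappaIntegrand]
    have h1 : ∀ pq : ↥(A ×ˢ A), 0 < pq.1.1.1 := fun pq => (hA _ pq.2.1).1
    have h2 : ∀ pq : ↥(A ×ˢ A), 0 < pq.1.2.1 := fun pq => (hA _ pq.2.2).1
    have h3 : ∀ pq : ↥(A ×ˢ A), 0 < pq.1.1.2 + pq.1.2.2 := fun pq =>
      add_pos (hA _ pq.2.1).2 (hA _ pq.2.2).2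
    refine Continuous.mul (Continuous.div (by fun_prop) (by fun_prop) fun pq =>
      (mul_pos (h1 pq) (h2 pq)).ne') ?_
    refine intervalIntegral.continuous_parametric_intervalIntegral_of_continuous' ?_ _ _
    have hc : ∀ φ, Real.cos φ ∈ Icc (-1 : ℝ) 1 := Real.cos_mem_Icc
    simp only [Function.uncurry_def, ringKernel]
    refine Continuous.mul (by fun_prop) ((continuous_const.div ?_ fun φ => ?_).sub
      (continuous_const.div ?_ fun φ => ?_))
    · exact Continuous.rpow_const (by fun_prop) fun φ =>
        Or.inl (denom_pos (h3 φ.1) (hc φ.2)).ne'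
    · exact (Real.rpow_pos_of_pos (denom_pos (h3 φ.1) (hc φ.2)) _).ne'
    · exact Continuous.rpow_const (by fun_prop) fun φ =>
        Or.inl (denom_pos' (h3 φ.1) (hc φ.2)).ne'
    · exact (Real.rpow_pos_of_pos (denom_pos' (h3 φ.1) (hc φ.2)) _).ne'
  have hne' : Nonempty ↥(A ×ˢ A) := (hne.prod hne).to_subtype
  have hcomp : CompactSpace ↥(A ×ˢ A) := isCompact_iff_compactSpace.1 (hAc.prod hAc)
  obtain ⟨m, -, hm⟩ := isCompact_univ.exists_isMinOn univ_nonempty hcont.continuousOn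
  refine mul_pos (by positivity) ((integral_kappaIntegrand_pos hA m.2.1 m.2.2).trans_le ?_)
  exact le_ciInf fun pq => hm (mem_univ pq)

end kappa

/-! ### Integrals over the upper half space -/

/-- The upper half space `z > 0`. -/
def upperHalf : Set E3 := {x | 0 < x 2}

theorem measurableSet_upperHalf : MeasurableSet upperHalf :=
  (isOpen_lt continuous_const (by fun_prop)).measurableSet

/-- `ℝ³` as the product of the axis and the horizontal plane. -/
noncomputable def axialEquiv : E3 ≃ᵐ ℝ × (ℝ × ℝ) :=
  (MeasurableEquiv.toLp 2 (Fin 3 → ℝ)).symm.trans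
    ((MeasurableEquiv.piFinSuccAbove (fun _ => ℝ) 2).trans
      ((MeasurableEquiv.refl ℝ).prodCongr MeasurableEquiv.finTwoArrow))

theorem axialEquiv_symm (z : ℝ) (p : ℝ × ℝ) : axialEquiv.symm (z, p) = !₂[p.1, p.2, z] := by
  rw [MeasurableEquiv.symm_apply_eq]
  rfl

theorem measurePreserving_axialEquiv : MeasurePreserving axialEquiv volume volume :=
  ((MeasurePreserving.id volume).prod (volume_preserving_finTwoArrow ℝ)).comp
    ((volume_preserving_piFinSuccAbove (fun _ : Fin 3 => ℝ) 2).comp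
      (EuclideanSpace.volume_preserving_symm_measurableEquiv_toLp (Fin 3)))

/-- Fubini for the upper half space, with the integrability of the slices' integrals. -/
theorem setIntegral_upperHalf {g : E3 → ℝ} (hg : IntegrableOn g upperHalf) :
    IntegrableOn (fun z => ∫ p : ℝ × ℝ, g !₂[p.1, p.2, z]) (Ioi 0) ∧
    ∫ x in upperHalf, g x = ∫ z in Ioi (0 : ℝ), ∫ p : ℝ × ℝ, g !₂[p.1, p.2, z] := by
  have hmp : MeasurePreserving axialEquiv.symm volume volume :=
    measurePreserving_axialEquiv.symm
  have hpre : axialEquiv.symm ⁻¹' upperHalf = Ioi (0 : ℝ) ×ˢ (univ : Set (ℝ × ℝ)) := by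
    ext ⟨z, p⟩
    simp [upperHalf, axialEquiv_symm]
  have hfun : (fun q : ℝ × (ℝ × ℝ) => g !₂[q.2.1, q.2.2, q.1]) = g ∘ axialEquiv.symm := by
    ext ⟨z, p⟩
    rw [Function.comp_apply, axialEquiv_symm]
  have hi : IntegrableOn (fun q : ℝ × (ℝ × ℝ) => g !₂[q.2.1, q.2.2, q.1])
      (Ioi (0 : ℝ) ×ˢ (univ : Set (ℝ × ℝ))) := by
    rw [← hpre, hfun]
    exact (hmp.integrableOn_comp_preimage axialEquiv.symm.measurableEmbedding).2 hg
  have h1 := hmp.setIntegral_preimage_emb axialEquiv.symm.measurableEmbedding g upperHalf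
  rw [hpre] at h1
  constructor
  · rw [IntegrableOn, Measure.volume_eq_prod, ← Measure.prod_restrict, Measure.restrict_univ] at hi
    exact hi.integral_prod_left
  · rw [← h1]
    change ∫ q in _, (g ∘ axialEquiv.symm) q = _
    rw [← hfun]
    have := setIntegral_prod _ hi
    rw [Measure.restrict_univ] at this
    exact this

/-- Integration in polar coordinates, with the integrability of the radial integrand. -/
theorem integral_eq_integral_polar {h : ℝ × ℝ → ℝ} (hc : Continuous h) (hcs : HasCompactSupport h) :
    IntegrableOn (fun r => r * ∫ φ in (-Real.pi)..Real.pi, h (r * Real.cos φ, r * Real.sin φ))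
      (Ioi 0) ∧
    ∫ p, h p = ∫ r in Ioi (0 : ℝ), r * ∫ φ in (-Real.pi)..Real.pi,
      h (r * Real.cos φ, r * Real.sin φ) := by
  set F : ℝ × ℝ → ℝ := fun q => q.1 • h (q.1 * Real.cos q.2, q.1 * Real.sin q.2) with hF
  have hFc : Continuous F := by fun_prop
  obtain ⟨R, hR⟩ := hcs.isCompact.isBounded.exists_norm_le
  have hi : IntegrableOn F (Ioi 0 ×ˢ Ioo (-Real.pi) Real.pi) := by
    refine IntegrableOn.of_forall_sdiff_eq_zero (s := Icc 0 (2 * R) ×ˢ Icc (-Real.pi) Real.pi)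
      (hFc.continuousOn.integrableOn_compact (isCompact_Icc.prod isCompact_Icc))
      (measurableSet_Ioi.prod measurableSet_Ioo) ?_
    rintro ⟨r, φ⟩ ⟨⟨hr, hφ⟩, hn⟩
    have hr0 : 0 < r := hr
    have hrR : 2 * R < r := by
      by_contra! hle
      exact hn ⟨⟨hr0.le, hle⟩, Ioo_subset_Icc_self hφ⟩
    suffices h (r * Real.cos φ, r * Real.sin φ) = 0 by simp [hF, this]
    by_contra hne
    have h1 := hR _ (subset_tsupport h hne)
    rw [Prod.norm_def, max_le_iff, Real.norm_eq_abs, Real.norm_eq_abs] at h1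
    have hR0 : 0 ≤ R := (abs_nonneg _).trans h1.1
    have h2 := sq_le_sq' (by linarith [abs_nonneg (r * Real.cos φ)]) h1.1
    have h3 := sq_le_sq' (by linarith [abs_nonneg (r * Real.sin φ)]) h1.2
    rw [sq_abs] at h2 h3
    have h4 : r ^ 2 = (r * Real.cos φ) ^ 2 + (r * Real.sin φ) ^ 2 := by
      linear_combination -r ^ 2 * Real.sin_sq_add_cos_sq φ
    nlinarith
  have hinner : ∀ r : ℝ, ∫ φ in Ioo (-Real.pi) Real.pi, F (r, φ) =
      r * ∫ φ in (-Real.pi)..Real.pi, h (r * Real.cos φ, r * Real.sin φ) := fun r => by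
    rw [intervalIntegral.integral_of_le (by linarith [Real.pi_pos]), integral_Ioc_eq_integral_Ioo,
      ← integral_const_mul]
    rfl
  constructor
  · have h1 := hi
    rw [IntegrableOn, Measure.volume_eq_prod, ← Measure.prod_restrict] at h1
    exact (h1.integral_prod_left).congr (Eventually.of_forall hinner)
  · rw [← integral_comp_polarCoord_symm, polarCoord_target]
    exact (setIntegral_prod F hi).trans (integral_congr_ae (Eventually.of_forall hinner))

/-! ### The impulse `Q` -/

/-- The vertical component of `x × f(x)`, which is `r f_θ` for a swirl field `f = f_θ e_θ`. -/
def angular (f : E3 → E3) (x : E3) : ℝ := x 0 * f x 1 - x 1 * f x 0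

theorem continuous_angular {f : E3 → E3} (hf : Continuous f) : Continuous (angular f) := by
  unfold angular; fun_prop

theorem HasCompactSupport.angular {f : E3 → E3} (hcs : HasCompactSupport f) :
    HasCompactSupport (angular f) :=
  hcs.mono fun x hx h => hx (by simp [VortexStretching.angular, h])

theorem IsAxial.angular_eq {f : E3 → E3} (hf : IsAxial f) (x : E3) :
    angular f x = radius x * omegaTheta f (radius x) (x 2) := by
  set w := omegaTheta f (radius x) (x 2) with hw
  rw [angular, hf.eq_omegaTheta x, ← hw]
  simp only [eTheta, PiLp.smul_apply, smul_eq_mul]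
  simp only [Matrix.cons_val_zero, Matrix.cons_val_one]
  rcases eq_or_ne (radius x) 0 with hr | hr
  · simp [hr]
  · field_simp
    linear_combination (-w) * radius_sq x

theorem radius_polar {r : ℝ} (hr : 0 ≤ r) (φ z : ℝ) :
    radius !₂[r * Real.cos φ, r * Real.sin φ, z] = r := by
  rw [radius, ← Real.sqrt_sq hr]
  congr 1
  simp [Real.sqrt_sq hr]
  linear_combination r ^ 2 * Real.sin_sq_add_cos_sq φ

theorem hasCompactSupport_slice {F : Type*} [Zero F] {g : E3 → F} (hcs : HasCompactSupport g)
    (z : ℝ) : HasCompactSupport fun p : ℝ × ℝ => g !₂[p.1, p.2, z] := by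
  obtain ⟨R, hR⟩ := hcs.isCompact.isBounded.exists_norm_le
  refine HasCompactSupport.intro (isCompact_closedBall (0 : ℝ × ℝ) R) fun p hp => ?_
  by_contra hne
  have h1 := hR _ (subset_tsupport g hne)
  apply hp
  rw [mem_closedBall_zero_iff, Prod.norm_def, max_le_iff]
  exact ⟨by simpa using (PiLp.norm_apply_le !₂[p.1, p.2, z] 0).trans h1,
    by simpa using (PiLp.norm_apply_le !₂[p.1, p.2, z] 1).trans h1⟩

/-- `Q` as an integral over the upper half space. -/
theorem IsAxial.setIntegral_angular {f : E3 → E3} (hf : IsAxial f) (hc : Continuous f)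
    (hcs : HasCompactSupport f) : ∫ x in upperHalf, angular f x = -(2 * Real.pi) * Q f := by
  have hi : IntegrableOn (angular f) upperHalf :=
    ((continuous_angular hc).integrable_of_hasCompactSupport
      (HasCompactSupport.angular hcs)).integrableOn
  rw [(setIntegral_upperHalf hi).2, Q, neg_mul_neg, ← integral_const_mul]
  refine integral_congr_ae (Eventually.of_forall fun z => ?_)
  dsimp only
  have hcs' : Continuous fun p : ℝ × ℝ => angular f !₂[p.1, p.2, z] :=
    (continuous_angular hc).comp (by fun_prop)
  rw [(integral_eq_integral_polar hcs'
    (hasCompactSupport_slice (HasCompactSupport.angular hcs) z)).2, ← integral_const_mul]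
  refine setIntegral_congr_fun measurableSet_Ioi fun r hr => ?_
  have hr' : 0 ≤ r := le_of_lt hr
  have : ∀ φ, angular f !₂[r * Real.cos φ, r * Real.sin φ, z] = r * omegaTheta f r z := fun φ => by
    rw [hf.angular_eq, radius_polar hr']
    simp
  simp only [this, intervalIntegral.integral_const, smul_eq_mul]
  ring

/-! ### Growth of the impulse -/

/-- The infinitesimal form of the rotational invariance of the velocity. -/
theorem IsAxial.fderiv_velocity_rot {s : ℝ} (hs : 3 / 2 < s) {f : E3 → E3} (hf : MemHs s f)
    (hcs : HasCompactSupport f) (hax : IsAxial f) (x : E3) :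
    fderiv ℝ (velocity f) x !₂[-x 1, x 0, 0] = !₂[-velocity f x 1, velocity f x 0, 0] := by
  have hrot : ∀ v : E3, HasDerivAt (fun t : ℝ =>
      (!₂[Real.cos t * v 0 - Real.sin t * v 1, Real.sin t * v 0 + Real.cos t * v 1, v 2] : E3))
      !₂[-v 1, v 0, 0] 0 := by
    intro v
    have h := ((Real.hasDerivAt_cos 0).smul_const (!₂[v 0, v 1, 0] : E3)).add
      ((Real.hasDerivAt_sin 0).smul_const (!₂[-v 1, v 0, 0] : E3)) |>.add_const (!₂[0, 0, v 2] : E3)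
    have heq : (fun t : ℝ => (!₂[Real.cos t * v 0 - Real.sin t * v 1,
        Real.sin t * v 0 + Real.cos t * v 1, v 2] : E3)) = fun t : ℝ =>
        Real.cos t • (!₂[v 0, v 1, 0] : E3) + Real.sin t • (!₂[-v 1, v 0, 0] : E3) +
          (!₂[0, 0, v 2] : E3) := by
      ext t i
      fin_cases i <;> simp <;> ring
    rw [heq]
    refine HasDerivAt.congr_deriv h ?_
    ext i
    fin_cases i <;> simp
  have h0 : (!₂[Real.cos 0 * x 0 - Real.sin 0 * x 1, Real.sin 0 * x 0 + Real.cos 0 * x 1, x 2] : E3)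
      = x := by
    ext i; fin_cases i <;> simp
  have hd := (hasFDerivAt_velocity hs hf x).differentiableAt.hasFDerivAt
  have h1 := (h0.symm ▸ hd : HasFDerivAt (velocity f) (fderiv ℝ (velocity f) x)
    (!₂[Real.cos 0 * x 0 - Real.sin 0 * x 1, Real.sin 0 * x 0 + Real.cos 0 * x 1, x 2] : E3)
    ).comp_hasDerivAt 0 (hrot x)
  have h2 : (velocity f ∘ fun t : ℝ =>
      (!₂[Real.cos t * x 0 - Real.sin t * x 1, Real.sin t * x 0 + Real.cos t * x 1, x 2] : E3)) =
      fun t : ℝ => !₂[Real.cos t * velocity f x 0 - Real.sin t * velocity f x 1,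
        Real.sin t * velocity f x 0 + Real.cos t * velocity f x 1, velocity f x 2] := by
    ext1 t
    have := hax.velocity_axialMap hs hf hcs (a := Real.cos t) (b := Real.sin t) (ε := 1) (δ := 1)
      (Real.cos_sq_add_sin_sq t) (by norm_num) (by norm_num) x
    simpa [axialMap_apply] using this
  rw [h2] at h1
  exact h1.unique (hrot (velocity f x))

/-- The stretching of a swirl field needs no derivative of the velocity: differentiation along `e_θ`
rotates the horizontal part of the velocity. -/
theorem IsAxial.angular_stretching {s : ℝ} (hs : 3 / 2 < s) {f : E3 → E3} (hf : MemHs s f)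
    (hcs : HasCompactSupport f) (hax : IsAxial f) (x : E3) :
    angular (VortexStretching.stretching f) x =
      f x 1 * velocity f x 0 - f x 0 * velocity f x 1 := by
  set c := omegaTheta f (radius x) (x 2) / radius x with hc
  have h1 : f x = c • (!₂[-x 1, x 0, 0] : E3) := by
    rw [hax.eq_omegaTheta x, hc]
    ext i
    fin_cases i <;> simp [eTheta] <;> ring
  have h2 : VortexStretching.stretching f x =
      c • (!₂[-velocity f x 1, velocity f x 0, 0] : E3) := by
    rw [VortexStretching.stretching, h1, map_smul, hax.fderiv_velocity_rot hs hf hcs]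
  rw [angular, h2, h1]
  simp
  ring

theorem IsAxial.apply_two {f : E3 → E3} (hax : IsAxial f) (x : E3) : f x 2 = 0 := by
  rw [hax.eq_omegaTheta x]
  simp [eTheta]

/-- The interaction of the vortex elements at `x` and `y`. -/
noncomputable def pairing (f : E3 → E3) (x y : E3) : ℝ :=
  (‖x - y‖ ^ 3)⁻¹ * ((x 2 - y 2) * inner ℝ (f x) (f y))

theorem pairing_anticomm (f : E3 → E3) (x y : E3) : pairing f y x = -pairing f x y := by
  rw [pairing, pairing, norm_sub_rev, real_inner_comm]
  ring

/-- The density of `Q'` is the interaction of the vortex element at `x` with all the others. -/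
theorem IsAxial.angular_stretching_eq_integral {s : ℝ} (hs : 3 / 2 < s) {f : E3 → E3}
    (hf : MemHs s f) (hcs : HasCompactSupport f) (hax : IsAxial f) (x : E3) :
    angular (VortexStretching.stretching f) x = (4 * Real.pi)⁻¹ * ∫ y, pairing f x y := by
  rw [hax.angular_stretching hs hf hcs, velocity_eq_integral hs hf hcs]
  have hi : Integrable fun y => (‖x - y‖ ^ 3)⁻¹ • crossR (f y) (x - y) := by
    refine (integrable_biotSavart hf.1 hcs x).neg.congr (Eventually.of_forall fun y => ?_)
    simp only [Pi.neg_apply]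
    rw [← smul_neg, ← crossR_anticomm]
  set l : E3 →L[ℝ] ℝ := f x 1 • EuclideanSpace.proj (𝕜 := ℝ) (0 : Fin 3) -
    f x 0 • EuclideanSpace.proj (𝕜 := ℝ) (1 : Fin 3) with hl
  have hl' : ∀ v : E3, f x 1 * v 0 - f x 0 * v 1 = l v := fun v => by simp [hl]
  rw [hl', map_smul, ← l.integral_comp_comm hi, smul_eq_mul]
  congr 1
  refine integral_congr_ae (Eventually.of_forall fun y => ?_)
  dsimp only
  rw [map_smul, ← hl', pairing, smul_eq_mul]
  congr 1
  simp [crossR_apply, cross_apply, PiLp.inner_apply, Fin.sum_univ_three, hax.apply_two]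
  ring

theorem norm_pairing_le (f : E3 → E3) (x y : E3) :
    ‖pairing f x y‖ ≤ ‖f x‖ * ((‖x - y‖ ^ 2)⁻¹ * ‖f y‖) := by
  rw [pairing, norm_mul, norm_mul, Real.norm_of_nonneg (by positivity)]
  rcases eq_or_ne (x - y) 0 with h | h
  · simp [h]
  have h0 : 0 < ‖x - y‖ := norm_pos_iff.2 h
  calc (‖x - y‖ ^ 3)⁻¹ * (‖x 2 - y 2‖ * ‖(inner ℝ (f x) (f y) : ℝ)‖)
      ≤ (‖x - y‖ ^ 3)⁻¹ * (‖x - y‖ * (‖f x‖ * ‖f y‖)) := by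
        gcongr
        · exact PiLp.norm_apply_le (x - y) 2
        · exact norm_inner_le_norm _ _
    _ = _ := by field_simp

theorem integrable_pairing {f : E3 → E3} (hc : Continuous f) (hcs : HasCompactSupport f) (x : E3) :
    Integrable (pairing f x) := by
  refine ((integrable_inv_sq_sub_mul hc hcs x).const_mul ‖f x‖).mono' ?_
    (Eventually.of_forall fun y => norm_pairing_le f x y)
  unfold pairing
  exact (Measurable.aestronglyMeasurable (f := fun y : E3 => (‖x - y‖ ^ 3)⁻¹)
    (by fun_prop)).mul (Continuous.aestronglyMeasurable (by fun_prop))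

theorem integrable_pairing_prod {f : E3 → E3} (hc : Continuous f) (hcs : HasCompactSupport f) :
    Integrable (fun p : E3 × E3 => pairing f p.1 p.2) (volume.prod volume) := by
  obtain ⟨R, hR⟩ := hcs.isCompact.isBounded.exists_norm_le
  obtain ⟨M, hM⟩ := hc.bounded_above_of_compact_support hcs
  set φ : E3 → ℝ := (Metric.ball (0 : E3) (2 * R + 1)).indicator fun z => (‖z‖ ^ 2)⁻¹ with hφdef
  have hφ : Integrable φ := (integrable_indicator_iff Metric.isOpen_ball.measurableSet).2
    (integrableOn_norm_inv_sq _)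
  have hfn : Integrable fun y => ‖f y‖ := (hc.integrable_of_hasCompactSupport hcs).norm
  have hconv := (hfn.convolution_integrand (ContinuousLinearMap.mul ℝ ℝ) hφ).const_mul M
  refine hconv.mono' ?_ (Eventually.of_forall fun p => ?_)
  · unfold pairing
    exact (Measurable.aestronglyMeasurable (f := fun p : E3 × E3 => (‖p.1 - p.2‖ ^ 3)⁻¹)
      (by fun_prop)).mul (Continuous.aestronglyMeasurable (by fun_prop))
  · obtain ⟨x, y⟩ := p
    have hφ0 : 0 ≤ φ (x - y) := indicator_nonneg (fun z _ => by positivity) _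
    simp only [ContinuousLinearMap.mul_apply']
    by_cases hx : f x = 0
    · have := norm_pairing_le f x y
      rw [hx, norm_zero, zero_mul] at this
      exact this.trans (mul_nonneg ((norm_nonneg _).trans (hM 0)) (by positivity))
    by_cases hy : f y = 0
    · have := norm_pairing_le f x y
      rw [hy, norm_zero, mul_zero, mul_zero] at this
      exact this.trans (mul_nonneg ((norm_nonneg _).trans (hM 0)) (by positivity))
    -- differences of points of the support stay in a ball, where `|z|⁻²` is integrable
    have hmem : x - y ∈ Metric.ball (0 : E3) (2 * R + 1) := by
      rw [mem_ball_zero_iff]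
      have h1 := hR _ (subset_tsupport f hx)
      have h2 := hR _ (subset_tsupport f hy)
      linarith [norm_sub_le x y]
    refine (norm_pairing_le f x y).trans ?_
    simp only [hφdef, indicator_of_mem hmem]
    rw [mul_comm ((‖x - y‖ ^ 2)⁻¹)]
    gcongr
    exact hM x

/-- The interaction of the vortex element at `x` with the mirror image of the one at `y`. -/
noncomputable def mirrorPairing (f : E3 → E3) (x y : E3) : ℝ :=
  (x 2 + y 2) * inner ℝ (f x) (f y) *
    (1 / ((x 2 + y 2) ^ 2 + (x 0 - y 0) ^ 2 + (x 1 - y 1) ^ 2) ^ (3 / 2 : ℝ))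

/-- The reflection in the plane `z = 0`. -/
noncomputable abbrev mirror : E3 ≃ₗᵢ[ℝ] E3 :=
  axialMap (a := 1) (b := 0) (ε := 1) (δ := -1) (by norm_num) (by norm_num) (by norm_num)

theorem mirror_apply (x : E3) : mirror x = !₂[x 0, x 1, -x 2] := by
  rw [axialMap_apply]; simp

theorem IsAxial.pairing_mirror {f : E3 → E3} (hax : IsAxial f) (x y : E3) :
    pairing f x (mirror y) = -mirrorPairing f x y := by
  have h1 : (‖x - mirror y‖ ^ 3)⁻¹ =
      1 / ((x 2 + y 2) ^ 2 + (x 0 - y 0) ^ 2 + (x 1 - y 1) ^ 2) ^ (3 / 2 : ℝ) := by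
    have h2 : (x 2 + y 2) ^ 2 + (x 0 - y 0) ^ 2 + (x 1 - y 1) ^ 2 = ‖x - mirror y‖ ^ 2 := by
      rw [mirror_apply, EuclideanSpace.norm_sq_eq, Fin.sum_univ_three]
      simp
      ring
    rw [h2, ← Real.rpow_natCast _ 2, ← Real.rpow_natCast _ 3, ← Real.rpow_mul (norm_nonneg _),
      one_div]
    norm_num
  have h2 : inner ℝ (f x) (f (mirror y)) = -inner ℝ (f x) (f y) := by
    have h3 : mirror (f y) = f y := by
      rw [mirror_apply]
      ext i
      fin_cases i <;> simp [hax.apply_two]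
    rw [hax, ← mirror, h3, inner_smul_right]
    ring
  have h4 : mirror y 2 = -y 2 := by rw [mirror_apply]; rfl
  rw [pairing, h1, h2, mirrorPairing, h4]
  ring

theorem IsAxial.integrable_mirrorPairing {f : E3 → E3} (hax : IsAxial f) (hc : Continuous f)
    (hcs : HasCompactSupport f) (x : E3) : Integrable (mirrorPairing f x) := by
  have h := ((mirror.measurePreserving.integrable_comp_emb
    mirror.toMeasurableEquiv.measurableEmbedding).2 (integrable_pairing hc hcs x)).neg
  refine h.congr (Eventually.of_forall fun y => ?_)
  simp only [Pi.neg_apply, Function.comp_apply]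
  rw [hax.pairing_mirror, neg_neg]

/-- As `f` is odd under reflection in the plane `z = 0`, the lower half space consists of mirror
images of the upper one, with the opposite sign. -/
theorem IsAxial.setIntegral_compl_pairing {f : E3 → E3} (hax : IsAxial f)
    (x : E3) : ∫ y in upperHalfᶜ, pairing f x y = -∫ y in upperHalf, mirrorPairing f x y := by
  have h1 := mirror.measurePreserving.setIntegral_preimage_emb
    mirror.toMeasurableEquiv.measurableEmbedding (pairing f x) upperHalfᶜ
  rw [← h1, ← integral_neg]
  simp only [hax.pairing_mirror]
  refine setIntegral_eq_of_subset_of_forall_sdiff_eq_zero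
    (mirror.continuous.measurable measurableSet_upperHalf.compl) (fun y hy => ?_) (fun y hy => ?_)
  · have hy' : 0 < y 2 := hy
    simp only [upperHalf, mem_preimage, mem_compl_iff, mem_ofPred_eq, mirror_apply]
    simpa using hy'.le
  · have h2 : y 2 = 0 := by
      have h3 : ¬ 0 < y 2 := hy.2
      have h4 := hy.1
      simp only [upperHalf, mem_preimage, mem_compl_iff, mem_ofPred_eq, mirror_apply] at h4
      simp at h4
      linarith
    have h5 := hax.omegaTheta_neg (radius y) 0
    rw [neg_zero] at h5
    have h6 : f y = 0 := by
      rw [hax.eq_omegaTheta y, h2, show omegaTheta f (radius y) 0 = 0 by linarith, zero_smul]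
    simp [mirrorPairing, h6]

/-- The vortex elements of the upper half space do not change their total impulse, because `pairing`
is antisymmetric. -/
theorem setIntegral_pairing_eq_zero {f : E3 → E3} (hc : Continuous f) (hcs : HasCompactSupport f) :
    ∫ x in upperHalf, ∫ y in upperHalf, pairing f x y = 0 := by
  have h := integral_integral_swap (f := pairing f) (μ := volume.restrict upperHalf)
    (ν := volume.restrict upperHalf) (by
      rw [Measure.prod_restrict]
      exact (integrable_pairing_prod hc hcs).integrableOn)
  have h2 : ∫ y in upperHalf, ∫ x in upperHalf, pairing f x y =
      -∫ x in upperHalf, ∫ y in upperHalf, pairing f x y := by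
    rw [← integral_neg]
    refine integral_congr_ae (Eventually.of_forall fun y => ?_)
    dsimp only
    rw [← integral_neg]
    exact integral_congr_ae (Eventually.of_forall fun x => pairing_anticomm f y x)
  rw [h2] at h
  exact self_eq_neg.1 h

/-- The growth rate of the impulse: only the interaction with the mirror images contributes. -/
theorem IsAxial.Q_stretching {s : ℝ} (hs : 3 / 2 < s) {f : E3 → E3}
    (hf : MemHs s f) (hcs : HasCompactSupport f) (hax : IsAxial f) :
    IntegrableOn (fun x => ∫ y in upperHalf, mirrorPairing f x y) upperHalf ∧
    8 * Real.pi ^ 2 * Q (VortexStretching.stretching f) =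
      ∫ x in upperHalf, ∫ y in upperHalf, mirrorPairing f x y := by
  have hcs' : HasCompactSupport (VortexStretching.stretching f) :=
    hcs.mono fun x hx h => hx (by simp [VortexStretching.stretching, h])
  have h1 := (hax.stretching hs hf hcs).setIntegral_angular (hf.stretching hs).1 hcs'
  simp only [hax.angular_stretching_eq_integral hs hf hcs] at h1
  have hU : Integrable (fun x => ∫ y in upperHalf, pairing f x y) (volume.restrict upperHalf) := by
    have := ((integrable_pairing_prod hf.1 hcs).integrableOn (s := upperHalf ×ˢ upperHalf))
    rw [IntegrableOn, ← Measure.prod_restrict] at this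
    exact this.integral_prod_left
  have hL : Integrable (fun x => ∫ y in upperHalfᶜ, pairing f x y) (volume.restrict upperHalf) := by
    have := ((integrable_pairing_prod hf.1 hcs).integrableOn (s := upperHalf ×ˢ upperHalfᶜ))
    rw [IntegrableOn, ← Measure.prod_restrict] at this
    exact this.integral_prod_left
  have hsplit : ∀ x, ∫ y, pairing f x y =
      (∫ y in upperHalf, pairing f x y) + ∫ y in upperHalfᶜ, pairing f x y := fun x =>
    (integral_add_compl measurableSet_upperHalf (integrable_pairing hf.1 hcs x)).symm
  simp only [hsplit] at h1
  rw [integral_const_mul, integral_add hU hL, setIntegral_pairing_eq_zero hf.1 hcs, zero_add] at h1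
  simp only [hax.setIntegral_compl_pairing] at h1 hL
  rw [integral_neg] at h1
  refine ⟨hL.neg.congr (Eventually.of_forall fun x => neg_neg _), ?_⟩
  field_simp at h1
  linarith

theorem IsAxial.mirrorPairing_axialMap {f : E3 → E3} (hax : IsAxial f) {a b : ℝ}
    (h : a ^ 2 + b ^ 2 = 1) (x y : E3) :
    mirrorPairing f (axialMap h (ε := 1) (δ := 1) (by norm_num) (by norm_num) x)
      (axialMap h (ε := 1) (δ := 1) (by norm_num) (by norm_num) y) = mirrorPairing f x y := by
  set L := axialMap h (ε := 1) (δ := 1) (by norm_num) (by norm_num) with hL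
  have h0 : ∀ v, L v 0 = a * v 0 - b * v 1 := fun v => by simp [hL, axialMap_apply]
  have h1 : ∀ v, L v 1 = b * v 0 + a * v 1 := fun v => by simp [hL, axialMap_apply]
  have h2 : ∀ v, L v 2 = v 2 := fun v => by simp [hL, axialMap_apply]
  have hD : (L x 0 - L y 0) ^ 2 + (L x 1 - L y 1) ^ 2 =
      (x 0 - y 0) ^ 2 + (x 1 - y 1) ^ 2 := by
    rw [h0, h0, h1, h1]
    linear_combination ((x 0 - y 0) ^ 2 + (x 1 - y 1) ^ 2) * h
  rw [mirrorPairing, mirrorPairing, add_assoc, hD, h2, h2, hax, hax]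
  simp only [one_mul, one_smul, ← hL, LinearIsometryEquiv.inner_map_map, ← add_assoc]

/-- The interaction of two coaxial vortex rings, in cylindrical coordinates. -/
theorem IsAxial.integral_mirrorPairing {f : E3 → E3} (hax : IsAxial f) {r z ρ ζ : ℝ} (hr : 0 < r)
    (hz : 0 < z) (hρ : 0 < ρ) (hζ : 0 < ζ) :
    ∫ φ in (-Real.pi)..Real.pi,
      mirrorPairing f !₂[r, 0, z] !₂[ρ * Real.cos φ, ρ * Real.sin φ, ζ] =
    omegaTheta f r z * omegaTheta f ρ ζ * (2 * r * ρ *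
      ∫ σ in (0 : ℝ)..1, kappaIntegrand (r, z) (ρ, ζ) σ) := by
  have h0 : f !₂[r, 0, z] 0 = 0 := by
    rw [hax.eq_omegaTheta]; simp [eTheta]
  have h1 : f !₂[r, 0, z] 1 = omegaTheta f r z := rfl
  have h2 : ∀ φ, f !₂[ρ * Real.cos φ, ρ * Real.sin φ, ζ] 1 = omegaTheta f ρ ζ * Real.cos φ :=
    fun φ => by
      rw [hax.eq_omegaTheta, radius_polar hρ.le]
      simp [eTheta, radius_polar hρ.le]
      left
      field_simp
  have h3 : ∀ φ, mirrorPairing f !₂[r, 0, z] !₂[ρ * Real.cos φ, ρ * Real.sin φ, ζ] =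
      (z + ζ) * omegaTheta f r z * omegaTheta f ρ ζ * (Real.cos φ * (1 / ((z + ζ) ^ 2 + r ^ 2 +
        ρ ^ 2 - 2 * r * ρ * Real.cos φ) ^ (3 / 2 : ℝ))) := fun φ => by
    have hin : inner ℝ (f !₂[r, 0, z]) (f !₂[ρ * Real.cos φ, ρ * Real.sin φ, ζ]) =
        omegaTheta f r z * (omegaTheta f ρ ζ * Real.cos φ) := by
      rw [PiLp.inner_apply, Fin.sum_univ_three, h0, h1, h2, hax.apply_two]
      simp [mul_comm]
    have hD : (z + ζ) ^ 2 + (r - ρ * Real.cos φ) ^ 2 + (0 - ρ * Real.sin φ) ^ 2 =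
        (z + ζ) ^ 2 + r ^ 2 + ρ ^ 2 - 2 * r * ρ * Real.cos φ := by
      linear_combination ρ ^ 2 * Real.sin_sq_add_cos_sq φ
    rw [mirrorPairing, hin, ← hD]
    simp only [Matrix.cons_val_zero, Matrix.cons_val_one, Matrix.cons_val]
    ring
  simp only [h3]
  rw [intervalIntegral.integral_const_mul,
    integral_cos_div_eq (p := (r, z)) (q := (ρ, ζ)) (add_pos hz hζ), integral_kappaIntegrand]
  field_simp

/-- The lower bound for the interaction of a vortex element with the mirror images of all the
others, by the constant `κ`. -/
theorem IsAxial.le_integral_mirrorPairing {f : E3 → E3} (hax : IsAxial f) (hc : Continuous f)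
    (hcs : HasCompactSupport f) {A : Set (ℝ × ℝ)} (hA : ∀ p ∈ A, 0 < p.1 ∧ 0 < p.2)
    (hfA : ∀ r z : ℝ, 0 < r → 0 < z → (r, z) ∉ A → omegaTheta f r z = 0)
    (hneg : ∀ r z : ℝ, 0 < r → 0 < z → omegaTheta f r z ≤ 0) {r z : ℝ} (hr : 0 < r) (hz : 0 < z) :
    4 * Real.pi * kappa A * (r * omegaTheta f r z) * -Q f ≤
      ∫ y in upperHalf, mirrorPairing f !₂[r, 0, z] y := by
  obtain ⟨hi, he⟩ := setIntegral_upperHalf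
    (hax.integrable_mirrorPairing hc hcs !₂[r, 0, z]).integrableOn
  have hκ : ∀ ρ ζ : ℝ, 0 < ρ → 0 < ζ →
      4 * Real.pi * kappa A * (r * omegaTheta f r z) * (ρ ^ 2 * omegaTheta f ρ ζ) ≤
      ρ * ∫ φ in (-Real.pi)..Real.pi,
        mirrorPairing f !₂[r, 0, z] !₂[ρ * Real.cos φ, ρ * Real.sin φ, ζ] := by
    intro ρ ζ hρ hζ
    rw [hax.integral_mirrorPairing hr hz hρ hζ]
    by_cases h1 : (r, z) ∈ A
    · by_cases h2 : (ρ, ζ) ∈ A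
      · have h3 := kappa_le hA h1 h2
        have h4 := mul_nonneg_of_nonpos_of_nonpos (hneg r z hr hz) (hneg ρ ζ hρ hζ)
        have h5 : 0 ≤ 2 * r * ρ ^ 2 * (omegaTheta f r z * omegaTheta f ρ ζ) := by positivity
        nlinarith [mul_le_mul_of_nonneg_left h3 h5]
      · simp [hfA ρ ζ hρ hζ h2]
    · simp [hfA r z hr hz h1]
  have hκ0 : 0 ≤ kappa A := by
    refine mul_nonneg (by positivity) (Real.iInf_nonneg fun pq => ?_)
    exact (integral_kappaIntegrand_pos hA pq.2.1 pq.2.2).le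
  have hnn : ∀ ρ ζ : ℝ, 0 < ρ → 0 < ζ →
      0 ≤ 4 * Real.pi * kappa A * (r * omegaTheta f r z) * (ρ ^ 2 * omegaTheta f ρ ζ) := by
    intro ρ ζ hρ hζ
    have h4 := mul_nonneg_of_nonpos_of_nonpos (hneg r z hr hz) (hneg ρ ζ hρ hζ)
    have : 0 ≤ 4 * Real.pi * kappa A * r * ρ ^ 2 * (omegaTheta f r z * omegaTheta f ρ ζ) := by
      positivity
    linarith
  rw [he, Q, neg_neg, ← integral_const_mul]
  simp only [← integral_const_mul]
  refine integral_mono_of_nonneg ?_ hi ?_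
  · filter_upwards [ae_restrict_mem measurableSet_Ioi] with ζ hζ
    refine setIntegral_nonneg measurableSet_Ioi fun ρ hρ => hnn ρ ζ hρ hζ
  · filter_upwards [ae_restrict_mem measurableSet_Ioi] with ζ hζ
    have hζ' : 0 < ζ := hζ
    have hcont : Continuous fun p : ℝ × ℝ => mirrorPairing f !₂[r, 0, z] !₂[p.1, p.2, ζ] := by
      have hpos : ∀ p : ℝ × ℝ, 0 < (z + ζ) ^ 2 + (r - p.1) ^ 2 + (0 - p.2) ^ 2 := fun p => by
        positivity
      unfold mirrorPairing
      refine Continuous.mul (Continuous.mul (by fun_prop) (by fun_prop)) ?_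
      refine continuous_const.div (Continuous.rpow_const (by fun_prop) fun p => Or.inl ?_)
        fun p => ?_
      · exact (hpos p).ne'
      · exact (Real.rpow_pos_of_pos (hpos p) _).ne'
    have hcomp : HasCompactSupport fun p : ℝ × ℝ =>
        mirrorPairing f !₂[r, 0, z] !₂[p.1, p.2, ζ] :=
      (hasCompactSupport_slice hcs ζ).mono fun p hp h => hp (by simp [mirrorPairing, h])
    obtain ⟨hi2, he2⟩ := integral_eq_integral_polar hcont hcomp
    rw [he2]
    refine integral_mono_of_nonneg ?_ hi2 ?_
    · filter_upwards [ae_restrict_mem measurableSet_Ioi] with ρ hρ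
      exact hnn ρ ζ hρ hζ
    · filter_upwards [ae_restrict_mem measurableSet_Ioi] with ρ hρ
      exact hκ ρ ζ hρ hζ

/-- The Riccati inequality for the impulse. -/
theorem IsAxial.kappa_mul_Q_sq_le {s : ℝ} (hs : 3 / 2 < s) {f : E3 → E3}
    (hf : MemHs s f) (hcs : HasCompactSupport f) (hax : IsAxial f) {A : Set (ℝ × ℝ)}
    (hA : ∀ p ∈ A, 0 < p.1 ∧ 0 < p.2)
    (hfA : ∀ r z : ℝ, 0 < r → 0 < z → (r, z) ∉ A → omegaTheta f r z = 0)
    (hneg : ∀ r z : ℝ, 0 < r → 0 < z → omegaTheta f r z ≤ 0) :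
    kappa A * Q f ^ 2 ≤ Q (VortexStretching.stretching f) := by
  obtain ⟨hi, he⟩ := hax.Q_stretching hs hf hcs
  have hia : IntegrableOn (angular f) upperHalf :=
    ((continuous_angular hf.1).integrable_of_hasCompactSupport
      (HasCompactSupport.angular hcs)).integrableOn
  have hmono : ∫ x in upperHalf, 4 * Real.pi * kappa A * -Q f * angular f x ≤
      ∫ x in upperHalf, ∫ y in upperHalf, mirrorPairing f x y := by
    refine setIntegral_mono_on (hia.const_mul _) hi measurableSet_upperHalf fun x hx => ?_
    rcases eq_or_ne (radius x) 0 with hr | hr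
    · have hx0 : f x = 0 := by
        rw [hax.eq_omegaTheta x]
        have : eTheta x = 0 := by ext i; fin_cases i <;> simp [eTheta, hr]
        rw [this, smul_zero]
      simp [angular, mirrorPairing, hx0]
    · have hr' : 0 < radius x := lt_of_le_of_ne (radius_nonneg x) hr.symm
      have hab : (x 0 / radius x) ^ 2 + (x 1 / radius x) ^ 2 = 1 := by
        rw [div_pow, div_pow, ← add_div, ← radius_sq, div_self (pow_ne_zero 2 hr)]
      set L := axialMap hab (ε := 1) (δ := 1) (by norm_num) (by norm_num) with hL
      have hLx : L !₂[radius x, 0, x 2] = x := by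
        ext i; fin_cases i <;> simp [hL, axialMap_apply] <;> field_simp
      -- a rotation moves `x` to the half plane `θ = 0`
      have hinv : ∫ y in upperHalf, mirrorPairing f x y =
          ∫ y in upperHalf, mirrorPairing f !₂[radius x, 0, x 2] y := by
        rw [← L.measurePreserving.setIntegral_preimage_emb
          L.toMeasurableEquiv.measurableEmbedding (mirrorPairing f x) upperHalf]
        have hpre : L ⁻¹' upperHalf = upperHalf := by
          ext y; simp [upperHalf, hL, axialMap_apply]
        rw [hpre]
        refine integral_congr_ae (Eventually.of_forall fun y => ?_)
        conv_lhs => rw [← hLx]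
        exact hax.mirrorPairing_axialMap hab _ y
      rw [hinv, hax.angular_eq]
      refine le_trans (le_of_eq ?_) (hax.le_integral_mirrorPairing hf.1 hcs hA hfA hneg hr' hx)
      ring
  rw [integral_const_mul, hax.setIntegral_angular hf.1 hcs, ← he] at hmono
  have hpi : 0 < 8 * Real.pi ^ 2 := by positivity
  refine le_of_mul_le_mul_left ?_ hpi
  linarith

/-! ### The state space -/

/-- Point evaluation of the field with Fourier transform `g`. -/
noncomputable def evalSob {s : ℝ} (hs : 3 / 2 < s) (x : E3) : Lp C3 2 (sobolevMeasure s) →L[ℝ] C3 :=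
  LinearMap.mkContinuous
    { toFun := fun g => 𝓕⁻ (g : E3 → C3) x
      map_add' := fun g h => by
        have hg := MemLp.integrable_of_sobolevMeasure hs (Lp.memLp g)
        have hh := MemLp.integrable_of_sobolevMeasure hs (Lp.memLp h)
        have h1 := (volume_absolutelyContinuous_sobolevMeasure (by linarith : 0 ≤ s)).ae_eq
          (Lp.coeFn_add g h)
        have hchar : ∀ {c : E3 → C3}, Integrable c →
            Integrable fun v => Real.fourierChar (inner ℝ v x) • c v := fun hc => by
          simpa using (Real.fourierIntegral_convergent_iff (-x)).2 hc
        rw [Real.fourierInv_congr_ae h1, Real.fourierInv_eq, Real.fourierInv_eq,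
          Real.fourierInv_eq, ← integral_add (hchar hg) (hchar hh)]
        simp only [Pi.add_apply, smul_add]
      map_smul' := fun c g => by
        have h1 := (volume_absolutelyContinuous_sobolevMeasure (by linarith : 0 ≤ s)).ae_eq
          (Lp.coeFn_smul c g)
        rw [Real.fourierInv_congr_ae h1, Real.fourierInv_eq, Real.fourierInv_eq,
          RingHom.id_apply, ← integral_smul]
        refine integral_congr_ae (Eventually.of_forall fun v => ?_)
        simp only [Pi.smul_apply]
        exact smul_comm _ _ _ }
    (sobolevConst s).toReal fun g => by
      have h := (enorm_fourierInv_le (g : E3 → C3) x).trans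
        (eLpNorm_one_le_sobolevConst_mul (s := s)
          (MemLp.of_sobolevMeasure (by linarith) (Lp.memLp g)).1)
      rw [← Lp.enorm_def] at h
      have h2 := ENNReal.toReal_mono (ENNReal.mul_ne_top (sobolevConst_lt_top hs).ne
        enorm_ne_top) h
      rwa [ENNReal.toReal_mul, toReal_enorm, toReal_enorm] at h2

theorem evalSob_apply {s : ℝ} (hs : 3 / 2 < s) (x : E3) (g : Lp C3 2 (sobolevMeasure s)) :
    evalSob hs x g = 𝓕⁻ (g : E3 → C3) x := rfl

theorem realField_eq_evalSob {s : ℝ} (hs : 3 / 2 < s) (g : Lp C3 2 (sobolevMeasure s)) (x : E3) :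
    realField g x = reC3 (evalSob hs x g) := rfl

/-- The axisymmetric swirl-free odd real fields in `H^s` for which `f_θ` vanishes outside of `K`,
as a space of Fourier transforms. -/
noncomputable def ringSpace {s : ℝ} (hs : 3 / 2 < s) (K : Set (ℝ × ℝ)) :
    Submodule ℝ (Lp C3 2 (sobolevMeasure s)) where
  carrier := {g | (∀ x, toC3 (reC3 (evalSob hs x g)) = evalSob hs x g) ∧
    IsAxial (fun x => reC3 (evalSob hs x g)) ∧
    ∀ r z : ℝ, 0 ≤ r → (r, z) ∉ K → omegaTheta (fun x => reC3 (evalSob hs x g)) r z = 0}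
  add_mem' {g h} hg hh := by
    refine ⟨fun x => ?_, fun a b ε δ h1 h2 h3 x => ?_, fun r z hr hK => ?_⟩
    · rw [map_add, map_add, map_add, hg.1, hh.1]
    · have e1 := hg.2.1 h1 h2 h3 x
      have e2 := hh.2.1 h1 h2 h3 x
      dsimp only at e1 e2 ⊢
      rw [map_add, map_add, e1, e2, map_add, map_add, map_add, smul_add]
    · have e1 := hg.2.2 r z hr hK
      have e2 := hh.2.2 r z hr hK
      rw [omegaTheta] at e1 e2 ⊢
      rw [map_add, map_add, PiLp.add_apply, e1, e2, add_zero]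
  zero_mem' := by
    refine ⟨fun x => by simp, fun a b ε δ h1 h2 h3 x => by simp, fun r z hr hK => ?_⟩
    simp [omegaTheta]
  smul_mem' c g hg := by
    refine ⟨fun x => ?_, fun a b ε δ h1 h2 h3 x => ?_, fun r z hr hK => ?_⟩
    · rw [map_smul, map_smul, map_smul, hg.1]
    · have e1 := hg.2.1 h1 h2 h3 x
      dsimp only at e1 ⊢
      rw [map_smul, map_smul, e1, map_smul, map_smul, map_smul, smul_comm]
    · have e1 := hg.2.2 r z hr hK
      rw [omegaTheta] at e1 ⊢
      rw [map_smul, map_smul, PiLp.smul_apply, e1, smul_zero]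

theorem isClosed_ringSpace {s : ℝ} (hs : 3 / 2 < s) (K : Set (ℝ × ℝ)) :
    IsClosed (ringSpace hs K : Set (Lp C3 2 (sobolevMeasure s))) := by
  change IsClosed {g : Lp C3 2 (sobolevMeasure s) | _ ∧ _ ∧ _}
  simp only [IsAxial, ofPred_and, ofPred_forall, omegaTheta]
  refine IsClosed.inter ?_ (IsClosed.inter ?_ ?_)
  · refine isClosed_iInter fun x => ?_
    exact isClosed_eq (f := fun g => toC3 (reC3 (evalSob hs x g)))
      (g := fun g => evalSob hs x g) (by fun_prop) (by fun_prop)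
  · refine isClosed_iInter fun a => isClosed_iInter fun b => isClosed_iInter fun ε =>
      isClosed_iInter fun δ => isClosed_iInter fun h1 => isClosed_iInter fun h2 =>
      isClosed_iInter fun h3 => isClosed_iInter fun x => ?_
    have hc : Continuous fun g => axialMap h1 h2 h3 (reC3 (evalSob hs x g)) :=
      (axialMap h1 h2 h3).continuous.comp (reC3.continuous.comp (evalSob hs x).continuous)
    exact isClosed_eq
      (f := fun g => reC3 (evalSob hs (axialMap h1 h2 h3 x) g))
      (g := fun g => (ε * δ) • axialMap h1 h2 h3 (reC3 (evalSob hs x g))) (by fun_prop)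
      (hc.const_smul (ε * δ))
  · refine isClosed_iInter fun r => isClosed_iInter fun z => isClosed_iInter fun _ =>
      isClosed_iInter fun _ => ?_
    exact isClosed_eq (f := fun g => reC3 (evalSob hs !₂[r, 0, z] g) 1) (g := fun _ => 0)
      (by fun_prop) continuous_const

section

variable {s : ℝ} (hs : 3 / 2 < s) {K : Set (ℝ × ℝ)}

theorem memHs_of_mem (g : ringSpace hs K) : MemHs s (realField g.1) :=
  (memHs_realField hs (Lp.memLp g.1)).1

theorem isAxial_of_mem (g : ringSpace hs K) : IsAxial (realField g.1) := g.2.2.1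

theorem omegaTheta_of_mem (g : ringSpace hs K) {r z : ℝ} (hr : 0 ≤ r) (h : (r, z) ∉ K) :
    omegaTheta (realField g.1) r z = 0 := g.2.2.2 r z hr h

theorem toSob_realField (g : ringSpace hs K) : toSob s (realField g.1) = g.1 := by
  rw [Lp.ext_iff]
  refine (toSob_coe_ae (memHs_of_mem hs g)).trans
    ((sobolevMeasure_absolutelyContinuous s).ae_eq
      (hat_ae_eq_of_complexify_eq hs (Lp.memLp g.1) (funext fun x => g.2.1 x)))

theorem hsNorm_realField (g : ringSpace hs K) : hsNorm s (realField g.1) = ‖g‖ₑ := by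
  rw [← enorm_toSob (memHs_of_mem hs g), toSob_realField]
  rfl

theorem toSob_mem {f : E3 → E3} (hf : MemHs s f) (hax : IsAxial f)
    (hK : ∀ r z : ℝ, 0 ≤ r → (r, z) ∉ K → omegaTheta f r z = 0) : toSob s f ∈ ringSpace hs K := by
  have h1 : ∀ x, reC3 (evalSob hs x (toSob s f)) = f x := fun x => by
    rw [← realField_eq_evalSob, realField_toSob hs hf]
  have h2 : (fun x => reC3 (evalSob hs x (toSob s f))) = f := funext h1
  refine ⟨fun x => ?_, ?_, ?_⟩
  · rw [h1, ← complexify_apply, hf.complexify_eq hs, evalSob_apply,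
      Real.fourierInv_congr_ae (toSob_coe_ae_volume (by linarith) hf)]
  · rw [h2]; exact hax
  · rw [h2]; exact hK

theorem hasCompactSupport_of_mem (hK : IsCompact K) (g : ringSpace hs K) :
    HasCompactSupport (realField g.1) :=
  hasCompactSupport_of_omegaTheta (isAxial_of_mem hs g).eq_omegaTheta hK
    fun _ _ hr h => omegaTheta_of_mem hs g hr h

/-- The pointwise bound for the rate of change of `ω_θ`, which keeps its zeros and its sign. -/
theorem abs_omegaTheta_stretching_le (hs : 3 / 2 < s) {f : E3 → E3} (hf : MemHs s f)
    (hcs : HasCompactSupport f) (hax : IsAxial f) {r : ℝ} (hr : 0 ≤ r) (z : ℝ) :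
    |omegaTheta (stretching f) r z| ≤
      (gradConst s).toReal * (hsNorm s f).toReal * |omegaTheta f r z| := by
  have h := enorm_stretching_le hs hf !₂[r, 0, z]
  have h2 := ENNReal.toReal_mono (ENNReal.mul_ne_top (ENNReal.mul_ne_top (gradConst_lt_top hs).ne
        hf.2.ne) enorm_ne_top) h
  rwa [ENNReal.toReal_mul, ENNReal.toReal_mul, toReal_enorm, toReal_enorm,
    hax.norm_meridian hr, (hax.stretching hs hf hcs).norm_meridian hr] at h2

/-- The stretching term maps the state space to itself. -/
theorem stretching_mem (hK : IsCompact K) (g : ringSpace hs K) :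
    toSob s (stretching (realField g.1)) ∈ ringSpace hs K := by
  have hf := memHs_of_mem hs g
  have hcs := hasCompactSupport_of_mem hs hK g
  refine toSob_mem hs (hf.stretching hs) ((isAxial_of_mem hs g).stretching hs hf hcs)
    fun r z hr h => ?_
  have h1 := abs_omegaTheta_stretching_le hs hf hcs (isAxial_of_mem hs g) hr z
  rw [omegaTheta_of_mem hs g hr h, abs_zero, mul_zero] at h1
  exact abs_eq_zero.1 (le_antisymm h1 (abs_nonneg _))

/-- The vortex stretching term as a vector field on the state space. -/
noncomputable def stretchField (hK : IsCompact K) (g : ringSpace hs K) : ringSpace hs K :=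
  ⟨toSob s (stretching (realField g.1)), stretching_mem hs hK g⟩

theorem realField_stretchField (hK : IsCompact K) (g : ringSpace hs K) :
    realField (stretchField hs hK g).1 = stretching (realField g.1) :=
  realField_toSob hs ((memHs_of_mem hs g).stretching hs)

theorem norm_toSob_stretching_sub_le (hs : 3 / 2 < s) {f g : E3 → E3} (hf : MemHs s f)
    (hg : MemHs s g) :
    ‖toSob s (stretching f) - toSob s (stretching g)‖ ≤
      (stretchConst s).toReal * ((‖toSob s f‖ + ‖toSob s g‖) * ‖toSob s f - toSob s g‖) := by
  have h := hsNorm_stretching_sub_le hs hf hg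
  rw [← enorm_toSob ((hf.stretching hs).sub (hg.stretching hs)),
    toSob_sub (hf.stretching hs) (hg.stretching hs), ← enorm_toSob hf, ← enorm_toSob hg,
    ← enorm_toSob (hf.sub hg), toSob_sub hf hg] at h
  have h2 := ENNReal.toReal_mono (ENNReal.mul_ne_top (stretchConst_lt_top hs).ne
    (ENNReal.mul_ne_top (ENNReal.add_ne_top.2 ⟨enorm_ne_top, enorm_ne_top⟩) enorm_ne_top)) h
  rwa [ENNReal.toReal_mul, ENNReal.toReal_mul, ENNReal.toReal_add enorm_ne_top enorm_ne_top,
    toReal_enorm, toReal_enorm, toReal_enorm, toReal_enorm] at h2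

theorem lipschitzOnWith_stretchField (hK : IsCompact K) (R : ℝ) :
    ∃ C, LipschitzOnWith C (stretchField hs hK) (Metric.closedBall 0 R) := by
  refine ⟨⟨(stretchConst s).toReal * (2 * |R|), by positivity⟩,
    LipschitzOnWith.of_dist_le_mul fun a ha b hb => ?_⟩
  have h := norm_toSob_stretching_sub_le hs (memHs_of_mem hs a) (memHs_of_mem hs b)
  rw [toSob_realField, toSob_realField] at h
  rw [dist_eq_norm, dist_eq_norm]
  rw [mem_closedBall_zero_iff] at ha hb
  refine (show ‖stretchField hs hK a - stretchField hs hK b‖ ≤ _ from h).trans ?_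
  have h1 : ‖a.1‖ + ‖b.1‖ ≤ 2 * |R| := by
    have ha' : ‖a.1‖ ≤ R := ha
    have hb' : ‖b.1‖ ≤ R := hb
    linarith [le_abs_self R]
  change _ ≤ (stretchConst s).toReal * (2 * |R|) * ‖a.1 - b.1‖
  rw [mul_assoc]
  gcongr

end

/-! ### Uniqueness of solutions -/

/-- Divergence free and gradient fields are pointwise orthogonal on the Fourier side. -/
theorem norm_le_norm_add_of_orthogonal {ξ : E3} (hξ : ξ ≠ 0) {a b : C3}
    (ha : ∑ i, toComplex ξ i * a i = 0) (hb : crossProduct (toComplex ξ) b.ofLp = 0) :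
    ‖a‖ ≤ ‖a + b‖ := by
  have h0 := congrFun hb 0
  have h1 := congrFun hb 1
  have h2 := congrFun hb 2
  simp [cross_apply, toComplex] at h0 h1 h2
  have hc := congrArg (starRingEnd ℂ) ha
  simp [Fin.sum_univ_three, toComplex] at hc
  have hn : ((ξ 0 : ℂ) ^ 2 + (ξ 1 : ℂ) ^ 2 + (ξ 2 : ℂ) ^ 2) ≠ 0 := by
    have : ‖ξ‖ ^ 2 ≠ 0 := pow_ne_zero 2 (norm_ne_zero_iff.2 hξ)
    rw [EuclideanSpace.norm_sq_eq, Fin.sum_univ_three] at this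
    simp only [Real.norm_eq_abs, sq_abs] at this
    exact_mod_cast this
  have hin : inner ℂ a b = 0 := by
    refine (mul_eq_zero.1 (?_ : ((ξ 0 : ℂ) ^ 2 + (ξ 1 : ℂ) ^ 2 + (ξ 2 : ℂ) ^ 2) * _ = 0)).resolve_left
      hn
    simp only [PiLp.inner_apply, Fin.sum_univ_three, RCLike.inner_apply]
    linear_combination ((ξ 0 : ℂ) * b 0 + (ξ 1 : ℂ) * b 1 + (ξ 2 : ℂ) * b 2) * hc +
      (ξ 1 * (starRingEnd ℂ) (a 2) - ξ 2 * (starRingEnd ℂ) (a 1)) * h0 +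
      (ξ 2 * (starRingEnd ℂ) (a 0) - ξ 0 * (starRingEnd ℂ) (a 2)) * h1 +
      (ξ 0 * (starRingEnd ℂ) (a 1) - ξ 1 * (starRingEnd ℂ) (a 0)) * h2
  have h := norm_add_sq_eq_norm_sq_add_norm_sq_of_inner_eq_zero (𝕜 := ℂ) a b hin
  nlinarith [norm_nonneg a, norm_nonneg b, norm_nonneg (a + b)]

theorem MemHsDf.sub {s : ℝ} {f g : E3 → E3} (hf : MemHsDf s f) (hg : MemHsDf s g) :
    MemHsDf s (f - g) := by
  refine ⟨hf.1.sub hg.1, ?_⟩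
  filter_upwards [hat_sub hf.1.memLp_complexify hg.1.memLp_complexify, hf.2, hg.2] with ξ h1 h2 h3
  simp only [h1, Pi.sub_apply, PiLp.sub_apply, mul_sub, Finset.sum_sub_distrib, h2, h3, sub_zero]

theorem MemHsGr.sub {s : ℝ} {f g : E3 → E3} (hf : MemHsGr s f) (hg : MemHsGr s g) :
    MemHsGr s (f - g) := by
  refine ⟨hf.1.sub hg.1, ?_⟩
  filter_upwards [hat_sub hf.1.memLp_complexify hg.1.memLp_complexify, hf.2, hg.2] with ξ h1 h2 h3
  rw [h1, Pi.sub_apply, WithLp.ofLp_sub, map_sub, h2, h3, sub_zero]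

theorem memHsGr_sub_self {s : ℝ} {f : E3 → E3} (hf : MemHs s f) : MemHsGr s (f - f) := by
  refine ⟨hf.sub hf, ?_⟩
  filter_upwards [hat_sub hf.memLp_complexify hf.memLp_complexify] with ξ h1
  rw [h1, sub_self, Pi.zero_apply, WithLp.ofLp_zero, map_zero]

/-- The Helmholtz projection is a contraction in `H^s`. -/
theorem IsHelmholtzProj.norm_toSob_sub_le {s : ℝ} {v₁ v₂ w₁ w₂ : E3 → E3}
    (h₁ : IsHelmholtzProj s v₁ w₁) (h₂ : IsHelmholtzProj s v₂ w₂) :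
    ‖toSob s w₁ - toSob s w₂‖ ≤ ‖toSob s v₁ - toSob s v₂‖ := by
  have hw := h₁.2.1.sub h₂.2.1
  have hg := h₁.2.2.sub h₂.2.2
  have he : toSob s v₁ - toSob s v₂ =
      toSob s (w₁ - w₂) + toSob s ((v₁ - w₁) - (v₂ - w₂)) := by
    rw [toSob_sub h₁.2.1.1 h₂.2.1.1, toSob_sub h₁.2.2.1 h₂.2.2.1, toSob_sub h₁.1 h₁.2.1.1,
      toSob_sub h₂.1 h₂.2.1.1]
    abel
  rw [he, ← toSob_sub h₁.2.1.1 h₂.2.1.1]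
  refine Lp.norm_le_norm_of_ae_le ?_
  have hac := (sobolevMeasure_absolutelyContinuous s).ae_le
  filter_upwards [Lp.coeFn_add (toSob s (w₁ - w₂)) (toSob s ((v₁ - w₁) - (v₂ - w₂))),
    toSob_coe_ae hw.1, toSob_coe_ae hg.1, hac hw.2, hac hg.2, hac (Measure.ae_ne volume (0 : E3))]
    with ξ h1 h2 h3 h4 h5 h6
  rw [h1, Pi.add_apply, h2, h3]
  exact norm_le_norm_add_of_orthogonal h6 h4 h5

/-- The time derivative in `H^s` of a solution, in terms of its Fourier transform. -/
theorem hasDerivWithinAt_toSob {s T t : ℝ} {v : ℝ → E3 → E3} {v' : E3 → E3}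
    (hv : ∀ t ∈ Ico 0 T, MemHs s (v t)) (hv' : MemHs s v') (ht : t ∈ Ico 0 T)
    (h : Tendsto (fun τ => hsNorm s ((τ - t)⁻¹ • (v τ - v t) - v'))
      (𝓝[Ico 0 T \ {t}] t) (𝓝 0)) :
    HasDerivWithinAt (fun τ => toSob s (v τ)) (toSob s v') (Ico 0 T) t := by
  rw [hasDerivWithinAt_iff_tendsto_slope, tendsto_iff_edist_tendsto_0]
  refine h.congr' ?_
  filter_upwards [self_mem_nhdsWithin] with τ hτ
  have h1 := (hv τ hτ.1).sub (hv t ht)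
  rw [slope_def_module, edist_eq_enorm_sub, ← toSob_sub (hv τ hτ.1) (hv t ht), ← toSob_smul _ h1,
    ← toSob_sub (h1.const_smul _) hv', enorm_toSob ((h1.const_smul _).sub hv')]

theorem IsSolution.exists_hasDerivWithinAt {s T : ℝ} {ω₀ : E3 → E3} {v : ℝ → E3 → E3}
    (h : IsSolution s ω₀ T v) : ∃ v' : ℝ → E3 → E3,
      (∀ t ∈ Ico 0 T, IsHelmholtzProj s (stretching (v t)) (v' t)) ∧
      ∀ t ∈ Ico 0 T, HasDerivWithinAt (fun τ => toSob s (v τ)) (toSob s (v' t)) (Ico 0 T) t := by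
  obtain ⟨-, -, hdf, v', h1, h2, -⟩ := h
  exact ⟨v', h1, fun t ht =>
    hasDerivWithinAt_toSob (fun t ht => (hdf t ht).1) (h1 t ht).2.1.1 ht (h2 t ht)⟩

/-- Two solutions with the same initial data agree as long as both exist, by Gronwall's
inequality. -/
theorem IsSolution.eq {s : ℝ} (hs : 3 / 2 < s) {ω₀ : E3 → E3} {T₁ T₂ : ℝ} {v₁ v₂ : ℝ → E3 → E3}
    (h₁ : IsSolution s ω₀ T₁ v₁) (h₂ : IsSolution s ω₀ T₂ v₂) {t : ℝ} (ht₁ : t ∈ Ico 0 T₁)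
    (ht₂ : t ∈ Ico 0 T₂) : v₁ t = v₂ t := by
  obtain ⟨v₁', hp₁, hd₁⟩ := h₁.exists_hasDerivWithinAt
  obtain ⟨v₂', hp₂, hd₂⟩ := h₂.exists_hasDerivWithinAt
  have hm₁ := fun u hu => (h₁.2.2.1 u hu).1
  have hm₂ := fun u hu => (h₂.2.2.1 u hu).1
  set a : ℝ → Lp C3 2 (sobolevMeasure s) := fun τ => toSob s (v₁ τ)
  set b : ℝ → Lp C3 2 (sobolevMeasure s) := fun τ => toSob s (v₂ τ)
  have hsub₁ : Icc 0 t ⊆ Ico 0 T₁ := fun u hu => ⟨hu.1, hu.2.trans_lt ht₁.2⟩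
  have hsub₂ : Icc 0 t ⊆ Ico 0 T₂ := fun u hu => ⟨hu.1, hu.2.trans_lt ht₂.2⟩
  have hca : ContinuousOn a (Icc 0 t) := fun u hu =>
    (hd₁ u (hsub₁ hu)).continuousWithinAt.mono hsub₁
  have hcb : ContinuousOn b (Icc 0 t) := fun u hu =>
    (hd₂ u (hsub₂ hu)).continuousWithinAt.mono hsub₂
  obtain ⟨A, hA⟩ := isCompact_Icc.exists_bound_of_continuousOn hca
  obtain ⟨B, hB⟩ := isCompact_Icc.exists_bound_of_continuousOn hcb
  have hder : ∀ u ∈ Ico 0 t, HasDerivWithinAt (fun τ => a τ - b τ)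
      (toSob s (v₁' u) - toSob s (v₂' u)) (Ici u) u := by
    intro u hu
    have hmem : ∀ T, t < T → Ico 0 T ∈ 𝓝[≥] u := fun T hT => by
      filter_upwards [Ico_mem_nhdsGE (hu.2.trans hT)] with x hx
      exact ⟨hu.1.trans hx.1, hx.2⟩
    exact ((hd₁ u (hsub₁ (Ico_subset_Icc_self hu))).mono_of_mem_nhdsWithin (hmem _ ht₁.2)).sub
      ((hd₂ u (hsub₂ (Ico_subset_Icc_self hu))).mono_of_mem_nhdsWithin (hmem _ ht₂.2))
  have hz := eq_zero_of_abs_deriv_le_mul_abs_self_of_eq_zero_right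
    (K := (stretchConst s).toReal * (A + B)) (hca.sub hcb) hder
    (by simp [a, b, h₁.2.1, h₂.2.1]) (fun u hu => ?_) t (right_mem_Icc.2 ht₁.1)
  · have h3 : toSob s (v₁ t - v₂ t) = 0 := by
      rw [toSob_sub (hm₁ t ht₁) (hm₂ t ht₂)]
      exact hz
    have hm := (hm₁ t ht₁).sub (hm₂ t ht₂)
    have h4 := realField_toSob hs hm
    ext1 x
    have h5 := hm.enorm_apply_le hs x
    rw [← enorm_toSob hm, h3, enorm_zero, mul_zero] at h5
    exact sub_eq_zero.1 (enorm_eq_zero.1 (le_antisymm h5 zero_le))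
  · have hu' := Ico_subset_Icc_self hu
    refine ((hp₁ u (hsub₁ hu')).norm_toSob_sub_le (hp₂ u (hsub₂ hu'))).trans
      ((norm_toSob_stretching_sub_le hs (hm₁ u (hsub₁ hu')) (hm₂ u (hsub₂ hu'))).trans ?_)
    rw [mul_assoc]
    have h3 := hA u hu'
    have h4 := hB u hu'
    change _ * ((‖a u‖ + ‖b u‖) * ‖a u - b u‖) ≤ _ * (_ * ‖a u - b u‖)
    gcongr

/-! ### Scalar differential inequalities -/

/-- A function with `|y'| ≤ M |y|` keeps its zeros, backward and forward in time. -/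
theorem eq_zero_of_abs_deriv_le {y y' : ℝ → ℝ} {t M : ℝ}
    (hy : ∀ u ∈ Icc 0 t, HasDerivWithinAt y (y' u) (Ici 0) u)
    (hb : ∀ u ∈ Icc 0 t, |y' u| ≤ M * |y u|) {c : ℝ} (hc : c ∈ Icc 0 t) (hyc : y c = 0) :
    y 0 = 0 ∧ y t = 0 := by
  have hcont : ContinuousOn y (Icc 0 t) := fun u hu =>
    (hy u hu).continuousWithinAt.mono Icc_subset_Ici_self
  constructor
  · -- time reversal
    have h := eq_zero_of_abs_deriv_le_mul_abs_self_of_eq_zero_right (f := fun u => y (c - u))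
      (f' := fun u => -y' (c - u)) (K := M) (a := 0) (b := c) ?_ ?_ (by simpa using hyc) ?_ c
      (right_mem_Icc.2 hc.1)
    · simpa using h
    · exact hcont.comp (by fun_prop) fun u hu => ⟨by linarith [hu.2], by linarith [hu.1, hc.2]⟩
    · intro u hu
      have hpos : 0 < c - u := by linarith [hu.2]
      have h1 := (hy (c - u) ⟨hpos.le, by linarith [hu.1, hc.2]⟩).hasDerivAt (Ici_mem_nhds hpos)
      have h2 := h1.comp u ((hasDerivAt_id u).const_sub c)
      exact (h2.congr_deriv (by simp)).hasDerivWithinAt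
    · intro u hu
      simpa using hb (c - u) ⟨by linarith [hu.2], by linarith [hu.1, hc.2]⟩
  · exact eq_zero_of_abs_deriv_le_mul_abs_self_of_eq_zero_right (K := M)
      (hcont.mono (Icc_subset_Icc_left hc.1))
      (fun u hu => (hy u ⟨hc.1.trans hu.1, hu.2.le⟩).mono (Ici_subset_Ici.2 (hc.1.trans hu.1)))
      hyc (fun u hu => hb u ⟨hc.1.trans hu.1, hu.2.le⟩) t (right_mem_Icc.2 hc.2)

theorem nonpos_of_abs_deriv_le {y y' : ℝ → ℝ} {t M : ℝ} (ht : 0 ≤ t)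
    (hy : ∀ u ∈ Icc 0 t, HasDerivWithinAt y (y' u) (Ici 0) u)
    (hb : ∀ u ∈ Icc 0 t, |y' u| ≤ M * |y u|) (h0 : y 0 ≤ 0) : y t ≤ 0 := by
  by_contra! hpos
  have hcont : ContinuousOn y (Icc 0 t) := fun u hu =>
    (hy u hu).continuousWithinAt.mono Icc_subset_Ici_self
  -- a change of sign needs a zero, and zeros persist
  obtain ⟨c, hc, hyc⟩ := intermediate_value_Icc ht hcont ⟨h0, hpos.le⟩
  exact hpos.ne' (eq_zero_of_abs_deriv_le hy hb hc hyc).2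

/-- A positive solution of the Riccati inequality `q' ≥ κ q²` lives at most until `1 / (κ q 0)`. -/
theorem le_one_div_of_riccati {q q' : ℝ → ℝ} {T κ : ℝ} (hT : 0 < T) (hκ : 0 < κ) (h0 : 0 < q 0)
    (hq : ∀ t ∈ Ico 0 T, HasDerivWithinAt q (q' t) (Ici 0) t)
    (hge : ∀ t ∈ Ico 0 T, κ * q t ^ 2 ≤ q' t) : T ≤ 1 / (κ * q 0) := by
  have hcont : ContinuousOn q (Ico 0 T) := fun u hu =>
    (hq u hu).continuousWithinAt.mono fun x hx => hx.1
  have hder : ∀ t ∈ interior (Ico 0 T), HasDerivAt q (q' t) t := fun t ht => by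
    rw [interior_Ico] at ht
    exact (hq t ⟨ht.1.le, ht.2⟩).hasDerivAt (Ici_mem_nhds ht.1)
  have hsub : interior (Ico 0 T) ⊆ Ico 0 T := interior_subset
  have hmem0 : (0 : ℝ) ∈ Ico 0 T := ⟨le_rfl, hT⟩
  have hmono : MonotoneOn q (Ico 0 T) := by
    refine monotoneOn_of_deriv_nonneg (convex_Ico 0 T) hcont
      (fun t ht => (hder t ht).differentiableAt.differentiableWithinAt) fun t ht => ?_
    rw [(hder t ht).deriv]
    exact le_trans (by positivity) (hge t (hsub ht))
  have hpos : ∀ t ∈ Ico 0 T, 0 < q t := fun t ht => h0.trans_le (hmono hmem0 ht ht.1)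
  -- `-1/q - κ t` is increasing, and `-1/q` is negative
  have hmono2 : MonotoneOn (fun t => -(q t)⁻¹ - κ * t) (Ico 0 T) := by
    have hd2 : ∀ t ∈ interior (Ico 0 T),
        HasDerivAt (fun t => -(q t)⁻¹ - κ * t) (q' t / q t ^ 2 - κ) t := fun t ht => by
      have h1 := (((hder t ht).inv (hpos t (hsub ht)).ne').neg).sub ((hasDerivAt_id t).const_mul κ)
      refine h1.congr_deriv ?_
      rw [mul_one]
      ring
    refine monotoneOn_of_deriv_nonneg (convex_Ico 0 T)
      (((hcont.inv₀ fun t ht => (hpos t ht).ne').neg).sub (by fun_prop))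
      (fun t ht => (hd2 t ht).differentiableAt.differentiableWithinAt) fun t ht => ?_
    rw [(hd2 t ht).deriv, sub_nonneg, le_div_iff₀ (pow_pos (hpos t (hsub ht)) 2)]
    exact hge t (hsub ht)
  refine le_of_forall_lt fun t ht => ?_
  have hb : 0 < 1 / (κ * q 0) := by positivity
  rcases lt_or_ge t 0 with h | h
  · linarith
  have hmem : t ∈ Ico 0 T := ⟨h, ht⟩
  have h1 := hmono2 hmem0 hmem h
  have h2 : 0 < (q t)⁻¹ := inv_pos.2 (hpos t hmem)
  simp only [mul_zero, sub_zero] at h1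
  have h3 : κ * t < (q 0)⁻¹ := by linarith
  rw [lt_div_iff₀ (by positivity)]
  calc t * (κ * q 0) = κ * t * q 0 := by ring
    _ < (q 0)⁻¹ * q 0 := by gcongr
    _ = 1 := inv_mul_cancel₀ h0.ne'

/-! ### The dynamics of colliding vortex rings -/

/-- The integral of the angular component over a bounded part of the upper half space, as a
functional on `H^s`. -/
noncomputable def impulse {s : ℝ} (hs : 3 / 2 < s) (R : ℝ) :
    Lp C3 2 (sobolevMeasure s) →L[ℝ] ℝ :=
  have hint : ∀ g : Lp C3 2 (sobolevMeasure s),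
      IntegrableOn (angular (realField g)) (upperHalf ∩ Metric.closedBall 0 R) := fun g =>
    ((continuous_angular (memHs_realField hs (Lp.memLp g)).1.1).continuousOn.integrableOn_compact
      (isCompact_closedBall _ _)).mono_set inter_subset_right
  LinearMap.mkContinuous
    { toFun := fun g => ∫ x in upperHalf ∩ Metric.closedBall 0 R, angular (realField g) x
      map_add' := fun g h => by
        rw [← integral_add (hint g) (hint h)]
        refine integral_congr_ae (Eventually.of_forall fun x => ?_)
        simp only [angular, realField_eq_evalSob hs, map_add, PiLp.add_apply]
        ring
      map_smul' := fun c g => by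
        rw [RingHom.id_apply, ← integral_smul]
        refine integral_congr_ae (Eventually.of_forall fun x => ?_)
        simp only [angular, realField_eq_evalSob hs, map_smul, PiLp.smul_apply, smul_eq_mul]
        ring }
    (2 * |R| * (sobolevConst s).toReal *
      volume.real (upperHalf ∩ Metric.closedBall (0 : E3) R)) fun g => by
      have hfin : volume (upperHalf ∩ Metric.closedBall (0 : E3) R) < ⊤ :=
        (measure_mono inter_subset_right).trans_lt measure_closedBall_lt_top
      have hb : ∀ x ∈ upperHalf ∩ Metric.closedBall (0 : E3) R, ‖angular (realField g) x‖ ≤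
          2 * |R| * (sobolevConst s).toReal * ‖g‖ := fun x hx => by
        have h1 : ‖realField g x‖ ≤ (sobolevConst s).toReal * ‖g‖ := by
          have hm := memHs_realField hs (Lp.memLp g)
          have h := (hm.1.enorm_apply_le hs x).trans (mul_le_mul_right hm.2.1 _)
          rw [← Lp.enorm_def] at h
          have h2 := ENNReal.toReal_mono (ENNReal.mul_ne_top (sobolevConst_lt_top hs).ne
            enorm_ne_top) h
          rwa [ENNReal.toReal_mul, toReal_enorm, toReal_enorm] at h2
        have h2 : ‖x‖ ≤ |R| := (mem_closedBall_zero_iff.1 hx.2).trans (le_abs_self R)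
        have h3 : ‖angular (realField g) x‖ ≤ ‖x‖ * ‖realField g x‖ + ‖x‖ * ‖realField g x‖ := by
          refine (norm_sub_le _ _).trans ?_
          rw [norm_mul, norm_mul]
          gcongr <;> exact PiLp.norm_apply_le _ _
        calc _ ≤ _ := h3
          _ = 2 * ‖x‖ * ‖realField g x‖ := by ring
          _ ≤ 2 * |R| * ((sobolevConst s).toReal * ‖g‖) := by gcongr
          _ = _ := by ring
      refine (norm_setIntegral_le_of_norm_le_const hfin hb).trans (le_of_eq ?_)
      ring

/-- On a state space, whose fields are supported in a fixed ball, `Q` is a continuous linear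
functional, up to a constant factor. -/
theorem exists_impulse_eq {s : ℝ} (hs : 3 / 2 < s) {K : Set (ℝ × ℝ)} (hK : IsCompact K) :
    ∃ R, ∀ g : ringSpace hs K, impulse hs R g.1 = -(2 * Real.pi) * Q (realField g.1) := by
  obtain ⟨R, hR⟩ := hK.isBounded.exists_norm_le
  -- `r ≤ R` and `|z| ≤ R` give `|x| ≤ 2R`
  refine ⟨2 * R, fun g => ?_⟩
  rw [← (isAxial_of_mem hs g).setIntegral_angular (memHs_of_mem hs g).1
    (hasCompactSupport_of_mem hs hK g)]
  refine (setIntegral_eq_of_subset_of_forall_sdiff_eq_zero measurableSet_upperHalf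
    inter_subset_left fun x hx => ?_).symm
  rw [(isAxial_of_mem hs g).angular_eq]
  suffices h : (radius x, x 2) ∉ K by
    rw [omegaTheta_of_mem hs g (radius_nonneg x) h, mul_zero]
  intro hmem
  refine hx.2 ⟨hx.1, mem_closedBall_zero_iff.2 ?_⟩
  have h := hR _ hmem
  rw [Prod.norm_def, max_le_iff, Real.norm_eq_abs, Real.norm_eq_abs] at h
  have hR0 : 0 ≤ R := (abs_nonneg _).trans h.1
  have h1 := sq_le_sq' (by linarith [abs_nonneg (radius x)]) h.1
  have h2 := sq_le_sq' (by linarith [abs_nonneg (x 2)]) h.2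
  rw [sq_abs] at h1 h2
  have := norm_sq_eq x
  exact abs_le_of_sq_le_sq' (by nlinarith) (by linarith) |>.2

section

variable {s : ℝ} {ω₀ : E3 → E3}

theorem IsCollidingRings.isAxial (hω₀ : IsCollidingRings s ω₀) : IsAxial ω₀ :=
  isAxial_of_eq hω₀.memHsStar.2 hω₀.odd

theorem omegaTheta_eq_zero_of_notMem (ω : E3 → E3) {r z : ℝ} (hr : 0 ≤ r)
    (h : (r, z) ∉ vortSupport ω) : omegaTheta ω r z = 0 := by
  by_contra hne
  exact h (subset_closure ⟨hr, hne⟩)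

theorem IsCollidingRings.pos_of_mem (hω₀ : IsCollidingRings s ω₀) (p : ℝ × ℝ)
    (hp : p ∈ upperSupport ω₀) :
    0 < p.1 ∧ 0 < p.2 :=
  ⟨lt_of_le_of_ne hp.2.1 (hω₀.support_away p hp.1).1.symm,
    lt_of_le_of_ne hp.2.2 (hω₀.support_away p hp.1).2.symm⟩

theorem IsCollidingRings.isCompact_upperSupport (hω₀ : IsCollidingRings s ω₀) :
    IsCompact (upperSupport ω₀) :=
  hω₀.isCompact_support.inter_right
    ((isClosed_le continuous_const continuous_fst).inter
      (isClosed_le continuous_const continuous_snd))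

theorem IsCollidingRings.exists_neg (hω₀ : IsCollidingRings s ω₀) :
    ∃ r z : ℝ, 0 < r ∧ 0 < z ∧ omegaTheta ω₀ r z < 0 := by
  obtain ⟨x, hx⟩ := Function.ne_iff.1 hω₀.ne_zero
  have h1 : omegaTheta ω₀ (radius x) (x 2) ≠ 0 := fun h => hx (by
    rw [hω₀.memHsStar.2 x, h, zero_smul]; rfl)
  have hr := radius_nonneg x
  obtain ⟨hr0, hz0⟩ := hω₀.support_away (radius x, x 2) (subset_closure ⟨hr, h1⟩)
  have hr' : 0 < radius x := lt_of_le_of_ne hr (Ne.symm hr0)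
  rcases lt_or_gt_of_ne hz0 with h | h
  · have h2 := hω₀.odd (radius x) (x 2) hr
    have h' : 0 < -x 2 := by simpa using h
    exact ⟨radius x, -x 2, hr', h', lt_of_le_of_ne (hω₀.nonpos _ _ hr h'.le)
      (by rw [h2]; simpa using h1)⟩
  · exact ⟨radius x, x 2, hr', h, lt_of_le_of_ne (hω₀.nonpos _ _ hr (le_of_lt h)) h1⟩

theorem IsCollidingRings.upperSupport_nonempty (hω₀ : IsCollidingRings s ω₀) :
    (upperSupport ω₀).Nonempty := by
  obtain ⟨r, z, hr, hz, h⟩ := hω₀.exists_neg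
  exact ⟨(r, z), subset_closure ⟨hr.le, h.ne⟩, hr.le, hz.le⟩

theorem IsCollidingRings.hasCompactSupport (hω₀ : IsCollidingRings s ω₀) : HasCompactSupport ω₀ :=
  hasCompactSupport_of_omegaTheta hω₀.memHsStar.2 hω₀.isCompact_support
    fun _ _ hr h => omegaTheta_eq_zero_of_notMem ω₀ hr h

theorem IsCollidingRings.Q_pos (hω₀ : IsCollidingRings s ω₀) : 0 < Q ω₀ := by
  have hc := hω₀.memHsStar.1.1.1
  have hcs := hω₀.hasCompactSupport
  have h := hω₀.isAxial.setIntegral_angular hc hcs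
  have hpos : 0 < ∫ x in upperHalf, -angular ω₀ x := by
    have hca := (continuous_angular hc).neg
    have hi : IntegrableOn (fun x => -angular ω₀ x) upperHalf :=
      ((continuous_angular hc).integrable_of_hasCompactSupport
        (HasCompactSupport.angular hcs)).neg.integrableOn
    refine (setIntegral_pos_iff_support_of_nonneg_ae ?_ hi).2 ?_
    · filter_upwards [ae_restrict_mem measurableSet_upperHalf] with x hx
      rw [hω₀.isAxial.angular_eq]
      have h1 := hω₀.nonpos (radius x) (x 2) (radius_nonneg x) (le_of_lt hx)
      have h2 := mul_nonneg_of_nonpos_of_nonpos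
        (neg_nonpos.2 (radius_nonneg x)) h1
      simpa using h2
    · obtain ⟨r, z, hr, hz, hneg⟩ := hω₀.exists_neg
      refine IsOpen.measure_pos _ ((hca.isOpen_support).inter
        (isOpen_lt continuous_const (by fun_prop))) ⟨!₂[r, 0, z], ?_, ?_⟩
      · simp only [Function.mem_support]
        rw [hω₀.isAxial.angular_eq, radius_meridian hr.le]
        exact neg_ne_zero.2 (mul_ne_zero hr.ne' hneg.ne)
      · exact hz
  rw [integral_neg, h] at hpos
  have hpi := Real.pi_pos
  by_contra! hcon
  nlinarith

end

section

variable {s : ℝ} (hs : 3 / 2 < s)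

/-- The initial vorticity as a point of the state space. -/
noncomputable def initialState {ω₀ : E3 → E3} (hω₀ : IsCollidingRings s ω₀) :
    ringSpace hs (vortSupport ω₀) :=
  ⟨toSob s ω₀, toSob_mem hs hω₀.memHsStar.1.1 hω₀.isAxial
    fun _ _ hr h => omegaTheta_eq_zero_of_notMem ω₀ hr h⟩

theorem toReal_hsNorm_realField {K : Set (ℝ × ℝ)} (g : ringSpace hs K) :
    (hsNorm s (realField g.1)).toReal = ‖g‖ := by
  rw [hsNorm_realField, toReal_enorm]

variable {ω₀ : E3 → E3} (hω₀ : IsCollidingRings s ω₀) {T : ℝ}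
  {γ : ℝ → ringSpace hs (vortSupport ω₀)}
  (hγ : IsFlowLine (stretchField hs hω₀.isCompact_support) (initialState hs hω₀) T γ)
include hγ

theorem IsFlowLine.realField_zero : realField (γ 0).1 = ω₀ := by
  rw [hγ.1]
  exact realField_toSob hs hω₀.memHsStar.1.1

theorem IsFlowLine.hasDerivWithinAt_clm {F : Type*} [NormedAddCommGroup F] [NormedSpace ℝ F]
    (l : Lp C3 2 (sobolevMeasure s) →L[ℝ] F) {t : ℝ} (ht : t ∈ Ico 0 T) :
    HasDerivWithinAt (fun t => l (γ t).1)
      (l (stretchField hs hω₀.isCompact_support (γ t)).1) (Ici 0) t :=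
  (l.comp (ringSpace hs (vortSupport ω₀)).subtypeL).hasFDerivAt.comp_hasDerivWithinAt t (hγ.2 t ht)

theorem IsFlowLine.hasDerivWithinAt_omegaTheta (r z : ℝ) {t : ℝ} (ht : t ∈ Ico 0 T) :
    HasDerivWithinAt (fun t => omegaTheta (realField (γ t).1) r z)
      (omegaTheta (stretching (realField (γ t).1)) r z) (Ici 0) t := by
  rw [← realField_stretchField hs hω₀.isCompact_support]
  exact hγ.hasDerivWithinAt_clm hs hω₀
    ((EuclideanSpace.proj (𝕜 := ℝ) (1 : Fin 3)).comp (reC3.comp (evalSob hs !₂[r, 0, z]))) ht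

/-- At each point of the half plane, `ω_θ` keeps its zeros and its sign. -/
theorem IsFlowLine.omegaTheta_preserved {r : ℝ} (hr : 0 ≤ r) (z : ℝ) {t : ℝ} (ht : t ∈ Ico 0 T) :
    (omegaTheta (realField (γ t).1) r z = 0 ↔ omegaTheta ω₀ r z = 0) ∧
    (omegaTheta ω₀ r z ≤ 0 → omegaTheta (realField (γ t).1) r z ≤ 0) := by
  have hsub : Icc 0 t ⊆ Ico 0 T := fun u hu => ⟨hu.1, hu.2.trans_lt ht.2⟩
  obtain ⟨B, hB⟩ := isCompact_Icc.exists_bound_of_continuousOn (hγ.continuousOn.mono hsub)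
  have hy := fun u (hu : u ∈ Icc 0 t) => hγ.hasDerivWithinAt_omegaTheta hs hω₀ r z (hsub hu)
  have hb : ∀ u ∈ Icc 0 t, |omegaTheta (stretching (realField (γ u).1)) r z| ≤
      (gradConst s).toReal * B * |omegaTheta (realField (γ u).1) r z| := fun u hu => by
    refine (abs_omegaTheta_stretching_le hs (memHs_of_mem hs _)
      (hasCompactSupport_of_mem hs hω₀.isCompact_support _) (isAxial_of_mem hs _) hr z).trans ?_
    rw [toReal_hsNorm_realField]
    have := hB u hu
    gcongr
  have h0 := hγ.realField_zero hs hω₀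
  refine ⟨⟨fun h => ?_, fun h => ?_⟩, fun h => ?_⟩
  · have := (eq_zero_of_abs_deriv_le hy hb (right_mem_Icc.2 ht.1) h).1
    rwa [h0] at this
  · rw [← h0] at h
    exact (eq_zero_of_abs_deriv_le hy hb (left_mem_Icc.2 ht.1) h).2
  · rw [← h0] at h
    exact nonpos_of_abs_deriv_le (y := fun u => omegaTheta (realField (γ u).1) r z) ht.1 hy hb h

/-- The zeros of `ω_θ` do not move, and so neither does its support. -/
theorem IsFlowLine.vortSupport_eq {t : ℝ} (ht : t ∈ Ico 0 T) :
    vortSupport (realField (γ t).1) = vortSupport ω₀ := by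
  unfold vortSupport
  congr 1
  ext ⟨r, z⟩
  exact and_congr_right fun hr => not_congr (hγ.omegaTheta_preserved hs hω₀ hr z ht).1

theorem IsFlowLine.isCollidingRings {t : ℝ} (ht : t ∈ Ico 0 T) :
    IsCollidingRings s (realField (γ t).1) where
  memHsStar := ⟨(isAxial_of_mem hs _).memHsDf (memHs_of_mem hs _)
    (hasCompactSupport_of_mem hs hω₀.isCompact_support _), (isAxial_of_mem hs _).eq_omegaTheta⟩
  ne_zero h := by
    obtain ⟨r, z, hr, -, hneg⟩ := hω₀.exists_neg
    refine hneg.ne ((hγ.omegaTheta_preserved hs hω₀ hr.le z ht).1.1 ?_)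
    rw [h]; rfl
  odd r z _ := (isAxial_of_mem hs _).omegaTheta_neg r z
  isCompact_support := by
    rw [hγ.vortSupport_eq hs hω₀ ht]; exact hω₀.isCompact_support
  support_away := by
    rw [hγ.vortSupport_eq hs hω₀ ht]; exact hω₀.support_away
  nonpos r z hr hz := (hγ.omegaTheta_preserved hs hω₀ hr z ht).2 (hω₀.nonpos r z hr hz)

/-- The Riccati inequality for `Q` bounds the time of existence. -/
theorem IsFlowLine.lifespan_le (hT : 0 < T) :
    T ≤ 1 / (kappa (upperSupport ω₀) * Q ω₀) := by
  have hK := hω₀.isCompact_support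
  obtain ⟨R, hR⟩ := exists_impulse_eq hs hK
  have hpi : (2 * Real.pi) ≠ 0 := by positivity
  have hQ : ∀ g : ringSpace hs (vortSupport ω₀),
      Q (realField g.1) = (-(2 * Real.pi)⁻¹ • impulse hs R) g.1 := fun g => by
    rw [smul_apply, hR, smul_eq_mul]
    field_simp
  have h0 := hγ.realField_zero hs hω₀
  rw [← h0]
  refine le_one_div_of_riccati (q := fun t => Q (realField (γ t).1))
    (q' := fun t => Q (stretching (realField (γ t).1))) hT
    (by rw [h0]; exact kappa_pos hω₀.pos_of_mem hω₀.isCompact_upperSupport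
          hω₀.upperSupport_nonempty)
    (by rw [h0]; exact hω₀.Q_pos) (fun t ht => ?_) (fun t ht => ?_)
  · rw [← realField_stretchField hs hK]
    simp only [hQ]
    exact hγ.hasDerivWithinAt_clm hs hω₀ _ ht
  · rw [h0]
    refine (isAxial_of_mem hs _).kappa_mul_Q_sq_le hs (memHs_of_mem hs _)
      (hasCompactSupport_of_mem hs hK _) hω₀.pos_of_mem (fun r z hr hz h => ?_)
      (fun r z hr hz => ?_)
    · exact omegaTheta_of_mem hs _ hr.le fun hmem => h ⟨hmem, hr.le, hz.le⟩
    · exact (hγ.omegaTheta_preserved hs hω₀ hr.le z ht).2 (hω₀.nonpos r z hr.le hz.le)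

/-- A flow line of `stretchField` solves the vortex stretching equation: the stretching term is
already divergence free, so that it equals its Helmholtz projection. -/
theorem IsFlowLine.isSolution (hT : 0 < T) :
    IsSolution s ω₀ T fun t => realField (γ t).1 := by
  have hK := hω₀.isCompact_support
  have hm : ∀ t, MemHs s (realField (γ t).1) := fun t => memHs_of_mem hs _
  have hst : ∀ t, MemHs s (stretching (realField (γ t).1)) := fun t => (hm t).stretching hs
  have hdf : ∀ g : ringSpace hs (vortSupport ω₀), MemHsDf s (realField g.1) := fun g =>
    (isAxial_of_mem hs g).memHsDf (memHs_of_mem hs g) (hasCompactSupport_of_mem hs hK g)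
  refine ⟨hT, hγ.realField_zero hs hω₀, fun t _ => hdf _, fun t => stretching (realField (γ t).1),
    fun t _ => ⟨hst t, ?_, memHsGr_sub_self (hst t)⟩, fun t ht => ?_, fun t ht => ?_⟩
  · have h := hdf (stretchField hs hK (γ t))
    rwa [realField_stretchField] at h
  · have h := (hasDerivWithinAt_iff_tendsto_slope.1 ((hγ.2 t ht).mono
      (Ico_subset_Ici_self : Ico 0 T ⊆ Ici 0)))
    rw [tendsto_iff_edist_tendsto_0] at h
    refine h.congr fun τ => ?_
    have h1 := ((hm τ).sub (hm t)).const_smul (τ - t)⁻¹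
    rw [← enorm_toSob (h1.sub (hst t)), toSob_sub h1 (hst t), toSob_smul _ ((hm τ).sub (hm t)),
      toSob_sub (hm τ) (hm t), toSob_realField, toSob_realField, edist_eq_enorm_sub,
      slope_def_module]
    rfl
  · obtain ⟨C, hC⟩ := lipschitzOnWith_stretchField hs hK (‖γ t‖ + 1)
    have hcont : ContinuousAt (stretchField hs hK) (γ t) :=
      (hC.continuousOn).continuousAt (Metric.closedBall_mem_nhds_of_mem (by simp))
    have h := hcont.tendsto.comp ((hγ.continuousOn) t ht)
    rw [tendsto_iff_edist_tendsto_0] at h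
    refine h.congr fun τ => ?_
    rw [← enorm_toSob ((hst τ).sub (hst t)), toSob_sub (hst τ) (hst t), edist_eq_enorm_sub]
    rfl

end

end VortexStretching

theorem theorem1p2 (s : ℝ) (hs : 3 / 2 < s)
    (ω₀ : VortexStretching.E3 → VortexStretching.E3)
    (hω₀ : VortexStretching.IsCollidingRings s ω₀) :
    0 < VortexStretching.kappa (VortexStretching.upperSupport ω₀) ∧
    ∃ (Tmax : ℝ) (ω : ℝ → VortexStretching.E3 → VortexStretching.E3),
      VortexStretching.IsMaximalSolution s ω₀ Tmax ω ∧
      (∀ t ∈ Set.Ico 0 Tmax, VortexStretching.IsCollidingRings s (ω t) ∧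
        VortexStretching.vortSupport (ω t) = VortexStretching.vortSupport ω₀) ∧
      Filter.Tendsto (fun t => VortexStretching.hsNorm s (ω t)) (nhdsWithin Tmax (Set.Iio Tmax))
        (nhds ⊤) ∧
      Tmax ≤ 1 / (VortexStretching.kappa (VortexStretching.upperSupport ω₀) *
        VortexStretching.Q ω₀) := by
  open VortexStretching in
  have hκ := kappa_pos hω₀.pos_of_mem hω₀.isCompact_upperSupport hω₀.upperSupport_nonempty
  have hK := hω₀.isCompact_support
  have : CompleteSpace (ringSpace hs (vortSupport ω₀)) :=
    (isClosed_ringSpace hs _).completeSpace_coe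
  obtain ⟨T, γ, hT, hγ, hblow⟩ := exists_maximal_flowLine (lipschitzOnWith_stretchField hs hK)
    (initialState hs hω₀) (M := 1 / (kappa (upperSupport ω₀) * Q ω₀)) fun T γ hγ => by
      rcases le_or_gt T 0 with h | h
      · exact h.trans (one_div_nonneg.2 (mul_pos hκ hω₀.Q_pos).le)
      · exact hγ.lifespan_le hs hω₀ h
  have hsol := hγ.isSolution hs hω₀ hT
  refine ⟨hκ, T, fun t => realField (γ t).1, ⟨hsol, fun T' ω' h' => ?_⟩, fun t ht =>
    ⟨hγ.isCollidingRings hs hω₀ ht, hγ.vortSupport_eq hs hω₀ ht⟩, ?_, hγ.lifespan_le hs hω₀ hT⟩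
  · have heq : ∀ t ∈ Set.Ico 0 T', t < T → ω' t = realField (γ t).1 := fun t ht hlt =>
      h'.eq hs hsol ht ⟨ht.1, hlt⟩
    have hle : T' ≤ T := by
      by_contra! hlt
      -- a longer solution would be bounded in `H^s` near the blow-up time
      obtain ⟨v', -, hd⟩ := h'.exists_hasDerivWithinAt
      have hTmem : T ∈ Set.Ico 0 T' := ⟨hT.le, hlt⟩
      have hcont := (hd T hTmem).continuousWithinAt.norm
      have hmono : nhdsWithin T (Set.Iio T) ≤ nhdsWithin T (Set.Ico 0 T') := by
        refine nhdsWithin_le_of_mem ?_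
        filter_upwards [Ioo_mem_nhdsLT hT] with t ht
        exact ⟨ht.1.le, ht.2.trans hlt⟩
      refine not_tendsto_nhds_of_tendsto_atTop hblow _
        ((hcont.tendsto.mono_left hmono).congr' ?_)
      filter_upwards [Ioo_mem_nhdsLT hT] with t ht
      rw [heq t ⟨ht.1.le, ht.2.trans hlt⟩ ht.2, toSob_realField]
      rfl
    exact ⟨hle, fun t ht => heq t ht (ht.2.trans_le hle)⟩
  · simp only [hsNorm_realField, ← ofReal_norm]
    exact ENNReal.tendsto_ofReal_atTop.comp hblow
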